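/- **Setting.** Fix integers $q<K$, a $q\times K$ real matrix $\widetilde G$ of rank $q$, and $s\in\{-\tfrac12,\tfrac12\}$. All the other objects below depend on a stage $t=1,2,\dots$ (suppressed in the notation); limits and the symbol $o(\cdot)$ are for $t\to\infty$, along which $n\to\infty$ and $p\to\infty$. At each stage there are sample sizes $n_1,\dots,n_K$ with $n=n_1+\dots+n_K$, a dimension $p$, and probability densities $\omega_1,\dots,\omega_p$ on $\mathbb R$ with finite means $a_i$ and variances $\beta_i^2$; put $$W=\mathrm{diag}(\beta_1^2,\dots,\beta_p^2)+aa^T,\qquad D=\mathrm{diag}\Big(\frac n{n_1},\dots,\frac n{n_K}\Big),\qquad G=(\widetilde GD\widetilde G^T)^{s}\,\widetilde G,\qquad (d_{\alpha\beta})=G^TG,\qquad D_\theta=G\otimes W^{1/2}.$$ One observes vectors $Y_{\alpha i}\in\mathbb R^p$ ($1\le\alpha\le K$, $1\le i\le n_\alpha$), with sample means $\overline Y_\alpha$ and sample covariance matrices $\widehat\Sigma_\alpha$ (divisor $n_\alpha-1$). Write $\mu=(\mu_1^T,\dots,\mu_K^T)^T$ and $\widehat\mu=(\overline Y_1^T,\dots,\overline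 Y_K^T)^T$, and assume: * (A1) $Y_{\alpha i}=\Gamma_\alpha Z_{\alpha i}+\mu_\alpha$, where $\Gamma_\alpha$ is a $p\times m$ matrix, $p\le m$, $\Gamma_\alpha\Gamma_\alpha^T=\Sigma_\alpha$, the random vectors $Z_{\alpha i}\in\mathbb R^m$ are all independent, are identically distributed within each sample $\alpha$, and have mean $0$ and covariance matrix $I_m$. * (A2) The coordinates $z_{\alpha is}$ of $Z_{\alpha i}$ satisfy $E z_{\alpha is}^4=3+\Delta<\infty$ with one constant $\Delta$, and $E\big(z_{\alpha is_1}^{\varsigma_1}\cdots z_{\alpha is_r}^{\varsigma_r}\big)=E(z_{\alpha is_1}^{\varsigma_1})\cdots E(z_{\alpha is_r}^{\varsigma_r})$ for distinct $s_1,\dots,s_r$ and positive integers $\varsigma_1,\dots,\varsigma_r$ with $\sum_l\varsigma_l\le 8$, whenever these expectations exist. * (A3) $n_\alpha/n\to\tau_\alpha\in(0,1)$ for every $\alpha$. * (A4) $\mathrm{tr}(W\Sigma_\alpha W\Sigma_\beta W\Sigma_\gamma W\Sigma_\beta)=o\{\mathrm{tr}(W\Sigma_\alpha W\Sigma_\beta)\,\mathrm{tr}(W\Sigma_\gamma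 W\Sigma_\beta)\}$ for all $\alpha,\beta,\gamma$. Define $$T_n=\sum_\alpha d_{\alpha\alpha}\frac{\sum_{i\ne j}Y_{\alpha i}^TWY_{\alpha j}}{n_\alpha(n_\alpha-1)}+\sum_{\alpha\ne\beta}d_{\alpha\beta}\frac{\sum_{i,j}Y_{\alpha i}^TWY_{\beta j}}{n_\alpha n_\beta},\qquad T_{n0}=\|D_\theta(\widehat\mu-\mu)\|^2-\sum_\alpha\frac{d_{\alpha\alpha}}{n_\alpha}\mathrm{tr}(W\widehat\Sigma_\alpha),$$ $$S_n=(D_\theta\mu)^TD_\theta(\widehat\mu-\mu),\qquad \sigma^2(T_{n0})=\mathrm{Var}(T_{n0}),$$ $$\widehat\sigma^2(T_{n0})=2\Big(\sum_\alpha\frac{d_{\alpha\alpha}^2\,\widehat{\mathrm{tr}(W\Sigma_\alpha)^2}}{n_\alpha(n_\alpha-1)}+\sum_{\alpha\ne\beta}\frac{d_{\alpha\beta}^2\,\mathrm{tr}(W\widehat\Sigma_\alpha W\widehat\Sigma_\beta)}{n_\alpha n_\beta}\Big),$$ $$\widehat{\mathrm{tr}(W\Sigma_\alpha)^2}=\frac{n_\alpha-1}{n_\alpha(n_\alpha-2)(n_\alpha-3)}\Big((n_\alpha-1)(n_\alpha-2)\,\mathrm{tr}\big((W\widehat\Sigma_\alpha)^2\big)+\big(\mathrm{tr}\,W\widehat\Sigma_\alpha\big)^2-n_\alpha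 Q_\alpha\Big),$$ with $Q_\alpha=(n_\alpha-1)^{-1}\sum_i\|W^{1/2}(Y_{\alpha i}-\overline Y_\alpha)\|^4$. Let $\sigma(T_{n0})$ and $\widehat\sigma(T_{n0})$ be the nonnegative square roots (in a ratio with denominator $\widehat\sigma(T_{n0})$, a negative $\widehat\sigma^2(T_{n0})$ is replaced by $0$ and a ratio with denominator $0$ is read as $0$). **Theorem.** Assume (A1)–(A4), that $\sigma^2(T_{n0})>0$ for all large $t$, and the local-alternative condition $\mathrm{Var}(S_n)=o(\sigma^2(T_{n0}))$. Let $\alpha\in(0,1)$ and let $z_\alpha$ be the upper $\alpha$-quantile of the standard normal distribution, whose distribution function is $\Phi$, so that $\Phi(z_\alpha)=1-\alpha$. Then $$P\Big(\frac{T_n}{\widehat\sigma(T_{n0})}\ge z_\alpha\Big)=\Phi\Big(-z_\alpha+\frac{\|D_\theta\mu\|^2}{\sigma(T_{n0})}\Big)\,(1+o(1)).$$ -/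

import Mathlib

open MeasureTheory ProbabilityTheory Filter Topology Asymptotics Matrix
open scoped Kronecker

namespace GLHT

noncomputable section

/-- `f` is a probability density on the line with finite second moment. -/
structure IsWeightDensity (f : ℝ → ℝ) : Prop where
  measurable : Measurable f
  nonneg : ∀ x, 0 ≤ f x
  integrable : Integrable f
  integral_eq_one : ∫ x, f x = 1
  integrable_sq : Integrable (fun x => x ^ 2 * f x)

/-- Mean of the density `f`. -/
def densityMean (f : ℝ → ℝ) : ℝ := ∫ x, x * f x

/-- Variance of the density `f`. -/
def densityVar (f : ℝ → ℝ) : ℝ := ∫ x, (x - densityMean f) ^ 2 * f x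

/-- `W = B + a aᵀ`, where `a` is the vector of means and `B` the diagonal matrix of variances of
the coordinate densities `w 0, …, w (p - 1)` of the product weight function. -/
def weightMatrix {p : ℕ} (w : Fin p → ℝ → ℝ) : Matrix (Fin p) (Fin p) ℝ :=
  Matrix.diagonal (fun i => densityVar (w i)) +
    Matrix.vecMulVec (fun i => densityMean (w i)) (fun i => densityMean (w i))

section Powers

open scoped MatrixOrder

/-- The positive semidefinite square root `W^{1/2}` of a positive semidefinite matrix. -/
def matSqrt {p : ℕ} (W : Matrix (Fin p) (Fin p) ℝ) : Matrix (Fin p) (Fin p) ℝ := CFC.sqrt W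

/-- The real power `A^s` of a positive (semi)definite matrix, by functional calculus. -/
def matPow {q : ℕ} (A : Matrix (Fin q) (Fin q) ℝ) (s : ℝ) : Matrix (Fin q) (Fin q) ℝ :=
  CFC.rpow A s

end Powers

/-- Total sample size `n = n_1 + … + n_K`. -/
def totalSize {K : ℕ} (n : Fin K → ℕ) : ℕ := ∑ a, n a

/-- `D = diag(n / n_1, …, n / n_K)`. -/
def sizeRatio {K : ℕ} (n : Fin K → ℕ) : Matrix (Fin K) (Fin K) ℝ :=
  Matrix.diagonal (fun a => (totalSize n : ℝ) / (n a : ℝ))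

/-- The normalized coefficient matrix `G = (G₀ D G₀ᵀ)^s G₀` built from the given matrix `G₀`. -/
def normCoef {K q : ℕ} (G₀ : Matrix (Fin q) (Fin K) ℝ) (s : ℝ) (n : Fin K → ℕ) :
    Matrix (Fin q) (Fin K) ℝ :=
  matPow (G₀ * sizeRatio n * G₀ᵀ) s * G₀

/-- Squared Euclidean norm. -/
def sqNorm {ι : Type*} [Fintype ι] (v : ι → ℝ) : ℝ := v ⬝ᵥ v

section Statistics

/- In this section `y a i` is the `i`-th observation (a vector in `ℝ^p`) of the `a`-th sample,
`G` is the (normalized) coefficient matrix, so that `d_{ab} = (Gᵀ * G) a b`. -/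

variable {K q p : ℕ} {n : Fin K → ℕ}

/-- Sample mean of the `a`-th sample. -/
def sampleMean (y : (a : Fin K) → Fin (n a) → Fin p → ℝ) (a : Fin K) : Fin p → ℝ :=
  (n a : ℝ)⁻¹ • ∑ i, y a i

/-- Sample covariance matrix of the `a`-th sample. -/
def sampleCov (y : (a : Fin K) → Fin (n a) → Fin p → ℝ) (a : Fin K) :
    Matrix (Fin p) (Fin p) ℝ :=
  ((n a : ℝ) - 1)⁻¹ •
    ∑ i, Matrix.vecMulVec (y a i - sampleMean y a) (y a i - sampleMean y a)

/-- The U-statistic `S_{aa}` of one sample. -/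
def uSelf (W : Matrix (Fin p) (Fin p) ℝ) (y : (a : Fin K) → Fin (n a) → Fin p → ℝ)
    (a : Fin K) : ℝ :=
  (∑ i, ∑ j, if i ≠ j then y a i ⬝ᵥ (W *ᵥ y a j) else 0) / ((n a : ℝ) * ((n a : ℝ) - 1))

/-- The U-statistic `S_{ab}` of two samples. -/
def uCross (W : Matrix (Fin p) (Fin p) ℝ) (y : (a : Fin K) → Fin (n a) → Fin p → ℝ)
    (a b : Fin K) : ℝ :=
  (∑ i, ∑ j, y a i ⬝ᵥ (W *ᵥ y b j)) / ((n a : ℝ) * (n b : ℝ))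

/-- The test statistic `T_n`. -/
def testStat (G : Matrix (Fin q) (Fin K) ℝ) (W : Matrix (Fin p) (Fin p) ℝ)
    (y : (a : Fin K) → Fin (n a) → Fin p → ℝ) : ℝ :=
  (∑ a, (Gᵀ * G) a a * uSelf W y a) +
    ∑ a, ∑ b, if a ≠ b then (Gᵀ * G) a b * uCross W y a b else 0

/-- `D_θ = G ⊗ W^{1/2}`. -/
def dTheta (G : Matrix (Fin q) (Fin K) ℝ) (W : Matrix (Fin p) (Fin p) ℝ) :
    Matrix (Fin q × Fin p) (Fin K × Fin p) ℝ :=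
  G ⊗ₖ matSqrt W

/-- The long vector `(v_1ᵀ, …, v_Kᵀ)ᵀ`. -/
def stack (v : Fin K → Fin p → ℝ) : Fin K × Fin p → ℝ := fun x => v x.1 x.2

/-- `‖D_θ μ‖²`. -/
def signal (G : Matrix (Fin q) (Fin K) ℝ) (W : Matrix (Fin p) (Fin p) ℝ)
    (mu : Fin K → Fin p → ℝ) : ℝ :=
  sqNorm (dTheta G W *ᵥ stack mu)

/-- `T_{n0} = ‖D_θ (μ̂ - μ)‖² - ∑ₐ (d_{aa} / n_a) tr (W Σ̂_a)`. -/
def nullStat (G : Matrix (Fin q) (Fin K) ℝ) (W : Matrix (Fin p) (Fin p) ℝ)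
    (mu : Fin K → Fin p → ℝ) (y : (a : Fin K) → Fin (n a) → Fin p → ℝ) : ℝ :=
  sqNorm (dTheta G W *ᵥ (stack (sampleMean y) - stack mu)) -
    ∑ a, (Gᵀ * G) a a / (n a : ℝ) * (W * sampleCov y a).trace

/-- `S_n = (D_θ μ)ᵀ D_θ (μ̂ - μ)`. -/
def linStat (G : Matrix (Fin q) (Fin K) ℝ) (W : Matrix (Fin p) (Fin p) ℝ)
    (mu : Fin K → Fin p → ℝ) (y : (a : Fin K) → Fin (n a) → Fin p → ℝ) : ℝ :=
  (dTheta G W *ᵥ stack mu) ⬝ᵥ (dTheta G W *ᵥ (stack (sampleMean y) - stack mu))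

/-- `Q_a = (n_a - 1)⁻¹ ∑ᵢ ‖W^{1/2} (Y_{ai} - Ȳ_a)‖⁴`. -/
def quartic (W : Matrix (Fin p) (Fin p) ℝ) (y : (a : Fin K) → Fin (n a) → Fin p → ℝ)
    (a : Fin K) : ℝ :=
  ((n a : ℝ) - 1)⁻¹ * ∑ i, sqNorm (matSqrt W *ᵥ (y a i - sampleMean y a)) ^ 2

/-- The estimator of `tr ((W Σ_a)²)`. -/
def trSqHat (W : Matrix (Fin p) (Fin p) ℝ) (y : (a : Fin K) → Fin (n a) → Fin p → ℝ)
    (a : Fin K) : ℝ :=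
  ((n a : ℝ) - 1) / ((n a : ℝ) * ((n a : ℝ) - 2) * ((n a : ℝ) - 3)) *
    (((n a : ℝ) - 1) * ((n a : ℝ) - 2) * ((W * sampleCov y a) ^ 2).trace +
      (W * sampleCov y a).trace ^ 2 - (n a : ℝ) * quartic W y a)

/-- The variance estimator `σ̂²(T_{n0})`. -/
def varHat (G : Matrix (Fin q) (Fin K) ℝ) (W : Matrix (Fin p) (Fin p) ℝ)
    (y : (a : Fin K) → Fin (n a) → Fin p → ℝ) : ℝ :=
  2 * ((∑ a, (Gᵀ * G) a a ^ 2 * trSqHat W y a / ((n a : ℝ) * ((n a : ℝ) - 1))) +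
    ∑ a, ∑ b, if a ≠ b then
      (Gᵀ * G) a b ^ 2 * (W * sampleCov y a * W * sampleCov y b).trace / ((n a : ℝ) * (n b : ℝ))
    else 0)

/-- The studentized statistic `T_n / σ̂(T_{n0})`. -/
def studentized (G : Matrix (Fin q) (Fin K) ℝ) (W : Matrix (Fin p) (Fin p) ℝ)
    (y : (a : Fin K) → Fin (n a) → Fin p → ℝ) : ℝ :=
  testStat G W y / Real.sqrt (varHat G W y)

end Statistics

/-- The multivariate factor model `Y_{ai} = Γ_a Z_{ai} + μ_a`, `Γ_a Γ_aᵀ = Σ_a`: all the vectors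
`Z_{ai}` are independent, they are identically distributed within each sample, and they have mean
zero and identity covariance matrix. -/
structure FactorModel {K : ℕ} (n : Fin K → ℕ) (p m : ℕ) {Ω : Type*} [MeasurableSpace Ω]
    (P : Measure Ω) (mu : Fin K → Fin p → ℝ) (Sigma : Fin K → Matrix (Fin p) (Fin p) ℝ)
    (Gamma : Fin K → Matrix (Fin p) (Fin m) ℝ)
    (Z : (a : Fin K) → Fin (n a) → Ω → Fin m → ℝ)
    (Y : (a : Fin K) → Fin (n a) → Ω → Fin p → ℝ) : Prop where
  dim_le : p ≤ m
  loading : ∀ a, Gamma a * (Gamma a)ᵀ = Sigma a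
  measurable : ∀ a i, Measurable (Z a i)
  indep : iIndepFun (fun x : (a : Fin K) × Fin (n a) => Z x.1 x.2) P
  identDistrib : ∀ a i j, IdentDistrib (Z a i) (Z a j) P P
  mean_zero : ∀ a i s, ∫ ω, Z a i ω s ∂P = 0
  cov_one : ∀ a i s t, cov[fun ω => Z a i ω s, fun ω => Z a i ω t; P] =
    (1 : Matrix (Fin m) (Fin m) ℝ) s t
  model : ∀ a i ω, Y a i ω = Gamma a *ᵥ Z a i ω + mu a

/-- The coordinates of the `Z_{ai}` have the finite fourth moment `3 + Δ`, and the mixed moments of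
distinct coordinates of one vector, of total order at most eight, factor (whenever the expectations
in question exist). -/
structure PseudoIndependent {K : ℕ} {n : Fin K → ℕ} {m : ℕ} {Ω : Type*} [MeasurableSpace Ω]
    (P : Measure Ω) (Δ : ℝ) (Z : (a : Fin K) → Fin (n a) → Ω → Fin m → ℝ) : Prop where
  integrable_fourth : ∀ a i s, Integrable (fun ω => Z a i ω s ^ 4) P
  fourth : ∀ a i s, ∫ ω, Z a i ω s ^ 4 ∂P = 3 + Δ
  factor : ∀ a i (r : ℕ) (s : Fin r → Fin m) (e : Fin r → ℕ), 0 < r → Function.Injective s →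
    (∀ l, 0 < e l) → ∑ l, e l ≤ 8 →
    (∀ l, Integrable (fun ω => Z a i ω (s l) ^ e l) P) →
    Integrable (fun ω => ∏ l, Z a i ω (s l) ^ e l) P →
    ∫ ω, ∏ l, Z a i ω (s l) ^ e l ∂P = ∏ l, ∫ ω, Z a i ω (s l) ^ e l ∂P

/-- The standard normal distribution function `Φ`. -/
def Phi (x : ℝ) : ℝ := cdf (gaussianReal 0 1) x

end

end GLHT

/-!
# Asymptotic power of the normal-reference test under local alternatives

With `V = W^{1/2}`, the standardized observations `ζ_{ai} = V (Y_{ai} - μ_a) = V Γ_a Z_{ai}` are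
independent and centered with covariance matrices `Λ_a = V Σ_a V`, and `T_n = T_{n0} + 2 S_n +
‖D_θ μ‖²` (`testStat_decomp`), where `T_{n0}` is the quadratic form `∑ c_{xy} ⟨ζ_x, ζ_y⟩` over pairs
`x ≠ y` of observations (`nullStat_eq_quadForm`). The kernels `c_{xy} ⟨ζ_x, ζ_y⟩` are degenerate:
they average to zero over either argument. Three facts give the theorem.

*Central limit theorem.* For a degenerate quadratic form `T` with row sums `R_x = ∑_y κ_{xy}`, the
part `T - 2 R_x` does not involve the coordinate `x`. Expanding `E R_x e^{iuT}` around that part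
yields `φ' ≈ -u φ` for the characteristic function `φ` of a standardized `T`, with one error from
`∑ R_x² - E ∑ R_x²` and one from `∑ E |R_x|³` (`DegenerateKernels.norm_charFun_sub_le`). The second
is small because no observation carries more than a share `1 / min n_a` of the variance
(`sum_pairCoef_sq_mul_le`) and fourth moments are of the order of squared second moments
(`sqrt_integral_pow_four_sum_le`; this is where the factorization of mixed moments enters). The first
is split into parts of order one, two and three, and almost orthogonality bounds their second
moments; the part of order two is governed by the quotients
`tr (Λ_x Λ_y Λ_x Λ_w) / (tr (Λ_x Λ_y) tr (Λ_x Λ_w))`, which vanish in the limit by the trace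
condition (`DegenerateKernels.integral_sq_sum_rowForm_sq_sub_le`).

*Variance estimation.* The estimator `σ̂²` depends on the data only through the inner products
`⟨ζ_x, ζ_y⟩` with `x ≠ y` (`varHat_eq`). Up to a relative error of order `1 / min n_a` in mean it is
`2 ∑ κ_{xy}²`, whose mean is `σ²` and whose relative fluctuations vanish by the fourth moment bounds,
so that `σ̂² / σ² → 1` in probability (`measure_varEst_error_le`).

*Slutsky.* `S_n / σ → 0` in probability by Chebyshev's inequality. The rejection event is
`z - ‖D_θ μ‖² / σ ≤ T_{n0} / σ + o_P(1)` (`rejection_iff`), and since the convergence of distribution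
functions to `Φ` is uniform, the drifting threshold does no harm (`tendsto_real_sub_Phi`). Finally
`Φ (-z + ‖D_θ μ‖² / σ) ≥ Φ (-z) > 0`, so the absolute error is also a relative one.
-/

namespace GLHT

set_option linter.unusedSectionVars false

noncomputable section

/-! ### Resampling one coordinate of a product measure -/

section Product

variable {I E : Type*} [Fintype I] [DecidableEq I] [MeasurableSpace E]
  (ν : I → Measure E) [∀ x, IsProbabilityMeasure (ν x)]

/-- Replacing one coordinate of a product sample by an independent copy does not change the law. -/
lemma measurePreserving_update_prod (v : I) :
    MeasurePreserving (fun r : E × (I → E) => Function.update r.2 v r.1)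
      ((ν v).prod (Measure.pi ν)) (Measure.pi ν) := by
  have hm : Measurable (fun r : E × (I → E) => Function.update r.2 v r.1) := by
    refine measurable_pi_lambda _ fun y => ?_
    by_cases h : y = v
    · subst h; simpa using measurable_fst
    · simp only [Function.update_of_ne h]
      exact (measurable_pi_apply y).comp measurable_snd
  refine ⟨hm, (Measure.pi_eq fun s hs => ?_).symm⟩
  rw [Measure.map_apply hm (MeasurableSet.univ_pi hs)]
  have : (fun r : E × (I → E) => Function.update r.2 v r.1) ⁻¹' (Set.univ.pi s) =
      s v ×ˢ (Set.univ.pi (Function.update s v Set.univ)) := by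
    ext r
    simp only [Set.mem_preimage, Set.mem_univ_pi, Set.mem_prod]
    constructor
    · intro h
      refine ⟨by simpa using h v, fun y => ?_⟩
      by_cases hy : y = v
      · subst hy; simp
      · simpa [Function.update_of_ne hy] using h y
    · rintro ⟨h1, h2⟩ y
      by_cases hy : y = v
      · subst hy; simpa using h1
      · simpa [Function.update_of_ne hy] using h2 y
  rw [this, Measure.prod_prod, Measure.pi_pi, ← Finset.mul_prod_erase Finset.univ _ (Finset.mem_univ v),
    ← Finset.mul_prod_erase Finset.univ (fun i => ν i (s i)) (Finset.mem_univ v)]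
  simp only [Function.update_self, measure_univ, one_mul]
  congr 1
  refine Finset.prod_congr rfl fun y hy => ?_
  rw [Function.update_of_ne (Finset.ne_of_mem_erase hy)]

lemma integral_eq_integral_update {F : Type*} [NormedAddCommGroup F] [NormedSpace ℝ F]
    (v : I) {f : (I → E) → F} (hf : Integrable f (Measure.pi ν)) :
    ∫ z, f z ∂Measure.pi ν = ∫ z, ∫ w, f (Function.update z v w) ∂ν v ∂Measure.pi ν := by
  have hmp := measurePreserving_update_prod ν v
  have hint := hmp.integrable_comp_of_integrable hf
  have h2 := integral_prod_symm _ hint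
  simp only [Function.comp_apply] at h2
  rw [← h2]
  conv_lhs => rw [← hmp.map_eq]
  rw [integral_map hmp.measurable.aemeasurable]
  rw [hmp.map_eq]
  exact hf.aestronglyMeasurable

/-- A function that does not see the coordinate `v` is orthogonal to every function whose average
over the coordinate `v` vanishes. -/
lemma integral_smul_eq_zero {F : Type*} [NormedAddCommGroup F] [NormedSpace ℝ F] [CompleteSpace F]
    (v : I) {h : (I → E) → ℝ} {f : (I → E) → F}
    (hf : ∀ z w, f (Function.update z v w) = f z)
    (hh : ∀ z, ∫ w, h (Function.update z v w) ∂ν v = 0)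
    (hint : Integrable (fun z => h z • f z) (Measure.pi ν)) :
    ∫ z, h z • f z ∂Measure.pi ν = 0 := by
  rw [integral_eq_integral_update ν v hint]
  have : ∀ z, ∫ w, h (Function.update z v w) • f (Function.update z v w) ∂ν v = 0 := fun z => by
    simp only [hf]
    rw [integral_smul_const, hh, zero_smul]
  simp_rw [this, integral_zero]

lemma integral_mul_eq_zero (v : I) {h f : (I → E) → ℝ}
    (hf : ∀ z w, f (Function.update z v w) = f z)
    (hh : ∀ z, ∫ w, h (Function.update z v w) ∂ν v = 0)
    (hint : Integrable (fun z => h z * f z) (Measure.pi ν)) :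
    ∫ z, h z * f z ∂Measure.pi ν = 0 :=
  integral_smul_eq_zero ν v hf hh hint

end Product

/-! ### Second and fourth moments of sums with vanishing mixed moments -/

section Moments

variable {Ω J : Type*} [MeasurableSpace Ω] {P : Measure Ω}

lemma integrable_mul_of_memLp_two {f g : Ω → ℝ} (hf : MemLp f 2 P) (hg : MemLp g 2 P) :
    Integrable (fun ω => f ω * g ω) P := hf.integrable_mul hg

lemma memLp_two_mul_of_memLp_four {f g : Ω → ℝ} (hf : MemLp f 4 P) (hg : MemLp g 4 P) :
    MemLp (fun ω => f ω * g ω) 2 P := by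
  have : ENNReal.HolderTriple 4 4 2 := ⟨by
    have : (4 : ENNReal) = 2 * 2 := by norm_num
    rw [this, ENNReal.mul_inv (by simp) (by simp), ← mul_add, ENNReal.inv_two_add_inv_two, mul_one]⟩
  exact hg.mul' hf

lemma integrable_mul_four {a b c d : Ω → ℝ} (ha : MemLp a 4 P) (hb : MemLp b 4 P)
    (hc : MemLp c 4 P) (hd : MemLp d 4 P) :
    Integrable (fun ω => a ω * b ω * (c ω * d ω)) P :=
  integrable_mul_of_memLp_two (memLp_two_mul_of_memLp_four ha hb) (memLp_two_mul_of_memLp_four hc hd)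

lemma integrable_pow_four {a : Ω → ℝ} (ha : MemLp a 4 P) : Integrable (fun ω => a ω ^ 4) P :=
  (integrable_mul_four ha ha ha ha).congr (Eventually.of_forall fun ω => by ring)

/-- Cauchy–Schwarz for real random variables, with square roots. -/
lemma abs_integral_mul_le_sqrt {f g : Ω → ℝ} (hf : MemLp f 2 P) (hg : MemLp g 2 P) :
    |∫ ω, f ω * g ω ∂P| ≤ √(∫ ω, f ω ^ 2 ∂P) * √(∫ ω, g ω ^ 2 ∂P) := by
  have hfg := integrable_mul_of_memLp_two hf hg
  have hf2 := hf.integrable_sq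
  have hg2 := hg.integrable_sq
  set A := ∫ ω, f ω ^ 2 ∂P
  set B := ∫ ω, g ω ^ 2 ∂P
  set M := ∫ ω, f ω * g ω ∂P
  have hA : 0 ≤ A := integral_nonneg fun _ => sq_nonneg _
  have hB : 0 ≤ B := integral_nonneg fun _ => sq_nonneg _
  have key : ∀ r : ℝ, 0 ≤ B * (r * r) + 2 * M * r + A := by
    intro r
    have h0 : 0 ≤ ∫ ω, (f ω + r * g ω) ^ 2 ∂P := integral_nonneg fun _ => sq_nonneg _
    have h1 : ∫ ω, (f ω + r * g ω) ^ 2 ∂P = B * (r * r) + 2 * M * r + A := by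
      have : ∀ ω, (f ω + r * g ω) ^ 2 = f ω ^ 2 + ((2 * r) * (f ω * g ω) + (r * r) * g ω ^ 2) :=
        fun ω => by ring
      simp_rw [this]
      rw [integral_add hf2 ((hfg.const_mul _).fun_add (hg2.const_mul _)),
        integral_add (hfg.const_mul _) (hg2.const_mul _), integral_const_mul, integral_const_mul]
      simp only [A, B, M]
      ring
    linarith
  have := discrim_le_zero key
  rw [discrim] at this
  rw [← Real.sqrt_mul hA]
  apply Real.abs_le_sqrt
  nlinarith

lemma integral_mul_sq_le_sqrt {f g : Ω → ℝ} (hf : MemLp f 4 P) (hg : MemLp g 4 P) :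
    ∫ ω, f ω ^ 2 * g ω ^ 2 ∂P ≤ √(∫ ω, f ω ^ 4 ∂P) * √(∫ ω, g ω ^ 4 ∂P) := by
  have hf2 : MemLp (fun ω => f ω ^ 2) 2 P := by
    simpa [pow_two] using memLp_two_mul_of_memLp_four hf hf
  have hg2 : MemLp (fun ω => g ω ^ 2) 2 P := by
    simpa [pow_two] using memLp_two_mul_of_memLp_four hg hg
  refine (le_abs_self _).trans ((abs_integral_mul_le_sqrt hf2 hg2).trans (le_of_eq ?_))
  simp_rw [← pow_mul]

/-- Almost orthogonality: if two summands are orthogonal unless they have the same key, and at most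
`N` summands share a key, then the second moment of the sum is at most `N` times the sum of the
second moments. -/
lemma integral_sq_sum_le_of_key {κ : Type*} [DecidableEq κ] (s : Finset J) (f : J → Ω → ℝ)
    (key : J → κ) (N : ℕ) (hN : ∀ j ∈ s, (s.filter fun i => key i = key j).card ≤ N)
    (hf : ∀ j ∈ s, MemLp (f j) 2 P)
    (horth : ∀ i ∈ s, ∀ j ∈ s, key i ≠ key j → ∫ ω, f i ω * f j ω ∂P = 0) :
    ∫ ω, (∑ j ∈ s, f j ω) ^ 2 ∂P ≤ N * ∑ j ∈ s, ∫ ω, f j ω ^ 2 ∂P := by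
  have hint : ∀ i ∈ s, ∀ j ∈ s, Integrable (fun ω => f i ω * f j ω) P := fun i hi j hj =>
    integrable_mul_of_memLp_two (hf i hi) (hf j hj)
  have h1 : ∫ ω, (∑ j ∈ s, f j ω) ^ 2 ∂P = ∑ i ∈ s, ∑ j ∈ s, ∫ ω, f i ω * f j ω ∂P := by
    simp_rw [pow_two, Finset.sum_mul_sum]
    rw [integral_finsetSum _ fun i hi => integrable_finsetSum _ fun j hj => hint i hi j hj]
    exact Finset.sum_congr rfl fun i hi => integral_finsetSum _ fun j hj => hint i hi j hj
  have h2 : ∀ i ∈ s, ∀ j ∈ s, ∫ ω, f i ω * f j ω ∂P ≤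
      if key i = key j then ((∫ ω, f i ω ^ 2 ∂P) + ∫ ω, f j ω ^ 2 ∂P) / 2 else 0 := by
    intro i hi j hj
    split_ifs with hk
    · rw [← integral_add (hf i hi).integrable_sq (hf j hj).integrable_sq, ← integral_div]
      refine integral_mono (hint i hi j hj)
        (((hf i hi).integrable_sq.add (hf j hj).integrable_sq).div_const 2) fun ω => ?_
      simp only
      nlinarith [sq_nonneg (f i ω - f j ω)]
    · exact (horth i hi j hj hk).le
  rw [h1]
  refine (Finset.sum_le_sum fun i hi => Finset.sum_le_sum fun j hj => h2 i hi j hj).trans ?_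
  set m : J → ℝ := fun j => ∫ ω, f j ω ^ 2 ∂P
  have hm : ∀ j, 0 ≤ m j := fun j => integral_nonneg fun _ => sq_nonneg _
  have h3 : ∑ i ∈ s, ∑ j ∈ s, (if key i = key j then (m i + m j) / 2 else 0) =
      ∑ i ∈ s, ∑ j ∈ s, (if key j = key i then m i else 0) := by
    have e1 : ∀ i j, (if key i = key j then (m i + m j) / 2 else 0) =
        (if key j = key i then m i else 0) / 2 + (if key i = key j then m j else 0) / 2 := by
      intro i j
      by_cases h : key i = key j
      · simp [h]; ring
      · simp [h, Ne.symm h]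
    simp_rw [e1, Finset.sum_add_distrib, ← Finset.sum_div]
    rw [Finset.sum_comm (f := fun i j => if key i = key j then m j else 0)]
    ring
  rw [h3, Finset.mul_sum]
  refine Finset.sum_le_sum fun i hi => ?_
  rw [← Finset.sum_filter, Finset.sum_const, nsmul_eq_mul]
  exact mul_le_mul_of_nonneg_right (by exact_mod_cast hN i hi) (hm i)

/-- Minkowski's inequality in `L²`, for second moments. -/
lemma sqrt_integral_sq_sum_le (s : Finset J) (f : J → Ω → ℝ) (hf : ∀ j ∈ s, MemLp (f j) 2 P) :
    √(∫ ω, (∑ j ∈ s, f j ω) ^ 2 ∂P) ≤ ∑ j ∈ s, √(∫ ω, f j ω ^ 2 ∂P) := by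
  have hnn : 0 ≤ ∑ j ∈ s, √(∫ ω, f j ω ^ 2 ∂P) := Finset.sum_nonneg fun _ _ => Real.sqrt_nonneg _
  rw [Real.sqrt_le_left hnn]
  have hint : ∀ i ∈ s, ∀ j ∈ s, Integrable (fun ω => f i ω * f j ω) P := fun i hi j hj =>
    integrable_mul_of_memLp_two (hf i hi) (hf j hj)
  simp_rw [pow_two (∑ j ∈ s, _), Finset.sum_mul_sum]
  rw [integral_finsetSum _ fun i hi => integrable_finsetSum _ fun j hj => hint i hi j hj]
  refine Finset.sum_le_sum fun i hi => ?_
  rw [integral_finsetSum _ fun j hj => hint i hi j hj]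
  exact Finset.sum_le_sum fun j hj =>
    (le_abs_self _).trans (abs_integral_mul_le_sqrt (hf i hi) (hf j hj))

/-- Fourth moments of sums: if `E X_a X_b X_c X_d = 0` whenever `d ∉ {a, b, c}`, then the square
root of the fourth moment of the sum is at most three times the sum of those of the summands.
Adding a summand `X` to a partial sum `S` changes the fourth moment only by `6 E S²X² + E X⁴`. -/
lemma sqrt_integral_pow_four_sum_le [DecidableEq J] [IsFiniteMeasure P] (s : Finset J)
    (X : J → Ω → ℝ) (hX : ∀ j ∈ s, MemLp (X j) 4 P)
    (horth : ∀ a ∈ s, ∀ b ∈ s, ∀ c ∈ s, ∀ d ∈ s, d ≠ a → d ≠ b → d ≠ c →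
      ∫ ω, X a ω * X b ω * (X c ω * X d ω) ∂P = 0) :
    √(∫ ω, (∑ j ∈ s, X j ω) ^ 4 ∂P) ≤ 3 * ∑ j ∈ s, √(∫ ω, X j ω ^ 4 ∂P) := by
  suffices H : ∀ F ⊆ s, √(∫ ω, (∑ j ∈ F, X j ω) ^ 4 ∂P) ≤ 3 * ∑ j ∈ F, √(∫ ω, X j ω ^ 4 ∂P) from
    H s subset_rfl
  intro F
  induction F using Finset.induction_on with
  | empty => intro _; simp
  | insert d F hd ih =>
    intro hFs
    have hds : d ∈ s := hFs (Finset.mem_insert_self _ _)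
    have hF : F ⊆ s := fun j hj => hFs (Finset.mem_insert_of_mem hj)
    have ih := ih hF
    set S : Ω → ℝ := fun ω => ∑ j ∈ F, X j ω with hSdef
    have hS : MemLp S 4 P := memLp_finsetSum _ fun j hj => hX j (hF hj)
    have hXd := hX d hds
    have e3 : ∫ ω, S ω * S ω * (S ω * X d ω) ∂P = 0 := by
      have : ∀ ω, S ω * S ω * (S ω * X d ω) =
          ∑ a ∈ F, ∑ b ∈ F, ∑ c ∈ F, X a ω * X b ω * (X c ω * X d ω) := by
        intro ω
        simp only [hSdef]
        rw [Finset.sum_mul_sum, Finset.sum_mul (s := F) (f := fun i => X i ω), Finset.sum_mul]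
        refine Finset.sum_congr rfl fun a _ => ?_
        rw [Finset.sum_mul_sum]
      have hi : ∀ a ∈ F, ∀ b ∈ F, ∀ c ∈ F,
          Integrable (fun ω => X a ω * X b ω * (X c ω * X d ω)) P := fun a ha b hb c hc =>
        integrable_mul_four (hX a (hF ha)) (hX b (hF hb)) (hX c (hF hc)) hXd
      simp_rw [this]
      rw [integral_finsetSum _ fun a ha => integrable_finsetSum _ fun b hb =>
        integrable_finsetSum _ fun c hc => hi a ha b hb c hc]
      refine Finset.sum_eq_zero fun a ha => ?_
      rw [integral_finsetSum _ fun b hb => integrable_finsetSum _ fun c hc => hi a ha b hb c hc]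
      refine Finset.sum_eq_zero fun b hb => ?_
      rw [integral_finsetSum _ fun c hc => hi a ha b hb c hc]
      refine Finset.sum_eq_zero fun c hc => ?_
      exact horth a (hF ha) b (hF hb) c (hF hc) d hds (fun h => hd (h ▸ ha))
        (fun h => hd (h ▸ hb)) (fun h => hd (h ▸ hc))
    have e1 : ∫ ω, X d ω * X d ω * (X d ω * S ω) ∂P = 0 := by
      have : ∀ ω, X d ω * X d ω * (X d ω * S ω) =
          ∑ a ∈ F, X d ω * X d ω * (X d ω * X a ω) := by
        intro ω; simp only [hSdef, Finset.mul_sum]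
      simp_rw [this]
      rw [integral_finsetSum _ fun a ha => integrable_mul_four hXd hXd hXd (hX a (hF ha))]
      refine Finset.sum_eq_zero fun a ha => ?_
      have had : a ≠ d := fun h => hd (h ▸ ha)
      exact horth d hds d hds d hds a (hF ha) had had had
    set A := ∫ ω, S ω ^ 4 ∂P
    set B := ∫ ω, X d ω ^ 4 ∂P
    have hA : 0 ≤ A := integral_nonneg fun _ => by positivity
    have hB : 0 ≤ B := integral_nonneg fun _ => by positivity
    have e2 : ∫ ω, S ω ^ 2 * X d ω ^ 2 ∂P ≤ √A * √B := integral_mul_sq_le_sqrt hS hXd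
    have tot : ∫ ω, (X d ω + S ω) ^ 4 ∂P = A + 6 * (∫ ω, S ω ^ 2 * X d ω ^ 2 ∂P) + B := by
      have : ∀ ω, (X d ω + S ω) ^ 4 = (S ω ^ 4 + 4 * (S ω * S ω * (S ω * X d ω))) +
          ((6 * (S ω ^ 2 * X d ω ^ 2) + 4 * (X d ω * X d ω * (X d ω * S ω))) + X d ω ^ 4) :=
        fun ω => by ring
      simp_rw [this]
      have i4 := integrable_pow_four hS
      have i0 := integrable_pow_four hXd
      have i3 := (integrable_mul_four hS hS hS hXd).const_mul 4
      have i1 := (integrable_mul_four hXd hXd hXd hS).const_mul 4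
      have i2 : Integrable (fun ω => 6 * (S ω ^ 2 * X d ω ^ 2)) P := by
        refine (((integrable_mul_four hS hS hXd hXd)).congr
          (Eventually.of_forall fun ω => ?_)).const_mul 6
        simp only; ring
      rw [integral_add (i4.fun_add i3) ((i2.fun_add i1).fun_add i0), integral_add i4 i3,
        integral_add (i2.fun_add i1) i0, integral_add i2 i1, integral_const_mul, integral_const_mul,
        integral_const_mul, e3, e1]
      simp only [A, B]
      ring
    simp_rw [Finset.sum_insert hd]
    change √(∫ ω, (X d ω + S ω) ^ 4 ∂P) ≤ 3 * (√B + ∑ j ∈ F, √(∫ ω, X j ω ^ 4 ∂P))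
    rw [tot]
    have hsA := Real.sqrt_nonneg A
    have hsB := Real.sqrt_nonneg B
    have : √(A + 6 * (∫ ω, S ω ^ 2 * X d ω ^ 2 ∂P) + B) ≤ √A + 3 * √B := by
      rw [Real.sqrt_le_left (by positivity)]
      nlinarith [Real.sq_sqrt hA, Real.sq_sqrt hB]
    linarith

end Moments

/-! ### Degenerate quadratic forms in independent variables -/

section Kernels

variable {I E : Type*} [Fintype I] [DecidableEq I] [MeasurableSpace E]

/-- The kernel `κ x y` evaluated at the coordinates `x` and `y` of a sample. -/
def ker (κ : I → I → E → E → ℝ) (x y : I) (z : I → E) : ℝ := κ x y (z x) (z y)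

/-- The row sum `∑_y κ x y`, half of the part of the quadratic form that involves coordinate `x`. -/
def rowForm (κ : I → I → E → E → ℝ) (x : I) (z : I → E) : ℝ := ∑ y, ker κ x y z

/-- The quadratic form `∑_x ∑_y κ x y`. -/
def quadForm (κ : I → I → E → E → ℝ) (z : I → E) : ℝ := ∑ x, rowForm κ x z

/-- A symmetric system of degenerate kernels, with second moments `V`, fourth moments controlled by
`C² V²`, and averages `β x y w` of the products `κ x y * κ x w` over the coordinate `x` whose
second moments are small of order `δ²`. The diagonal kernels vanish, so that sums over all pairs of
indices are sums over pairs of distinct ones. The averages are carried as data because their symmetry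
and their moments are easier to verify for a closed form than for an integral. -/
structure DegenerateKernels (ν : I → Measure E) (κ : I → I → E → E → ℝ)
    (β : I → I → I → E → E → ℝ) (V : I → I → ℝ) (C δ : ℝ) : Prop where
  symm : ∀ x y a b, κ x y a b = κ y x b a
  diag : ∀ x a b, κ x x a b = 0
  centered : ∀ x y, x ≠ y → ∀ b, ∫ a, κ x y a b ∂ν x = 0
  meas : ∀ x y, Measurable (fun r : E × E => κ x y r.1 r.2)
  memLp : ∀ x y, MemLp (ker κ x y) 4 (Measure.pi ν)
  sq : ∀ x y, ∫ z, ker κ x y z ^ 2 ∂Measure.pi ν = V x y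
  fourth : ∀ x y, ∫ z, ker κ x y z ^ 4 ∂Measure.pi ν ≤ C ^ 2 * V x y ^ 2
  const_nonneg : 0 ≤ C
  avg : ∀ x y w, x ≠ y → x ≠ w → ∀ a c, ∫ u, κ x y u a * κ x w u c ∂ν x = β x y w a c
  avg_symm : ∀ x y w a c, β x y w a c = β x w y c a
  avg_centered : ∀ x y w, y ≠ w → ∀ c, ∫ a, β x y w a c ∂ν y = 0
  avg_memLp : ∀ x y w, MemLp (ker (β x) y w) 2 (Measure.pi ν)
  delta_nonneg : 0 ≤ δ
  avg_sq : ∀ x y w, y ≠ w →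
    ∫ z, ker (β x) y w z ^ 2 ∂Measure.pi ν ≤ δ ^ 2 * (V x y * V x w)

variable {ν : I → Measure E} [∀ x, IsProbabilityMeasure (ν x)]
  {κ : I → I → E → E → ℝ} {β : I → I → I → E → E → ℝ} {V : I → I → ℝ} {C δ : ℝ}

lemma ker_update (κ : I → I → E → E → ℝ) {x y v : I} (hx : v ≠ x) (hy : v ≠ y) (z : I → E) (w : E) :
    ker κ x y (Function.update z v w) = ker κ x y z := by
  simp [ker, Function.update_of_ne hx.symm, Function.update_of_ne hy.symm]

namespace DegenerateKernels

variable (h : DegenerateKernels ν κ β V C δ)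
include h

lemma ker_symm (x y : I) (z : I → E) : ker κ x y z = ker κ y x z := h.symm _ _ _ _

lemma ker_diag (x : I) (z : I → E) : ker κ x x z = 0 := h.diag _ _ _

lemma V_nonneg (x y : I) : 0 ≤ V x y := by
  rw [← h.sq]; exact integral_nonneg fun _ => sq_nonneg _

lemma V_symm (x y : I) : V x y = V y x := by
  rw [← h.sq, ← h.sq]; simp_rw [h.ker_symm x y]

/-- The kernels average to zero over either coordinate, the diagonal ones being zero. -/
lemma ker_centered_left (x y : I) (z : I → E) :
    ∫ w, ker κ x y (Function.update z x w) ∂ν x = 0 := by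
  by_cases hxy : x = y
  · subst hxy; simp [h.ker_diag]
  · simpa [ker, Function.update_of_ne (Ne.symm hxy)] using h.centered x y hxy (z y)

lemma ker_centered_right (x y : I) (z : I → E) :
    ∫ w, ker κ x y (Function.update z y w) ∂ν y = 0 := by
  simp_rw [h.ker_symm x y]; exact h.ker_centered_left y x z

lemma memLp_two (x y : I) : MemLp (ker κ x y) 2 (Measure.pi ν) :=
  (h.memLp x y).mono_exponent (by norm_num)

lemma sqrt_fourth_le (x y : I) :
    √(∫ z, ker κ x y z ^ 4 ∂Measure.pi ν) ≤ C * V x y := by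
  rw [Real.sqrt_le_left (mul_nonneg h.const_nonneg (h.V_nonneg x y)), mul_pow]
  exact h.fourth x y

lemma rowForm_memLp (x : I) : MemLp (rowForm κ x) 4 (Measure.pi ν) :=
  memLp_finsetSum _ fun y _ => h.memLp x y

lemma quadForm_memLp : MemLp (quadForm κ) 4 (Measure.pi ν) :=
  memLp_finsetSum _ fun y _ => h.rowForm_memLp y

lemma rowForm_pow_four_le (x : I) :
    ∫ z, rowForm κ x z ^ 4 ∂Measure.pi ν ≤ 9 * C ^ 2 * (∑ y, V x y) ^ 2 := by
  have h1 : √(∫ z, (∑ y, ker κ x y z) ^ 4 ∂Measure.pi ν) ≤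
      3 * ∑ y, √(∫ z, ker κ x y z ^ 4 ∂Measure.pi ν) := by
    refine sqrt_integral_pow_four_sum_le _ (fun y => ker κ x y) (fun y _ => h.memLp x y) ?_
    intro a _ b _ c _ d _ hda hdb hdc
    by_cases hdx : d = x
    · subst hdx; simp [h.ker_diag]
    have hi := integrable_mul_four (h.memLp x a) (h.memLp x b) (h.memLp x c) (h.memLp x d)
    have := integral_mul_eq_zero ν d (h := ker κ x d)
      (f := fun z => ker κ x a z * ker κ x b z * ker κ x c z)
      (fun z w => by
        simp only [ker_update κ hdx hda, ker_update κ hdx hdb, ker_update κ hdx hdc])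
      (h.ker_centered_right x d) (hi.congr (Eventually.of_forall fun z => by simp only; ring))
    rw [← this]
    exact integral_congr_ae (Eventually.of_forall fun z => by simp only; ring)
  have h2 : √(∫ z, rowForm κ x z ^ 4 ∂Measure.pi ν) ≤ 3 * (C * ∑ y, V x y) := by
    refine h1.trans ?_
    rw [Finset.mul_sum (a := C)]
    exact mul_le_mul_of_nonneg_left (Finset.sum_le_sum fun y _ => h.sqrt_fourth_le x y)
      (by norm_num)
  have h3 : (0 : ℝ) ≤ 3 * (C * ∑ y, V x y) :=
    mul_nonneg (by norm_num) (mul_nonneg h.const_nonneg (Finset.sum_nonneg fun y _ => h.V_nonneg x y))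
  rw [Real.sqrt_le_left h3] at h2
  linarith [h2, show (3 * (C * ∑ y, V x y)) ^ 2 = 9 * C ^ 2 * (∑ y, V x y) ^ 2 by ring]

lemma rowForm_sq (x : I) : ∫ z, rowForm κ x z ^ 2 ∂Measure.pi ν = ∑ y, V x y := by
  have hint : ∀ y w, Integrable (fun z => ker κ x y z * ker κ x w z) (Measure.pi ν) := fun y w =>
    integrable_mul_of_memLp_two (h.memLp_two x y) (h.memLp_two x w)
  simp only [rowForm, pow_two, Finset.sum_mul_sum]
  rw [integral_finsetSum _ fun y _ => integrable_finsetSum _ fun w _ => hint y w]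
  refine Finset.sum_congr rfl fun y _ => ?_
  rw [integral_finsetSum _ fun w _ => hint y w, Finset.sum_eq_single y]
  · rw [← h.sq]; simp_rw [pow_two]
  · intro w _ hw
    by_cases hwx : w = x
    · subst hwx; simp [h.ker_diag]
    rw [← integral_mul_eq_zero ν w (h := ker κ x w) (f := ker κ x y)
      (fun z u => ker_update κ hwx hw z u) (h.ker_centered_right x w) (hint w y)]
    simp_rw [mul_comm]
  · simp

/-- Removing from the quadratic form all terms that involve the coordinate `x`. -/
lemma quadForm_sub_rowForm (x : I) (z : I → E) :
    quadForm κ z - 2 * rowForm κ x z =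
      ∑ a ∈ Finset.univ.erase x, ∑ b ∈ Finset.univ.erase x, ker κ a b z := by
  have h1 : quadForm κ z = rowForm κ x z + ∑ a ∈ Finset.univ.erase x, rowForm κ a z := by
    rw [quadForm, Finset.add_sum_erase _ (fun a => rowForm κ a z) (Finset.mem_univ x)]
  have h2 : ∀ a, rowForm κ a z = ker κ x a z + ∑ b ∈ Finset.univ.erase x, ker κ a b z := by
    intro a
    rw [rowForm, ← Finset.add_sum_erase _ _ (Finset.mem_univ x), h.ker_symm]
  have h3 : ∑ a ∈ Finset.univ.erase x, ker κ x a z = rowForm κ x z := by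
    rw [rowForm, ← Finset.add_sum_erase Finset.univ _ (Finset.mem_univ x), h.ker_diag, zero_add]
  rw [h1, Finset.sum_congr rfl fun a _ => h2 a, Finset.sum_add_distrib, h3]
  ring

lemma quadForm_sub_rowForm_update (x : I) (z : I → E) (w : E) :
    quadForm κ (Function.update z x w) - 2 * rowForm κ x (Function.update z x w) =
      quadForm κ z - 2 * rowForm κ x z := by
  rw [h.quadForm_sub_rowForm, h.quadForm_sub_rowForm]
  refine Finset.sum_congr rfl fun a ha => Finset.sum_congr rfl fun b hb => ?_
  exact ker_update κ (Finset.ne_of_mem_erase ha).symm (Finset.ne_of_mem_erase hb).symm z w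

/-- A row sum is orthogonal to every function of the other coordinates. -/
lemma integral_rowForm_smul_eq_zero {F : Type*} [NormedAddCommGroup F] [NormedSpace ℝ F]
    [CompleteSpace F] (x : I) {f : (I → E) → F}
    (hf : ∀ z w, f (Function.update z x w) = f z)
    (hint : ∀ y, Integrable (fun z => ker κ x y z • f z) (Measure.pi ν)) :
    ∫ z, rowForm κ x z • f z ∂Measure.pi ν = 0 := by
  simp only [rowForm, Finset.sum_smul]
  rw [integral_finsetSum _ fun y _ => hint y]
  exact Finset.sum_eq_zero fun y _ =>
    integral_smul_eq_zero ν x hf (h.ker_centered_left x y) (hint y)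

lemma integral_ker (x y : I) : ∫ z, ker κ x y z ∂Measure.pi ν = 0 := by
  have := integral_smul_eq_zero ν x (h := ker κ x y) (f := fun _ => (1 : ℝ)) (fun _ _ => rfl)
    (h.ker_centered_left x y) (by simpa using (h.memLp x y).integrable (by norm_num))
  simpa using this

lemma integral_quadForm : ∫ z, quadForm κ z ∂Measure.pi ν = 0 := by
  have hi : ∀ x y, Integrable (ker κ x y) (Measure.pi ν) := fun x y =>
    (h.memLp x y).integrable (by norm_num)
  simp only [quadForm, rowForm]
  rw [integral_finsetSum _ fun x _ => integrable_finsetSum _ fun y _ => hi x y]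
  refine Finset.sum_eq_zero fun x _ => ?_
  rw [integral_finsetSum _ fun y _ => hi x y]
  exact Finset.sum_eq_zero fun y _ => h.integral_ker x y

lemma integral_quadForm_sq :
    ∫ z, quadForm κ z ^ 2 ∂Measure.pi ν = 2 * ∑ x, ∑ y, V x y := by
  have hQ : MemLp (quadForm κ) 2 (Measure.pi ν) := h.quadForm_memLp.mono_exponent (by norm_num)
  have hR : ∀ x, MemLp (rowForm κ x) 2 (Measure.pi ν) := fun x =>
    (h.rowForm_memLp x).mono_exponent (by norm_num)
  have h1 : ∀ x, ∫ z, rowForm κ x z * quadForm κ z ∂Measure.pi ν = 2 * ∑ y, V x y := by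
    intro x
    have hd : MemLp (fun z => quadForm κ z - 2 * rowForm κ x z) 2 (Measure.pi ν) :=
      hQ.sub ((hR x).const_mul 2)
    have e0 := h.integral_rowForm_smul_eq_zero x (f := fun z => quadForm κ z - 2 * rowForm κ x z)
      (h.quadForm_sub_rowForm_update x)
      (fun y => integrable_mul_of_memLp_two (h.memLp_two x y) hd)
    have : ∀ z, rowForm κ x z * quadForm κ z =
        rowForm κ x z * (quadForm κ z - 2 * rowForm κ x z) + 2 * rowForm κ x z ^ 2 := by
      intro z; ring
    simp only [smul_eq_mul] at e0
    rw [integral_congr_ae (Eventually.of_forall this)]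
    rw [integral_add (integrable_mul_of_memLp_two (hR x) hd) ((hR x).integrable_sq.const_mul 2),
      e0, integral_const_mul, h.rowForm_sq, zero_add]
  have : ∀ z, quadForm κ z ^ 2 = ∑ x, rowForm κ x z * quadForm κ z := by
    intro z; rw [← Finset.sum_mul, ← quadForm, pow_two]
  simp_rw [this]
  rw [integral_finsetSum _ fun x _ => integrable_mul_of_memLp_two (hR x) hQ]
  simp_rw [h1]
  rw [← Finset.mul_sum]

end DegenerateKernels

end Kernels

/-! ### Concentration of the sum of the squared row sums -/

section Kernels

variable {I E : Type*} [Fintype I] [DecidableEq I] [MeasurableSpace E]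
variable {ν : I → Measure E} [∀ x, IsProbabilityMeasure (ν x)]
  {κ : I → I → E → E → ℝ} {β : I → I → I → E → E → ℝ} {V : I → I → ℝ} {C δ : ℝ}

namespace DegenerateKernels

variable (h : DegenerateKernels ν κ β V C δ)
include h

lemma integral_sq_mul_sq_of_disjoint {x y a b : I} (hxa : x ≠ a) (hxb : x ≠ b) (hya : y ≠ a)
    (hyb : y ≠ b) :
    ∫ z, (ker κ x y z ^ 2 - V x y) * (ker κ a b z ^ 2 - V a b) ∂Measure.pi ν = 0 := by
  have hind : iIndepFun (fun (i : I) (z : I → E) => z i) (Measure.pi ν) :=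
    iIndepFun_pi (X := fun _ => id) (fun _ => aemeasurable_id)
  have hpair := hind.indepFun_prodMk_prodMk (fun i => measurable_pi_apply i) x y a b hxa hxb hya hyb
  have hm : ∀ x y, Measurable (fun r : E × E => κ x y r.1 r.2 ^ 2 - V x y) := fun x y =>
    ((h.meas x y).pow_const 2).sub_const _
  have hpm : ∀ x y : I, AEMeasurable (fun z : I → E => (z x, z y)) (Measure.pi ν) := fun x y =>
    ((measurable_pi_apply x).prodMk (measurable_pi_apply y)).aemeasurable
  have := hpair.integral_fun_comp_mul_comp (hpm x y) (hpm a b)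
    (hm x y).aestronglyMeasurable (hm a b).aestronglyMeasurable
  have h0 : ∫ z, (κ x y (z x) (z y) ^ 2 - V x y) ∂Measure.pi ν = 0 := by
    rw [integral_sub (f := fun z : I → E => κ x y (z x) (z y) ^ 2) (h.memLp_two x y).integrable_sq
      (integrable_const _), integral_const]
    have := h.sq x y
    simp only [ker] at this
    simp [this]
  rw [h0, zero_mul] at this
  exact this

lemma sq_sub_memLp (x y : I) : MemLp (fun z => ker κ x y z ^ 2 - V x y) 2 (Measure.pi ν) := by
  refine MemLp.sub ?_ (memLp_const _)
  simpa [pow_two] using memLp_two_mul_of_memLp_four (h.memLp x y) (h.memLp x y)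

lemma sqrt_integral_sq_sub_le (x y : I) :
    √(∫ z, (ker κ x y z ^ 2 - V x y) ^ 2 ∂Measure.pi ν) ≤ C * V x y := by
  refine le_trans (Real.sqrt_le_sqrt ?_) (h.sqrt_fourth_le x y)
  have h2 := (h.memLp_two x y).integrable_sq
  have h4 := integrable_pow_four (h.memLp x y)
  have : ∀ z, (ker κ x y z ^ 2 - V x y) ^ 2 =
      ker κ x y z ^ 4 + (-(2 * V x y) * ker κ x y z ^ 2 + V x y ^ 2) := fun z => by ring
  simp_rw [this]
  rw [integral_add h4 ((h2.const_mul _).fun_add (integrable_const _)),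
    integral_add (h2.const_mul _) (integrable_const _), integral_const_mul, h.sq]
  simp only [integral_const, probReal_univ, smul_eq_mul, one_mul]
  nlinarith [sq_nonneg (V x y)]

/-- The variance of the sum of the squared kernels: only pairs that share a coordinate are
correlated. -/
lemma integral_sq_sum_sq_sub_le :
    ∫ z, (∑ x, ∑ y, (ker κ x y z ^ 2 - V x y)) ^ 2 ∂Measure.pi ν ≤
      4 * C ^ 2 * ∑ x, (∑ y, V x y) ^ 2 := by
  have hint : ∀ x y a b, Integrable (fun z => (ker κ x y z ^ 2 - V x y) *
      (ker κ a b z ^ 2 - V a b)) (Measure.pi ν) := fun x y a b =>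
    integrable_mul_of_memLp_two (h.sq_sub_memLp x y) (h.sq_sub_memLp a b)
  have hCV : ∀ x y, 0 ≤ C * V x y := fun x y => mul_nonneg h.const_nonneg (h.V_nonneg x y)
  have hle : ∀ x y a b, ∫ z, (ker κ x y z ^ 2 - V x y) * (ker κ a b z ^ 2 - V a b) ∂Measure.pi ν ≤
      (if x = a then (C * V x y) * (C * V a b) else 0) +
      (if x = b then (C * V x y) * (C * V a b) else 0) +
      ((if y = a then (C * V x y) * (C * V a b) else 0) +
      (if y = b then (C * V x y) * (C * V a b) else 0)) := by
    intro x y a b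
    have hnn := mul_nonneg (hCV x y) (hCV a b)
    have hb : ∫ z, (ker κ x y z ^ 2 - V x y) * (ker κ a b z ^ 2 - V a b) ∂Measure.pi ν ≤
        (C * V x y) * (C * V a b) := by
      refine (le_abs_self _).trans ((abs_integral_mul_le_sqrt (h.sq_sub_memLp x y)
        (h.sq_sub_memLp a b)).trans ?_)
      exact mul_le_mul (h.sqrt_integral_sq_sub_le x y) (h.sqrt_integral_sq_sub_le a b)
        (Real.sqrt_nonneg _) (hCV x y)
    by_cases h1 : x = a
    · rw [if_pos h1]; split_ifs <;> linarith
    by_cases h2 : x = b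
    · rw [if_pos h2]; split_ifs <;> linarith
    by_cases h3 : y = a
    · rw [if_pos h3]; split_ifs <;> linarith
    by_cases h4 : y = b
    · rw [if_pos h4, if_neg h1, if_neg h2, if_neg h3]; linarith
    rw [h.integral_sq_mul_sq_of_disjoint h1 h2 h3 h4]
    simp [h1, h2, h3, h4]
  have hexp : ∫ z, (∑ x, ∑ y, (ker κ x y z ^ 2 - V x y)) ^ 2 ∂Measure.pi ν =
      ∑ x, ∑ y, ∑ a, ∑ b,
        ∫ z, (ker κ x y z ^ 2 - V x y) * (ker κ a b z ^ 2 - V a b) ∂Measure.pi ν := by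
    have : ∀ z, (∑ x, ∑ y, (ker κ x y z ^ 2 - V x y)) ^ 2 =
        ∑ x, ∑ y, ∑ a, ∑ b, (ker κ x y z ^ 2 - V x y) * (ker κ a b z ^ 2 - V a b) := by
      intro z
      simp only [pow_two (∑ x, _), Finset.sum_mul]
      refine Finset.sum_congr rfl fun x _ => Finset.sum_congr rfl fun y _ => ?_
      simp only [Finset.mul_sum]
    simp_rw [this]
    rw [integral_finsetSum _ fun x _ => integrable_finsetSum _ fun y _ =>
      integrable_finsetSum _ fun a _ => integrable_finsetSum _ fun b _ => hint x y a b]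
    refine Finset.sum_congr rfl fun x _ => ?_
    rw [integral_finsetSum _ fun y _ =>
      integrable_finsetSum _ fun a _ => integrable_finsetSum _ fun b _ => hint x y a b]
    refine Finset.sum_congr rfl fun y _ => ?_
    rw [integral_finsetSum _ fun a _ => integrable_finsetSum _ fun b _ => hint x y a b]
    refine Finset.sum_congr rfl fun a _ => ?_
    rw [integral_finsetSum _ fun b _ => hint x y a b]
  rw [hexp]
  refine (Finset.sum_le_sum fun x _ => Finset.sum_le_sum fun y _ => Finset.sum_le_sum fun a _ =>
    Finset.sum_le_sum fun b _ => hle x y a b).trans (le_of_eq ?_)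
  simp only [Finset.sum_add_distrib]
  have hcol : ∀ x, ∑ y, C * V y x = ∑ y, C * V x y := fun x => by simp_rw [h.V_symm _ x]
  have e1 : ∑ x, ∑ y, ∑ a, ∑ b, (if x = a then (C * V x y) * (C * V a b) else 0) =
      ∑ x, (∑ y, C * V x y) ^ 2 := by
    refine Finset.sum_congr rfl fun x _ => ?_
    rw [pow_two, Finset.sum_mul]
    refine Finset.sum_congr rfl fun y _ => ?_
    rw [Finset.sum_comm]
    simp [Finset.mul_sum]
  have e2 : ∑ x, ∑ y, ∑ a, ∑ b, (if x = b then (C * V x y) * (C * V a b) else 0) =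
      ∑ x, (∑ y, C * V x y) ^ 2 := by
    refine Finset.sum_congr rfl fun x _ => ?_
    rw [pow_two, Finset.sum_mul]
    refine Finset.sum_congr rfl fun y _ => ?_
    rw [← hcol x]
    simp [Finset.mul_sum]
  have e3 : ∑ x, ∑ y, ∑ a, ∑ b, (if y = a then (C * V x y) * (C * V a b) else 0) =
      ∑ x, (∑ y, C * V x y) ^ 2 := by
    rw [Finset.sum_comm, ← e1]
    exact Finset.sum_congr rfl fun x _ => Finset.sum_congr rfl fun y _ => by
      simp_rw [h.V_symm x y]
  have e4 : ∑ x, ∑ y, ∑ a, ∑ b, (if y = b then (C * V x y) * (C * V a b) else 0) =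
      ∑ x, (∑ y, C * V x y) ^ 2 := by
    rw [Finset.sum_comm, ← e2]
    exact Finset.sum_congr rfl fun x _ => Finset.sum_congr rfl fun y _ => by
      simp_rw [h.V_symm x y]
  rw [e1, e2, e3, e4]
  simp_rw [← Finset.mul_sum, mul_pow]
  rw [← Finset.mul_sum]
  ring

lemma avg_orthogonal {x y w v : I} (hyw : y ≠ w) (hv : v = y ∨ v = w) {f : (I → E) → ℝ}
    (hf : ∀ z u, f (Function.update z v u) = f z) (hf2 : MemLp f 2 (Measure.pi ν)) :
    ∫ z, ker (β x) y w z * f z ∂Measure.pi ν = 0 := by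
  have hint := integrable_mul_of_memLp_two (h.avg_memLp x y w) hf2
  refine integral_mul_eq_zero ν v hf (fun z => ?_) hint
  rcases hv with rfl | rfl
  · simpa [ker, Function.update_of_ne hyw.symm] using h.avg_centered x v w hyw (z w)
  · have := h.avg_centered x v y hyw.symm (z y)
    simpa [ker, Function.update_of_ne hyw, h.avg_symm x y v] using this

/-- The second-order part: averages over the common index of the products of two kernels. For fixed
`(y, w)` the averages are summed over `x` by Minkowski's inequality, different pairs are orthogonal. -/
lemma integral_sq_sum_avg_le :
    ∫ z, (∑ r : I × I, ∑ x, if x ≠ r.1 ∧ x ≠ r.2 ∧ r.1 ≠ r.2 then ker (β x) r.1 r.2 z else 0) ^ 2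
      ∂Measure.pi ν ≤ 4 * δ ^ 2 * (∑ x, ∑ y, V x y) ^ 2 := by
  set f : I × I → (I → E) → ℝ := fun r z =>
    ∑ x, if x ≠ r.1 ∧ x ≠ r.2 ∧ r.1 ≠ r.2 then ker (β x) r.1 r.2 z else 0 with hfdef
  have hmem1 : ∀ (r : I × I) x, MemLp (fun z => if x ≠ r.1 ∧ x ≠ r.2 ∧ r.1 ≠ r.2 then
      ker (β x) r.1 r.2 z else 0) 2 (Measure.pi ν) := by
    intro r x
    split_ifs
    · exact h.avg_memLp x r.1 r.2
    · exact MemLp.zero'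
  have hmem : ∀ r, MemLp (f r) 2 (Measure.pi ν) := fun r =>
    memLp_finsetSum _ fun x _ => hmem1 r x
  have hkey := integral_sq_sum_le_of_key Finset.univ f (fun r => ({r.1, r.2} : Finset I)) 4
    (fun r _ => by
      have hsub : (Finset.univ.filter fun i : I × I => ({i.1, i.2} : Finset I) = {r.1, r.2}) ⊆
          ({r.1, r.2} : Finset I) ×ˢ ({r.1, r.2} : Finset I) := by
        intro i hi
        have hi := (Finset.mem_filter.1 hi).2
        rw [Finset.mem_product, ← hi]
        simp
      refine (Finset.card_le_card hsub).trans ?_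
      rw [Finset.card_product]
      exact Nat.mul_le_mul Finset.card_le_two Finset.card_le_two)
    (fun r _ => hmem r)
    (fun r _ r' _ hne => by
      by_cases hr : r.1 = r.2
      · simp [hfdef, hr]
      by_cases hr' : r'.1 = r'.2
      · simp [hfdef, hr']
      have hex : ∃ v ∈ ({r.1, r.2} : Finset I), v ∉ ({r'.1, r'.2} : Finset I) := by
        by_contra hcon
        push Not at hcon
        exact hne (Finset.eq_of_subset_of_card_le hcon
          (by rw [Finset.card_pair hr, Finset.card_pair hr']))
      obtain ⟨v, hv, hv'⟩ := hex
      simp only [Finset.mem_insert, Finset.mem_singleton, not_or] at hv hv'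
      have hfr : ∀ z u, f r' (Function.update z v u) = f r' z := by
        intro z u
        refine Finset.sum_congr rfl fun x _ => ?_
        split_ifs
        · exact ker_update (β x) hv'.1 hv'.2 z u
        · rfl
      have hsum : ∀ z, f r z * f r' z = ∑ x,
          (if x ≠ r.1 ∧ x ≠ r.2 ∧ r.1 ≠ r.2 then ker (β x) r.1 r.2 z else 0) * f r' z := by
        intro z; rw [← Finset.sum_mul]
      simp_rw [hsum]
      rw [integral_finsetSum _ fun x _ => integrable_mul_of_memLp_two (hmem1 r x) (hmem r')]
      refine Finset.sum_eq_zero fun x _ => ?_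
      split_ifs
      · exact h.avg_orthogonal hr hv hfr (hmem r')
      · simp)
  refine hkey.trans ?_
  have hrow : ∀ y, 0 ≤ ∑ x, V x y := fun y => Finset.sum_nonneg fun x _ => h.V_nonneg x y
  have hone : ∀ r : I × I, ∫ z, f r z ^ 2 ∂Measure.pi ν ≤
      δ ^ 2 * ((∑ x, V x r.1) * ∑ x, V x r.2) := by
    intro r
    have hterm : ∀ x, √(∫ z, (if x ≠ r.1 ∧ x ≠ r.2 ∧ r.1 ≠ r.2 then ker (β x) r.1 r.2 z else 0) ^ 2
        ∂Measure.pi ν) ≤ δ * (√(V x r.1) * √(V x r.2)) := by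
      intro x
      have hnn : 0 ≤ δ * (√(V x r.1) * √(V x r.2)) :=
        mul_nonneg h.delta_nonneg (by positivity)
      split_ifs with hx
      · rw [Real.sqrt_le_left hnn]
        refine (h.avg_sq x r.1 r.2 hx.2.2).trans (le_of_eq ?_)
        rw [mul_pow, mul_pow, Real.sq_sqrt (h.V_nonneg _ _), Real.sq_sqrt (h.V_nonneg _ _)]
      · simpa using hnn
    have hs : √(∫ z, f r z ^ 2 ∂Measure.pi ν) ≤ δ * (√(∑ x, V x r.1) * √(∑ x, V x r.2)) := by
      refine (sqrt_integral_sq_sum_le Finset.univ _ fun x _ => hmem1 r x).trans ?_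
      refine (Finset.sum_le_sum fun x _ => hterm x).trans ?_
      rw [← Finset.mul_sum]
      exact mul_le_mul_of_nonneg_left (Real.sum_sqrt_mul_sqrt_le _ (fun x => h.V_nonneg x _)
        fun x => h.V_nonneg x _) h.delta_nonneg
    rw [Real.sqrt_le_left (mul_nonneg h.delta_nonneg (by positivity)), mul_pow, mul_pow,
      Real.sq_sqrt (hrow _), Real.sq_sqrt (hrow _)] at hs
    exact hs
  have hsum : ∑ r : I × I, ∫ z, f r z ^ 2 ∂Measure.pi ν ≤ δ ^ 2 * (∑ x, ∑ y, V x y) ^ 2 := by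
    refine (Finset.sum_le_sum fun r _ => hone r).trans (le_of_eq ?_)
    rw [← Finset.mul_sum, Fintype.sum_prod_type, pow_two (∑ x, ∑ y, V x y),
      Finset.sum_comm (f := V), Finset.sum_mul_sum]
  push_cast
  linarith

/-- The difference is the part of `κ x y * κ x w` that is degenerate in all three coordinates. -/
lemma triple_memLp (x y w : I) :
    MemLp (fun z => ker κ x y z * ker κ x w z - ker (β x) y w z) 2 (Measure.pi ν) :=
  (memLp_two_mul_of_memLp_four (h.memLp x y) (h.memLp x w)).sub (h.avg_memLp x y w)

lemma triple_orthogonal {x y w v : I} (hxy : x ≠ y) (hxw : x ≠ w) (hyw : y ≠ w)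
    (hv : v = x ∨ v = y ∨ v = w) {f : (I → E) → ℝ}
    (hf : ∀ z u, f (Function.update z v u) = f z) (hf2 : MemLp f 2 (Measure.pi ν)) :
    ∫ z, (ker κ x y z * ker κ x w z - ker (β x) y w z) * f z ∂Measure.pi ν = 0 := by
  have hprod : ∀ y w, Integrable (fun z => ker κ x y z * ker κ x w z * f z) (Measure.pi ν) :=
    fun y w => integrable_mul_of_memLp_two
      (memLp_two_mul_of_memLp_four (h.memLp x y) (h.memLp x w)) hf2
  have hside : ∀ y w, x ≠ y → y ≠ w → (∀ z u, f (Function.update z y u) = f z) →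
      ∫ z, (ker κ x y z * ker κ x w z - ker (β x) y w z) * f z ∂Measure.pi ν = 0 := by
    intro y w hxy hyw hf
    simp_rw [sub_mul]
    rw [integral_sub (hprod y w) (integrable_mul_of_memLp_two (h.avg_memLp x y w) hf2),
      h.avg_orthogonal hyw (Or.inl rfl) hf hf2, sub_zero]
    rw [← integral_mul_eq_zero ν y (h := ker κ x y) (f := fun z => ker κ x w z * f z)
      (fun z u => by simp only [hf, ker_update κ hxy.symm hyw]) (h.ker_centered_right x y)
      ((hprod y w).congr (Eventually.of_forall fun z => by simp only; ring))]
    exact integral_congr_ae (Eventually.of_forall fun z => by simp only; ring)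
  rcases hv with rfl | rfl | rfl
  · refine integral_mul_eq_zero ν v hf (fun z => ?_)
      (integrable_mul_of_memLp_two (h.triple_memLp v y w) hf2)
    simp only [ker, Function.update_self, Function.update_of_ne hxy.symm,
      Function.update_of_ne hxw.symm]
    have hav := h.avg v y w hxy hxw (z y) (z w)
    -- a non-integrable section would have average zero by convention, consistently on both sides
    by_cases hi : Integrable (fun u => κ v y u (z y) * κ v w u (z w)) (ν v)
    · rw [integral_sub hi (integrable_const _), hav]; simp
    · rw [integral_undef hi] at hav
      rw [← hav]; simp [integral_undef hi]
  · exact hside v w hxy hyw hf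
  · rw [← hside v y hxw hyw.symm hf]
    refine integral_congr_ae (Eventually.of_forall fun z => ?_)
    simp only [ker, h.avg_symm x v y]
    ring

lemma integral_triple_sq_le {x y w : I} (hyw : y ≠ w) :
    ∫ z, (ker κ x y z * ker κ x w z - ker (β x) y w z) ^ 2 ∂Measure.pi ν ≤
      2 * (C ^ 2 + δ ^ 2) * (V x y * V x w) := by
  have h1 : MemLp (fun z => ker κ x y z * ker κ x w z) 2 (Measure.pi ν) :=
    memLp_two_mul_of_memLp_four (h.memLp x y) (h.memLp x w)
  have h2 := h.avg_memLp x y w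
  have h3 : ∫ z, (ker κ x y z * ker κ x w z) ^ 2 ∂Measure.pi ν ≤ C ^ 2 * (V x y * V x w) := by
    simp_rw [mul_pow]
    refine (integral_mul_sq_le_sqrt (h.memLp x y) (h.memLp x w)).trans ?_
    refine (mul_le_mul (h.sqrt_fourth_le x y) (h.sqrt_fourth_le x w) (Real.sqrt_nonneg _)
      (mul_nonneg h.const_nonneg (h.V_nonneg x y))).trans (le_of_eq (by ring))
  have h4 := h.avg_sq x y w hyw
  calc ∫ z, (ker κ x y z * ker κ x w z - ker (β x) y w z) ^ 2 ∂Measure.pi ν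
      ≤ ∫ z, (2 * (ker κ x y z * ker κ x w z) ^ 2 + 2 * ker (β x) y w z ^ 2) ∂Measure.pi ν := by
        refine integral_mono (h.triple_memLp x y w).integrable_sq
          ((h1.integrable_sq.const_mul 2).add (h2.integrable_sq.const_mul 2)) fun z => ?_
        simp only
        nlinarith [sq_nonneg (ker κ x y z * ker κ x w z + ker (β x) y w z)]
    _ = 2 * (∫ z, (ker κ x y z * ker κ x w z) ^ 2 ∂Measure.pi ν) +
          2 * ∫ z, ker (β x) y w z ^ 2 ∂Measure.pi ν := by
        rw [integral_add (h1.integrable_sq.const_mul 2) (h2.integrable_sq.const_mul 2),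
          integral_const_mul, integral_const_mul]
    _ ≤ 2 * (C ^ 2 + δ ^ 2) * (V x y * V x w) := by linarith

/-- The third-order part: summands with different index sets are orthogonal. -/
lemma integral_sq_sum_triple_le :
    ∫ z, (∑ r : I × I × I, if r.1 ≠ r.2.1 ∧ r.1 ≠ r.2.2 ∧ r.2.1 ≠ r.2.2 then
      ker κ r.1 r.2.1 z * ker κ r.1 r.2.2 z - ker (β r.1) r.2.1 r.2.2 z else 0) ^ 2 ∂Measure.pi ν ≤
      54 * (C ^ 2 + δ ^ 2) * ∑ x, (∑ y, V x y) ^ 2 := by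
  set f : I × I × I → (I → E) → ℝ := fun r z =>
    if r.1 ≠ r.2.1 ∧ r.1 ≠ r.2.2 ∧ r.2.1 ≠ r.2.2 then
      ker κ r.1 r.2.1 z * ker κ r.1 r.2.2 z - ker (β r.1) r.2.1 r.2.2 z else 0 with hfdef
  have hmem : ∀ r, MemLp (f r) 2 (Measure.pi ν) := by
    intro r
    simp only [hfdef]
    split_ifs
    · exact h.triple_memLp _ _ _
    · exact MemLp.zero'
  have hkey := integral_sq_sum_le_of_key Finset.univ f
    (fun r => ({r.1, r.2.1, r.2.2} : Finset I)) 27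
    (fun r _ => by
      set A : Finset I := {r.1, r.2.1, r.2.2} with hA
      have hsub : (Finset.univ.filter fun i : I × I × I =>
          ({i.1, i.2.1, i.2.2} : Finset I) = A) ⊆ A ×ˢ A ×ˢ A := by
        intro i hi
        have hi := (Finset.mem_filter.1 hi).2
        rw [Finset.mem_product, Finset.mem_product, ← hi]
        simp
      refine (Finset.card_le_card hsub).trans ?_
      rw [Finset.card_product, Finset.card_product]
      have : A.card ≤ 3 := Finset.card_le_three
      calc A.card * (A.card * A.card) ≤ 3 * (3 * 3) :=
            Nat.mul_le_mul this (Nat.mul_le_mul this this)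
        _ = 27 := by norm_num)
    (fun r _ => hmem r)
    (fun r _ r' _ hne => by
      by_cases hr : r.1 ≠ r.2.1 ∧ r.1 ≠ r.2.2 ∧ r.2.1 ≠ r.2.2
      swap
      · simp only [hfdef, if_neg hr, zero_mul, integral_zero]
      by_cases hr' : r'.1 ≠ r'.2.1 ∧ r'.1 ≠ r'.2.2 ∧ r'.2.1 ≠ r'.2.2
      swap
      · simp only [hfdef, if_neg hr', mul_zero, integral_zero]
      have hex : ∃ v ∈ ({r.1, r.2.1, r.2.2} : Finset I),
          v ∉ ({r'.1, r'.2.1, r'.2.2} : Finset I) := by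
        by_contra hcon
        push Not at hcon
        refine hne (Finset.eq_of_subset_of_card_le hcon ?_)
        rw [Finset.card_eq_three.2 ⟨_, _, _, hr.1, hr.2.1, hr.2.2, rfl⟩]
        exact Finset.card_le_three
      obtain ⟨v, hv, hv'⟩ := hex
      simp only [Finset.mem_insert, Finset.mem_singleton, not_or] at hv hv'
      have hfr : ∀ z u, f r' (Function.update z v u) = f r' z := by
        intro z u
        simp only [hfdef, if_pos hr']
        rw [ker_update κ hv'.1 hv'.2.1, ker_update κ hv'.1 hv'.2.2,
          ker_update (β r'.1) hv'.2.1 hv'.2.2]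
      have := h.triple_orthogonal hr.1 hr.2.1 hr.2.2 hv hfr (hmem r')
      rw [← this]
      refine integral_congr_ae (Eventually.of_forall fun z => ?_)
      simp only [hfdef, if_pos hr])
  refine hkey.trans ?_
  have hc : 0 ≤ 2 * (C ^ 2 + δ ^ 2) := by positivity
  have hone : ∀ r : I × I × I, ∫ z, f r z ^ 2 ∂Measure.pi ν ≤
      2 * (C ^ 2 + δ ^ 2) * (V r.1 r.2.1 * V r.1 r.2.2) := by
    intro r
    by_cases hr : r.1 ≠ r.2.1 ∧ r.1 ≠ r.2.2 ∧ r.2.1 ≠ r.2.2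
    · simp only [hfdef, if_pos hr]
      exact h.integral_triple_sq_le hr.2.2
    · simp only [hfdef, if_neg hr]
      simpa using mul_nonneg hc (mul_nonneg (h.V_nonneg r.1 r.2.1) (h.V_nonneg r.1 r.2.2))
  have hsum : ∑ r : I × I × I, ∫ z, f r z ^ 2 ∂Measure.pi ν ≤
      2 * (C ^ 2 + δ ^ 2) * ∑ x, (∑ y, V x y) ^ 2 := by
    refine (Finset.sum_le_sum fun r _ => hone r).trans (le_of_eq ?_)
    rw [← Finset.mul_sum, Fintype.sum_prod_type]
    congr 1
    refine Finset.sum_congr rfl fun x _ => ?_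
    rw [Fintype.sum_prod_type, pow_two, Finset.sum_mul_sum]
  push_cast
  linarith

/-- Splitting the sum of the squared row sums into its parts of order one, two and three. -/
lemma sum_rowForm_sq (z : I → E) :
    ∑ x, rowForm κ x z ^ 2 = (∑ x, ∑ y, ker κ x y z ^ 2) +
      (∑ r : I × I, ∑ x, if x ≠ r.1 ∧ x ≠ r.2 ∧ r.1 ≠ r.2 then ker (β x) r.1 r.2 z else 0) +
      ∑ r : I × I × I, if r.1 ≠ r.2.1 ∧ r.1 ≠ r.2.2 ∧ r.2.1 ≠ r.2.2 then
        ker κ r.1 r.2.1 z * ker κ r.1 r.2.2 z - ker (β r.1) r.2.1 r.2.2 z else 0 := by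
  have e2 : (∑ r : I × I, ∑ x, if x ≠ r.1 ∧ x ≠ r.2 ∧ r.1 ≠ r.2 then
      ker (β x) r.1 r.2 z else 0) =
      ∑ x, ∑ y, ∑ w, if x ≠ y ∧ x ≠ w ∧ y ≠ w then ker (β x) y w z else 0 := by
    rw [Finset.sum_comm]
    exact Finset.sum_congr rfl fun x _ => by rw [Fintype.sum_prod_type]
  have e3 : (∑ r : I × I × I, if r.1 ≠ r.2.1 ∧ r.1 ≠ r.2.2 ∧ r.2.1 ≠ r.2.2 then
        ker κ r.1 r.2.1 z * ker κ r.1 r.2.2 z - ker (β r.1) r.2.1 r.2.2 z else 0) =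
      ∑ x, ∑ y, ∑ w, if x ≠ y ∧ x ≠ w ∧ y ≠ w then
        ker κ x y z * ker κ x w z - ker (β x) y w z else 0 := by
    rw [Fintype.sum_prod_type]
    exact Finset.sum_congr rfl fun x _ => by rw [Fintype.sum_prod_type]
  have e1 : ∀ x y, ker κ x y z ^ 2 = ∑ w, if w = y then ker κ x y z * ker κ x w z else 0 := by
    intro x y
    simp [pow_two]
  rw [e2, e3]
  simp_rw [e1, ← Finset.sum_add_distrib, rowForm, pow_two, Finset.sum_mul_sum]
  refine Finset.sum_congr rfl fun x _ => Finset.sum_congr rfl fun y _ =>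
    Finset.sum_congr rfl fun w _ => ?_
  by_cases hxy : x = y
  · subst hxy; simp [h.ker_diag]
  by_cases hxw : x = w
  · subst hxw; simp [h.ker_diag]
  by_cases hyw : y = w
  · subst hyw; simp
  · simp [hxy, hxw, hyw, Ne.symm hyw]

/-- Concentration of the sum of the squared row sums, the engine of the central limit theorem. -/
lemma integral_sq_sum_rowForm_sq_sub_le :
    ∫ z, ((∑ x, rowForm κ x z ^ 2) - ∑ x, ∑ y, V x y) ^ 2 ∂Measure.pi ν ≤
      174 * (C ^ 2 + δ ^ 2) * (∑ x, (∑ y, V x y) ^ 2) +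
        12 * δ ^ 2 * (∑ x, ∑ y, V x y) ^ 2 := by
  set A : (I → E) → ℝ := fun z => ∑ x, ∑ y, (ker κ x y z ^ 2 - V x y) with hA
  set B : (I → E) → ℝ := fun z => ∑ r : I × I, ∑ x,
    if x ≠ r.1 ∧ x ≠ r.2 ∧ r.1 ≠ r.2 then ker (β x) r.1 r.2 z else 0 with hB
  set D : (I → E) → ℝ := fun z => ∑ r : I × I × I,
    if r.1 ≠ r.2.1 ∧ r.1 ≠ r.2.2 ∧ r.2.1 ≠ r.2.2 then
        ker κ r.1 r.2.1 z * ker κ r.1 r.2.2 z - ker (β r.1) r.2.1 r.2.2 z else 0 with hD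
  have mA : MemLp A 2 (Measure.pi ν) :=
    memLp_finsetSum _ fun x _ => memLp_finsetSum _ fun y _ => h.sq_sub_memLp x y
  have mB : MemLp B 2 (Measure.pi ν) := by
    refine memLp_finsetSum _ fun r _ => memLp_finsetSum _ fun x _ => ?_
    split_ifs
    · exact h.avg_memLp x r.1 r.2
    · exact MemLp.zero'
  have mD : MemLp D 2 (Measure.pi ν) := by
    refine memLp_finsetSum _ fun r _ => ?_
    split_ifs
    · exact h.triple_memLp _ _ _
    · exact MemLp.zero'
  have hsplit : ∀ z, (∑ x, rowForm κ x z ^ 2) - ∑ x, ∑ y, V x y = A z + B z + D z := by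
    intro z
    rw [h.sum_rowForm_sq z]
    simp only [hA, hB, hD, Finset.sum_sub_distrib]
    ring
  simp_rw [hsplit]
  have iA := mA.integrable_sq
  have iB := mB.integrable_sq
  have iD := mD.integrable_sq
  have hA' := h.integral_sq_sum_sq_sub_le
  have hB' := h.integral_sq_sum_avg_le
  have hD' := h.integral_sq_sum_triple_le
  have hS : 0 ≤ ∑ x, (∑ y, V x y) ^ 2 := Finset.sum_nonneg fun _ _ => sq_nonneg _
  have hle : ∫ z, (A z + B z + D z) ^ 2 ∂Measure.pi ν ≤
      3 * (∫ z, A z ^ 2 ∂Measure.pi ν) + (3 * (∫ z, B z ^ 2 ∂Measure.pi ν) +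
        3 * ∫ z, D z ^ 2 ∂Measure.pi ν) := by
    rw [← integral_const_mul, ← integral_const_mul, ← integral_const_mul,
      ← integral_add (iB.const_mul 3) (iD.const_mul 3),
      ← integral_add (iA.const_mul 3) ((iB.const_mul 3).fun_add (iD.const_mul 3))]
    refine integral_mono ((mA.add mB).add mD).integrable_sq
      ((iA.const_mul 3).add ((iB.const_mul 3).add (iD.const_mul 3))) fun z => ?_
    simp only
    nlinarith [sq_nonneg (A z - B z), sq_nonneg (A z - D z), sq_nonneg (B z - D z)]
  nlinarith [mul_nonneg (sq_nonneg δ) hS]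

end DegenerateKernels

end Kernels

/-! ### The characteristic function of a degenerate quadratic form -/

/-- The unit complex number `exp (i u x)`. -/
def cexpI (u x : ℝ) : ℂ := Complex.exp (((u * x : ℝ) : ℂ) * Complex.I)

lemma norm_cexpI (u x : ℝ) : ‖cexpI u x‖ = 1 := Complex.norm_exp_ofReal_mul_I _

lemma measurable_cexpI (u : ℝ) : Measurable (cexpI u) := by
  unfold cexpI; fun_prop

lemma cexpI_add (u x y : ℝ) : cexpI u (x + y) = cexpI u x * cexpI u y := by
  rw [cexpI, cexpI, cexpI, ← Complex.exp_add]
  congr 1; push_cast; ring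

lemma hasDerivAt_cexpI (u x : ℝ) :
    HasDerivAt (fun s => cexpI s x) (x • (Complex.I * cexpI u x)) u := by
  have h1 : HasDerivAt (fun s : ℝ => ((s * x : ℝ) : ℂ) * Complex.I) ((x : ℂ) * Complex.I) u := by
    have := ((hasDerivAt_id u).mul_const x).ofReal_comp.mul_const Complex.I
    simpa using this
  have h2 := h1.cexp
  refine h2.congr_deriv ?_
  rw [Complex.real_smul, cexpI]; ring

lemma norm_exp_mul_I_sub_le (θ : ℝ) :
    ‖Complex.exp ((θ : ℂ) * Complex.I) - 1 - (θ : ℂ) * Complex.I‖ ≤ 3 * θ ^ 2 := by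
  have hn : ‖(θ : ℂ) * Complex.I‖ = |θ| := by simp
  by_cases h : |θ| ≤ 1
  · refine (Complex.norm_exp_sub_one_sub_id_le (by rw [hn]; exact h)).trans ?_
    rw [hn, sq_abs]; nlinarith [sq_nonneg θ]
  · push Not at h
    have h1 : ‖Complex.exp ((θ : ℂ) * Complex.I)‖ = 1 := Complex.norm_exp_ofReal_mul_I _
    have h2 := norm_sub_le (Complex.exp ((θ : ℂ) * Complex.I) - 1) ((θ : ℂ) * Complex.I)
    have h3 := norm_sub_le (Complex.exp ((θ : ℂ) * Complex.I)) 1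
    rw [hn] at h2
    rw [h1, norm_one] at h3
    nlinarith [sq_abs θ]

/-- First-order expansion of `exp (i u ·)` backwards from `T` to `T - 2 r`. -/
lemma norm_cexpI_sub_le (u T r : ℝ) :
    ‖cexpI u T - cexpI u (T - 2 * r) - (2 * u * r) • (Complex.I * cexpI u T)‖ ≤
      12 * u ^ 2 * r ^ 2 := by
  have h1 : cexpI u (T - 2 * r) = cexpI u T * cexpI u (-(2 * r)) := by
    rw [← cexpI_add]; ring_nf
  have h2 : cexpI u T - cexpI u (T - 2 * r) - (2 * u * r) • (Complex.I * cexpI u T) =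
      -(cexpI u T * (Complex.exp (((-(2 * u * r) : ℝ) : ℂ) * Complex.I) - 1 -
        ((-(2 * u * r) : ℝ) : ℂ) * Complex.I)) := by
    have h3 : cexpI u (-(2 * r)) = Complex.exp (((-(2 * u * r) : ℝ) : ℂ) * Complex.I) := by
      rw [cexpI]; congr 3; ring
    rw [h1, h3, Complex.real_smul]; push_cast; ring
  rw [h2, norm_neg, norm_mul, norm_cexpI, one_mul]
  refine (norm_exp_mul_I_sub_le _).trans (le_of_eq (by ring))

section Stein

variable {Ω : Type*} [MeasurableSpace Ω] {P : Measure Ω} [IsProbabilityMeasure P]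

lemma integrable_smul_cexpI {f T : Ω → ℝ} (hf : Integrable f P) (hT : AEStronglyMeasurable T P)
    (u : ℝ) (c : ℂ) : Integrable (fun ω => f ω • (c * cexpI u (T ω))) P := by
  refine hf.smul_bdd ‖c‖ ?_ ?_
  · exact ((measurable_cexpI u).comp_aemeasurable hT.aemeasurable).aestronglyMeasurable.const_mul c
  · exact Eventually.of_forall fun ω => by rw [norm_mul, norm_cexpI, mul_one]

lemma hasDerivAt_integral_cexpI {T : Ω → ℝ} (hT : Integrable T P) (u : ℝ) :
    HasDerivAt (fun s => ∫ ω, cexpI s (T ω) ∂P)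
      (∫ ω, T ω • (Complex.I * cexpI u (T ω)) ∂P) u := by
  have hm : ∀ s, AEStronglyMeasurable (fun ω => cexpI s (T ω)) P := fun s =>
    ((measurable_cexpI s).comp_aemeasurable hT.aestronglyMeasurable.aemeasurable).aestronglyMeasurable
  refine (hasDerivAt_integral_of_dominated_loc_of_deriv_le (F := fun s ω => cexpI s (T ω))
    (F' := fun s ω => T ω • (Complex.I * cexpI s (T ω))) (bound := fun ω => |T ω|)
    (s := Set.univ) univ_mem (Eventually.of_forall hm) ?_ ?_ ?_ hT.abs ?_).2
  · exact (integrable_const (1 : ℝ)).mono' (hm u)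
      (Eventually.of_forall fun ω => (norm_cexpI _ _).le)
  · exact (integrable_smul_cexpI hT hT.aestronglyMeasurable u Complex.I).aestronglyMeasurable
  · refine Eventually.of_forall fun ω s _ => ?_
    rw [norm_smul, norm_mul, norm_cexpI]; simp
  · exact Eventually.of_forall fun ω s _ => hasDerivAt_cexpI s (T ω)

/-- If the characteristic function of `T` nearly solves `φ' = -u φ`, it is nearly Gaussian: the
derivative of `e^{u²/2} φ` is small. -/
lemma norm_integral_cexpI_sub_le {T : Ω → ℝ} (hT : Integrable T P) {a b : ℝ} (ha : 0 ≤ a)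
    (hb : 0 ≤ b)
    (hode : ∀ u : ℝ, ‖∫ ω, T ω • (Complex.I * cexpI u (T ω)) ∂P + u • ∫ ω, cexpI u (T ω) ∂P‖ ≤
      |u| * a + u ^ 2 * b) (u : ℝ) :
    ‖∫ ω, cexpI u (T ω) ∂P - ((Real.exp (-(u ^ 2 / 2)) : ℝ) : ℂ)‖ ≤ u ^ 2 * a + |u| ^ 3 * b := by
  set φ : ℝ → ℂ := fun s => ∫ ω, cexpI s (T ω) ∂P with hφ
  set ψ : ℝ → ℂ := fun s => ∫ ω, T ω • (Complex.I * cexpI s (T ω)) ∂P with hψ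
  have hd : ∀ s, HasDerivAt (fun s => Real.exp (s ^ 2 / 2) • φ s)
      (Real.exp (s ^ 2 / 2) • (ψ s + s • φ s)) s := by
    intro s
    have h1 : HasDerivAt (fun s : ℝ => Real.exp (s ^ 2 / 2)) (Real.exp (s ^ 2 / 2) * s) s := by
      have := ((hasDerivAt_pow 2 s).div_const 2).exp
      refine this.congr_deriv ?_
      norm_num
    have h2 := h1.smul (hasDerivAt_integral_cexpI hT s)
    refine h2.congr_deriv ?_
    rw [smul_add, smul_smul]
  have hbound : ∀ s ∈ Set.Icc (-|u|) |u|, ‖Real.exp (s ^ 2 / 2) • (ψ s + s • φ s)‖ ≤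
      Real.exp (u ^ 2 / 2) * (|u| * a + u ^ 2 * b) := by
    intro s hs
    have hsu : |s| ≤ |u| := abs_le.2 hs
    have hsq : s ^ 2 ≤ u ^ 2 := sq_le_sq.2 hsu
    rw [norm_smul, Real.norm_eq_abs, Real.abs_exp]
    refine mul_le_mul (Real.exp_le_exp.2 (by linarith)) ((hode s).trans ?_) (norm_nonneg _)
      (Real.exp_pos _).le
    exact add_le_add (mul_le_mul_of_nonneg_right hsu ha) (mul_le_mul_of_nonneg_right hsq hb)
  have hmv := (convex_Icc (-|u|) |u|).norm_image_sub_le_of_norm_hasDerivWithin_le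
    (fun s hs => (hd s).hasDerivWithinAt) hbound
    (⟨by simp, by simp⟩ : (0 : ℝ) ∈ Set.Icc (-|u|) |u|) (abs_le.1 le_rfl : u ∈ Set.Icc (-|u|) |u|)
  have h0 : φ 0 = 1 := by simp [hφ, cexpI]
  simp only [h0, sub_zero, Real.norm_eq_abs] at hmv
  have hfac : φ u - ((Real.exp (-(u ^ 2 / 2)) : ℝ) : ℂ) =
      Real.exp (-(u ^ 2 / 2)) • (Real.exp (u ^ 2 / 2) • φ u - Real.exp (0 ^ 2 / 2) • (1 : ℂ)) := by
    rw [smul_sub, smul_smul, ← Real.exp_add]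
    simp
  rw [hfac, norm_smul, Real.norm_eq_abs, Real.abs_exp]
  calc Real.exp (-(u ^ 2 / 2)) * ‖Real.exp (u ^ 2 / 2) • φ u - Real.exp (0 ^ 2 / 2) • (1 : ℂ)‖
      ≤ Real.exp (-(u ^ 2 / 2)) * (Real.exp (u ^ 2 / 2) * (|u| * a + u ^ 2 * b) * |u|) :=
        mul_le_mul_of_nonneg_left hmv (Real.exp_pos _).le
    _ = (Real.exp (-(u ^ 2 / 2)) * Real.exp (u ^ 2 / 2)) * (|u| * |u| * a + |u| * u ^ 2 * b) := by
        ring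
    _ = u ^ 2 * a + |u| ^ 3 * b := by
        rw [← Real.exp_add, neg_add_cancel, Real.exp_zero, one_mul, ← sq_abs u]
        ring

end Stein

namespace DegenerateKernels

variable {I E : Type*} [Fintype I] [DecidableEq I] [MeasurableSpace E]
variable {ν : I → Measure E} [∀ x, IsProbabilityMeasure (ν x)]
  {κ : I → I → E → E → ℝ} {β : I → I → I → E → E → ℝ} {V : I → I → ℝ} {C δ : ℝ}

variable (h : DegenerateKernels ν κ β V C δ)
include h

/-- Leave-one-out expansion: the part of the form that does not involve the coordinate `x` is
independent of that coordinate, so the row sum only correlates with the linear response. -/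
lemma norm_integral_rowForm_smul_sub_le (x : I) (u : ℝ) :
    ‖∫ z, rowForm κ x z • cexpI u (quadForm κ z) ∂Measure.pi ν -
      ∫ z, (2 * u * rowForm κ x z ^ 2) • (Complex.I * cexpI u (quadForm κ z)) ∂Measure.pi ν‖ ≤
      12 * u ^ 2 * ∫ z, |rowForm κ x z| ^ 3 ∂Measure.pi ν := by
  have hR4 := h.rowForm_memLp x
  have hR2 : MemLp (rowForm κ x) 2 (Measure.pi ν) := hR4.mono_exponent (by norm_num)
  have hR1 : Integrable (rowForm κ x) (Measure.pi ν) := hR4.integrable (by norm_num)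
  have hQ : MemLp (quadForm κ) 2 (Measure.pi ν) := h.quadForm_memLp.mono_exponent (by norm_num)
  have hQm := hQ.aestronglyMeasurable
  have hdm : AEStronglyMeasurable (fun z => quadForm κ z - 2 * rowForm κ x z) (Measure.pi ν) :=
    hQm.sub (hR1.aestronglyMeasurable.const_mul 2)
  have hcube : Integrable (fun z => |rowForm κ x z| ^ 3) (Measure.pi ν) := by
    have := (hR4.mono_exponent (p := 3) (by norm_num)).integrable_norm_pow (by norm_num)
    simpa using this
  have i1 := integrable_smul_cexpI hR1 hQm u 1
  have i2 : Integrable (fun z => rowForm κ x z • (1 * cexpI u (quadForm κ z - 2 * rowForm κ x z)))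
    (Measure.pi ν) := integrable_smul_cexpI hR1 hdm u 1
  have i3 := integrable_smul_cexpI (hR2.integrable_sq.const_mul (2 * u)) hQm u Complex.I
  simp only [one_mul] at i1 i2
  have h0 : ∫ z, rowForm κ x z • cexpI u (quadForm κ z - 2 * rowForm κ x z) ∂Measure.pi ν = 0 := by
    refine h.integral_rowForm_smul_eq_zero x (fun z w => ?_) fun y => ?_
    · rw [h.quadForm_sub_rowForm_update]
    · simpa using integrable_smul_cexpI ((h.memLp x y).integrable (by norm_num)) hdm u 1
  have heq : ∫ z, rowForm κ x z • cexpI u (quadForm κ z) ∂Measure.pi ν -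
      ∫ z, (2 * u * rowForm κ x z ^ 2) • (Complex.I * cexpI u (quadForm κ z)) ∂Measure.pi ν =
      ∫ z, (rowForm κ x z • cexpI u (quadForm κ z) -
        rowForm κ x z • cexpI u (quadForm κ z - 2 * rowForm κ x z) -
        (2 * u * rowForm κ x z ^ 2) • (Complex.I * cexpI u (quadForm κ z))) ∂Measure.pi ν := by
    have i12 : Integrable (fun z => rowForm κ x z • cexpI u (quadForm κ z) -
        rowForm κ x z • cexpI u (quadForm κ z - 2 * rowForm κ x z)) (Measure.pi ν) := i1.sub i2
    rw [integral_sub i12 i3, integral_sub i1 i2, h0, sub_zero]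
  rw [heq, ← integral_const_mul]
  refine norm_integral_le_of_norm_le (hcube.const_mul _) (Eventually.of_forall fun z => ?_)
  have hfac : rowForm κ x z • cexpI u (quadForm κ z) -
      rowForm κ x z • cexpI u (quadForm κ z - 2 * rowForm κ x z) -
      (2 * u * rowForm κ x z ^ 2) • (Complex.I * cexpI u (quadForm κ z)) =
      rowForm κ x z • (cexpI u (quadForm κ z) - cexpI u (quadForm κ z - 2 * rowForm κ x z) -
        (2 * u * rowForm κ x z) • (Complex.I * cexpI u (quadForm κ z))) := by
    rw [smul_sub, smul_sub, smul_smul]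
    congr 2; ring
  rw [hfac, norm_smul, Real.norm_eq_abs]
  refine (mul_le_mul_of_nonneg_left (norm_cexpI_sub_le u _ _) (abs_nonneg _)).trans (le_of_eq ?_)
  rw [← sq_abs (rowForm κ x z)]; ring

/-- Berry–Esseen type bound for characteristic functions: a standardized degenerate quadratic form
is close to a standard Gaussian when no coordinate is influential and `δ` is small. -/
lemma norm_charFun_sub_le {η : ℝ} (hη : 0 < η) (hV : ∑ x, ∑ y, V x y = 1 / 2)
    (hrow : ∀ x, ∑ y, V x y ≤ η) (u : ℝ) :
    ‖∫ z, cexpI u (quadForm κ z) ∂Measure.pi ν - ((Real.exp (-(u ^ 2 / 2)) : ℝ) : ℂ)‖ ≤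
      u ^ 2 * √(348 * (C ^ 2 + δ ^ 2) * η + 12 * δ ^ 2) + |u| ^ 3 * (3 * (1 + 9 * C ^ 2) * √η) := by
  have hR4 := h.rowForm_memLp
  have hR2 : ∀ x, MemLp (rowForm κ x) 2 (Measure.pi ν) := fun x =>
    (hR4 x).mono_exponent (by norm_num)
  have hR1 : ∀ x, Integrable (rowForm κ x) (Measure.pi ν) := fun x =>
    (hR4 x).integrable (by norm_num)
  have hQ : MemLp (quadForm κ) 2 (Measure.pi ν) := h.quadForm_memLp.mono_exponent (by norm_num)
  have hQm := hQ.aestronglyMeasurable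
  have hcube : ∀ x, Integrable (fun z => |rowForm κ x z| ^ 3) (Measure.pi ν) := fun x => by
    have := ((hR4 x).mono_exponent (p := 3) (by norm_num)).integrable_norm_pow (by norm_num)
    simpa using this
  have hVn : ∀ x, 0 ≤ ∑ y, V x y := fun x => Finset.sum_nonneg fun y _ => h.V_nonneg x y
  have hS : ∑ x, (∑ y, V x y) ^ 2 ≤ η / 2 := by
    calc ∑ x, (∑ y, V x y) ^ 2 ≤ ∑ x, η * ∑ y, V x y := Finset.sum_le_sum fun x _ => by
          rw [pow_two]; exact mul_le_mul_of_nonneg_right (hrow x) (hVn x)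
      _ = η / 2 := by rw [← Finset.mul_sum, hV]; ring
  -- the quadratic variation concentrates
  set W : (I → E) → ℝ := fun z => (∑ x, rowForm κ x z ^ 2) - ∑ x, ∑ y, V x y with hW
  have hWm : MemLp W 2 (Measure.pi ν) := by
    refine MemLp.sub (memLp_finsetSum _ fun x _ => ?_) (memLp_const _)
    simpa [pow_two] using memLp_two_mul_of_memLp_four (hR4 x) (hR4 x)
  have hWi : Integrable W (Measure.pi ν) := hWm.integrable (by norm_num)
  have hWsq : ∫ z, W z ^ 2 ∂Measure.pi ν ≤ 87 * (C ^ 2 + δ ^ 2) * η + 3 * δ ^ 2 := by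
    refine h.integral_sq_sum_rowForm_sq_sub_le.trans ?_
    rw [hV]
    nlinarith [mul_le_mul_of_nonneg_left hS (by positivity : 0 ≤ 174 * (C ^ 2 + δ ^ 2))]
  have hWabs : 2 * ∫ z, |W z| ∂Measure.pi ν ≤ √(348 * (C ^ 2 + δ ^ 2) * η + 12 * δ ^ 2) := by
    have := abs_integral_mul_le_sqrt hWm.abs (memLp_const (1 : ℝ) (μ := Measure.pi ν) (p := 2))
    simp only [Pi.abs_apply, mul_one, sq_abs, one_pow, integral_const, probReal_univ, smul_eq_mul,
      Real.sqrt_one] at this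
    have h2 := (le_abs_self _).trans (this.trans (Real.sqrt_le_sqrt hWsq))
    have h3 : √(348 * (C ^ 2 + δ ^ 2) * η + 12 * δ ^ 2) =
        2 * √(87 * (C ^ 2 + δ ^ 2) * η + 3 * δ ^ 2) := by
      rw [show 348 * (C ^ 2 + δ ^ 2) * η + 12 * δ ^ 2 =
        2 ^ 2 * (87 * (C ^ 2 + δ ^ 2) * η + 3 * δ ^ 2) by ring, Real.sqrt_mul (by norm_num),
        Real.sqrt_sq (by norm_num)]
    rw [h3]; linarith
  -- the Lyapunov sum is small
  have hsη := Real.sqrt_pos.2 hη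
  have hLyap : 12 * ∑ x, ∫ z, |rowForm κ x z| ^ 3 ∂Measure.pi ν ≤ 3 * (1 + 9 * C ^ 2) * √η := by
    have h1 : ∀ x, ∫ z, |rowForm κ x z| ^ 3 ∂Measure.pi ν ≤
        √η / 2 * (∑ y, V x y) + 9 * C ^ 2 / (2 * √η) * (∑ y, V x y) ^ 2 := by
      intro x
      have e2 := h.rowForm_sq x
      have e4 := h.rowForm_pow_four_le x
      have i4 := integrable_pow_four (hR4 x)
      have i2 := (hR2 x).integrable_sq
      calc ∫ z, |rowForm κ x z| ^ 3 ∂Measure.pi ν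
          ≤ ∫ z, (√η / 2 * rowForm κ x z ^ 2 + 1 / (2 * √η) * rowForm κ x z ^ 4) ∂Measure.pi ν := by
            -- `|R|³ ≤ √η R² / 2 + R⁴ / (2 √η)`, the weight balances the two moments of a row sum
            refine integral_mono (hcube x) ((i2.const_mul _).add (i4.const_mul _)) fun z => ?_
            simp only
            rw [← sq_abs (rowForm κ x z), show rowForm κ x z ^ 4 = |rowForm κ x z| ^ 4 by
              rw [show (4 : ℕ) = 2 * 2 by norm_num, pow_mul, pow_mul, sq_abs]]
            set r := |rowForm κ x z|
            have : √η / 2 * r ^ 2 + 1 / (2 * √η) * r ^ 4 - r ^ 3 =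
                1 / (2 * √η) * (r * (√η - r)) ^ 2 := by
              field_simp; ring
            have h0 : 0 ≤ 1 / (2 * √η) * (r * (√η - r)) ^ 2 := by positivity
            linarith
        _ = √η / 2 * (∑ y, V x y) + 1 / (2 * √η) * ∫ z, rowForm κ x z ^ 4 ∂Measure.pi ν := by
            rw [integral_add (i2.const_mul _) (i4.const_mul _), integral_const_mul,
              integral_const_mul, e2]
        _ ≤ _ := by
            have := mul_le_mul_of_nonneg_left e4 (by positivity : 0 ≤ 1 / (2 * √η))
            have e : 1 / (2 * √η) * (9 * C ^ 2 * (∑ y, V x y) ^ 2) =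
              9 * C ^ 2 / (2 * √η) * (∑ y, V x y) ^ 2 := by ring
            linarith
    have h2 := Finset.sum_le_sum fun x (_ : x ∈ Finset.univ) => h1 x
    rw [Finset.sum_add_distrib, ← Finset.mul_sum, ← Finset.mul_sum, hV] at h2
    have h3 := mul_le_mul_of_nonneg_left hS (by positivity : 0 ≤ 9 * C ^ 2 / (2 * √η))
    have h4 : 9 * C ^ 2 / (2 * √η) * (η / 2) = 9 * C ^ 2 * √η / 4 := by
      field_simp
      rw [Real.sq_sqrt hη.le]; ring
    linarith
  -- the differential equation for the characteristic function, up to the two errors above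
  refine norm_integral_cexpI_sub_le (hQ.integrable (by norm_num)) (Real.sqrt_nonneg _)
    (by positivity) (fun u => ?_) u
  have i1 : ∀ x, Integrable (fun z => rowForm κ x z • cexpI u (quadForm κ z)) (Measure.pi ν) :=
    fun x => by simpa using integrable_smul_cexpI (hR1 x) hQm u 1
  have i3 : ∀ x, Integrable (fun z => (2 * u * rowForm κ x z ^ 2) •
      (Complex.I * cexpI u (quadForm κ z))) (Measure.pi ν) := fun x =>
    integrable_smul_cexpI ((hR2 x).integrable_sq.const_mul (2 * u)) hQm u Complex.I
  have i0 : Integrable (fun z => cexpI u (quadForm κ z)) (Measure.pi ν) := by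
    simpa using integrable_smul_cexpI (integrable_const (1 : ℝ)) hQm u 1
  have iW := integrable_smul_cexpI (hWi.const_mul (2 * u)) hQm u Complex.I
  have e1 : ∫ z, quadForm κ z • (Complex.I * cexpI u (quadForm κ z)) ∂Measure.pi ν =
      Complex.I * ∑ x, ∫ z, rowForm κ x z • cexpI u (quadForm κ z) ∂Measure.pi ν := by
    rw [← integral_finsetSum _ fun x _ => i1 x, ← integral_const_mul]
    refine integral_congr_ae (Eventually.of_forall fun z => ?_)
    simp only
    rw [← Finset.sum_smul, ← quadForm, mul_smul_comm]
  have e2 : ∑ x, ∫ z, (2 * u * rowForm κ x z ^ 2) •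
      (Complex.I * cexpI u (quadForm κ z)) ∂Measure.pi ν =
      (u * Complex.I) * (∫ z, cexpI u (quadForm κ z) ∂Measure.pi ν) +
        ∫ z, (2 * u * W z) • (Complex.I * cexpI u (quadForm κ z)) ∂Measure.pi ν := by
    rw [← integral_finsetSum _ fun x _ => i3 x, ← integral_const_mul,
      ← integral_add (i0.const_mul _) iW]
    refine integral_congr_ae (Eventually.of_forall fun z => ?_)
    simp only
    rw [← Finset.sum_smul, ← Finset.mul_sum]
    have : 2 * u * ∑ x, rowForm κ x z ^ 2 = u + 2 * u * W z := by
      simp only [hW, hV]; ring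
    rw [this, add_smul, Complex.real_smul]
    ring
  have e3 : ∫ z, quadForm κ z • (Complex.I * cexpI u (quadForm κ z)) ∂Measure.pi ν +
      u • ∫ z, cexpI u (quadForm κ z) ∂Measure.pi ν =
      Complex.I * (∑ x, (∫ z, rowForm κ x z • cexpI u (quadForm κ z) ∂Measure.pi ν -
        ∫ z, (2 * u * rowForm κ x z ^ 2) • (Complex.I * cexpI u (quadForm κ z)) ∂Measure.pi ν) +
        ∫ z, (2 * u * W z) • (Complex.I * cexpI u (quadForm κ z)) ∂Measure.pi ν) := by
    rw [Finset.sum_sub_distrib, e2, e1, Complex.real_smul]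
    linear_combination ((u : ℂ) * ∫ z, cexpI u (quadForm κ z) ∂Measure.pi ν) * Complex.I_sq
  rw [e3, norm_mul, Complex.norm_I, one_mul]
  have b1 : ‖∑ x, (∫ z, rowForm κ x z • cexpI u (quadForm κ z) ∂Measure.pi ν -
        ∫ z, (2 * u * rowForm κ x z ^ 2) • (Complex.I * cexpI u (quadForm κ z)) ∂Measure.pi ν)‖ ≤
      u ^ 2 * (12 * ∑ x, ∫ z, |rowForm κ x z| ^ 3 ∂Measure.pi ν) := by
    refine (norm_sum_le _ _).trans ((Finset.sum_le_sum fun x _ =>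
      h.norm_integral_rowForm_smul_sub_le x u).trans (le_of_eq ?_))
    rw [← Finset.mul_sum]; ring
  have b2 : ‖∫ z, (2 * u * W z) • (Complex.I * cexpI u (quadForm κ z)) ∂Measure.pi ν‖ ≤
      |u| * (2 * ∫ z, |W z| ∂Measure.pi ν) := by
    rw [← mul_assoc, ← integral_const_mul]
    refine norm_integral_le_of_norm_le (hWi.abs.const_mul _) (Eventually.of_forall fun z => ?_)
    rw [norm_smul, norm_mul Complex.I, norm_cexpI, Complex.norm_I, Real.norm_eq_abs, abs_mul, abs_mul,
      abs_two]
    exact le_of_eq (by ring)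
  refine (norm_add_le _ _).trans ?_
  have c1 := mul_le_mul_of_nonneg_left hLyap (sq_nonneg u)
  have c2 := mul_le_mul_of_nonneg_left hWabs (abs_nonneg u)
  linarith

end DegenerateKernels

/-! ### The standard normal distribution function and convergence in distribution -/

lemma Phi_eq_real (x : ℝ) : Phi x = (gaussianReal 0 1).real (Set.Iic x) := cdf_eq_real _ _

lemma Phi_mono : Monotone Phi := monotone_cdf _

lemma Phi_sub_le {a b : ℝ} (hab : a ≤ b) : Phi b - Phi a ≤ b - a := by
  have hpdf : ∀ x, gaussianPDF 0 1 x ≤ 1 := by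
    intro x
    rw [gaussianPDF, ENNReal.ofReal_le_one, gaussianPDFReal]
    have h1 : (√(2 * Real.pi * ((1 : NNReal) : ℝ)))⁻¹ ≤ 1 := by
      apply inv_le_one_of_one_le₀
      rw [Real.one_le_sqrt]
      have := Real.pi_gt_three
      simp; linarith
    have h2 : Real.exp (-(x - 0) ^ 2 / (2 * ((1 : NNReal) : ℝ))) ≤ 1 := by
      rw [Real.exp_le_one_iff]
      have := sq_nonneg (x - 0)
      apply div_nonpos_of_nonpos_of_nonneg <;> simp
      positivity
    exact mul_le_one₀ h1 (Real.exp_pos _).le h2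
  have hle : gaussianReal 0 1 (Set.Ioc a b) ≤ ENNReal.ofReal (b - a) := by
    rw [gaussianReal_apply 0 one_ne_zero, ← Real.volume_Ioc]
    calc ∫⁻ x in Set.Ioc a b, gaussianPDF 0 1 x ≤ ∫⁻ _ in Set.Ioc a b, 1 :=
          lintegral_mono fun x => hpdf x
      _ = volume (Set.Ioc a b) := by simp
  have hset : Set.Iic a ∪ Set.Ioc a b = Set.Iic b := Set.Iic_union_Ioc_eq_Iic hab
  have hadd : (gaussianReal 0 1).real (Set.Iic b) =
      (gaussianReal 0 1).real (Set.Iic a) + (gaussianReal 0 1).real (Set.Ioc a b) := by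
    have hdisj : Disjoint (Set.Iic a) (Set.Ioc a b) :=
      Set.disjoint_left.2 fun x hx hx' => not_le.2 hx'.1 hx
    rw [← hset, measureReal_union hdisj measurableSet_Ioc]
  rw [Phi_eq_real, Phi_eq_real, hadd]
  have : (gaussianReal 0 1).real (Set.Ioc a b) ≤ b - a := by
    rw [Measure.real]
    exact ENNReal.toReal_le_of_le_ofReal (by linarith) hle
  linarith

lemma Phi_neg (x : ℝ) : Phi (-x) = 1 - Phi x := by
  have hmap : (gaussianReal 0 1).map (fun y => -y) = gaussianReal 0 1 := by
    simpa using gaussianReal_map_neg (μ := 0) (v := 1)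
  have hatom := nullSingletonClass_gaussianReal (μ := 0) (v := 1) one_ne_zero
  have h1 : gaussianReal 0 1 (Set.Iic (-x)) = gaussianReal 0 1 (Set.Ioi x) := by
    conv_lhs => rw [← hmap]
    rw [Measure.map_apply measurable_neg measurableSet_Iic]
    have : (fun y : ℝ => -y) ⁻¹' Set.Iic (-x) = Set.Ici x := by ext y; simp
    rw [this]
    exact (measure_congr Ioi_ae_eq_Ici).symm
  rw [Phi_eq_real, Phi_eq_real, measureReal_def, h1, ← measureReal_def, ← Set.compl_Iic,
    probReal_compl_eq_one_sub measurableSet_Iic]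

lemma Phi_pos (x : ℝ) : 0 < Phi x := by
  rw [Phi_eq_real, measureReal_def]
  refine ENNReal.toReal_pos ?_ (measure_ne_top _ _)
  intro h0
  have := gaussianReal_absolutelyContinuous' 0 one_ne_zero h0
  simp at this

/-- Pólya's theorem for the normal limit: pointwise convergence of distribution functions to `Φ`
is uniform. -/
lemma tendstoUniformly_of_tendsto_Phi {F : ℕ → ℝ → ℝ} (hmono : ∀ t, Monotone (F t))
    (h0 : ∀ t x, 0 ≤ F t x) (h1 : ∀ t x, F t x ≤ 1)
    (hF : ∀ x, Tendsto (fun t => F t x) atTop (𝓝 (Phi x))) {ε : ℝ} (hε : 0 < ε) :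
    ∀ᶠ t in atTop, ∀ x, |F t x - Phi x| ≤ 2 * ε := by
  -- a grid of mesh `ε` on which convergence is checked, beyond it both functions are nearly constant
  have hbot : ∃ N : ℕ, Phi (-(N * ε)) ≤ ε := by
    have : Tendsto (fun N : ℕ => Phi (-(N * ε))) atTop (𝓝 0) :=
      (tendsto_cdf_atBot (gaussianReal 0 1)).comp
        (tendsto_neg_atTop_atBot.comp (tendsto_natCast_atTop_atTop.atTop_mul_const hε))
    exact ((this.eventually (ge_mem_nhds hε)).exists)
  obtain ⟨N, hN⟩ := hbot
  have hN' : 1 - ε ≤ Phi (N * ε) := by have := Phi_neg (N * ε); linarith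
  have hev : ∀ᶠ t in atTop, ∀ j ∈ Finset.Icc (-(N : ℤ)) N,
      |F t (j * ε) - Phi (j * ε)| ≤ ε := by
    rw [Filter.eventually_all_finset]
    intro j _
    have := (hF (j * ε)).sub_const (Phi (j * ε))
    rw [sub_self] at this
    have := this.abs
    rw [abs_zero] at this
    exact this.eventually (ge_mem_nhds hε)
  filter_upwards [hev] with t ht x
  have hΦ0 : ∀ x, 0 ≤ Phi x := fun x => cdf_nonneg _ _
  have hΦ1 : ∀ x, Phi x ≤ 1 := fun x => cdf_le_one _ _
  by_cases hx1 : x < -(N * ε)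
  · have a1 := ht (-(N : ℤ)) (by simp)
    push_cast at a1
    rw [neg_mul] at a1
    have a2 := hmono t hx1.le
    have a3 := Phi_mono hx1.le
    rw [abs_le] at a1 ⊢
    constructor <;> linarith [h0 t x, hΦ0 x]
  push Not at hx1
  by_cases hx2 : N * ε ≤ x
  · have a1 := ht (N : ℤ) (by simp)
    push_cast at a1
    have a2 := hmono t hx2
    have a3 := Phi_mono hx2
    rw [abs_le] at a1 ⊢
    constructor <;> linarith [h1 t x, hΦ1 x]
  push Not at hx2
  set j : ℤ := ⌊x / ε⌋ with hj
  have hj1 : (j : ℝ) * ε ≤ x := by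
    have := Int.floor_le (x / ε)
    rwa [le_div_iff₀ hε] at this
  have hj2 : x ≤ ((j + 1 : ℤ) : ℝ) * ε := by
    have := (Int.lt_floor_add_one (x / ε)).le
    rw [div_le_iff₀ hε] at this
    push_cast; exact this
  have hjl : -(N : ℤ) ≤ j := by
    rw [hj, Int.le_floor, le_div_iff₀ hε]; push_cast; linarith
  have hju : j < N := by
    rw [hj, Int.floor_lt, div_lt_iff₀ hε]; push_cast; exact hx2
  have a1 := ht j (Finset.mem_Icc.2 ⟨hjl, hju.le⟩)
  have a2 := ht (j + 1) (Finset.mem_Icc.2 ⟨by omega, by omega⟩)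
  have b1 := hmono t hj1
  have b2 := hmono t hj2
  have c1 := Phi_mono hj1
  have c2 := Phi_mono hj2
  have d : Phi (((j + 1 : ℤ) : ℝ) * ε) - Phi (j * ε) ≤ ε := by
    refine (Phi_sub_le (hj1.trans hj2)).trans (le_of_eq ?_)
    push_cast; ring
  rw [abs_le] at a1 a2 ⊢
  constructor <;> linarith

section Weak

variable {Ω : ℕ → Type*} [∀ t, MeasurableSpace (Ω t)] (P : (t : ℕ) → Measure (Ω t))
  [∀ t, IsProbabilityMeasure (P t)]

/-- Lévy's continuity theorem, for distribution functions on varying probability spaces. -/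
lemma tendsto_real_le_Phi (X : (t : ℕ) → Ω t → ℝ) (hX : ∀ t, AEMeasurable (X t) (P t))
    (hchar : ∀ u, Tendsto (fun t => ∫ ω, cexpI u (X t ω) ∂P t) atTop
      (𝓝 ((Real.exp (-(u ^ 2 / 2)) : ℝ) : ℂ))) (x : ℝ) :
    Tendsto (fun t => (P t).real {ω | X t ω ≤ x}) atTop (𝓝 (Phi x)) := by
  have hprob : ∀ t, IsProbabilityMeasure ((P t).map (X t)) := fun t =>
    Measure.isProbabilityMeasure_map (hX t)
  let μs : ℕ → ProbabilityMeasure ℝ := fun t => ⟨(P t).map (X t), hprob t⟩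
  let μ₀ : ProbabilityMeasure ℝ := ⟨gaussianReal 0 1, inferInstance⟩
  have hlim : Tendsto μs atTop (𝓝 μ₀) := by
    rw [ProbabilityMeasure.tendsto_iff_tendsto_charFun]
    intro u
    have e1 : charFun (μ₀ : Measure ℝ) u = ((Real.exp (-(u ^ 2 / 2)) : ℝ) : ℂ) := by
      change charFun (gaussianReal 0 1) u = _
      rw [charFun_gaussianReal]
      push_cast
      congr 1; simp
    have e2 : ∀ t, charFun (μs t : Measure ℝ) u = ∫ ω, cexpI u (X t ω) ∂P t := by
      intro t
      change charFun ((P t).map (X t)) u = _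
      rw [charFun_apply_real, integral_map (hX t) (by fun_prop)]
      refine integral_congr_ae (Eventually.of_forall fun ω => ?_)
      simp [cexpI]
    rw [e1]
    simp_rw [e2]
    exact hchar u
  have hfr : (μ₀ : Measure ℝ) (frontier (Set.Iic x)) = 0 := by
    change gaussianReal 0 1 (frontier (Set.Iic x)) = 0
    have := nullSingletonClass_gaussianReal (μ := 0) (v := 1) one_ne_zero
    rw [frontier_Iic]
    exact measure_singleton x
  have := ProbabilityMeasure.tendsto_measure_of_null_frontier_of_tendsto' hlim hfr
  have h2 := (ENNReal.tendsto_toReal (measure_ne_top _ _)).comp this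
  rw [Phi_eq_real]
  refine h2.congr fun t => ?_
  change ((P t).map (X t) (Set.Iic x)).toReal = _
  rw [Measure.map_apply_of_aemeasurable (hX t) measurableSet_Iic]
  rfl

/-- Slutsky's theorem with moving thresholds: an event that coincides with `c ≤ X + V`, up to
vanishing probability and a negligible `V`, has asymptotically the normal probability of
`[c, ∞)`. -/
lemma tendsto_real_sub_Phi (X : (t : ℕ) → Ω t → ℝ) (hX : ∀ t, AEMeasurable (X t) (P t))
    (hcdf : ∀ x, Tendsto (fun t => (P t).real {ω | X t ω ≤ x}) atTop (𝓝 (Phi x)))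
    (V : (t : ℕ) → Ω t → ℝ) (A : (t : ℕ) → Set (Ω t)) (c : ℕ → ℝ)
    (hA : ∀ δ > 0, Tendsto (fun t => (P t).real
      {ω | ¬ ((ω ∈ A t ↔ c t ≤ X t ω + V t ω) ∧ |V t ω| ≤ δ)}) atTop (𝓝 0)) :
    Tendsto (fun t => (P t).real (A t) - Phi (-(c t))) atTop (𝓝 0) := by
  rw [Metric.tendsto_atTop']
  intro ε hε
  set δ := ε / 10 with hδdef
  have hδ : 0 < δ := by positivity
  have hunif := tendstoUniformly_of_tendsto_Phi
    (F := fun t x => (P t).real {ω | X t ω ≤ x})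
    (fun t x y hxy => measureReal_mono fun ω hω => le_trans hω hxy)
    (fun t x => measureReal_nonneg) (fun t x => measureReal_le_one) hcdf hδ
  have hbad := (hA δ hδ).eventually (ge_mem_nhds hδ)
  obtain ⟨N, hN⟩ := eventually_atTop.1 (hunif.and hbad)
  refine ⟨N, fun t ht => ?_⟩
  obtain ⟨hu, hb⟩ := hN t ht.le
  set B := {ω | ¬ ((ω ∈ A t ↔ c t ≤ X t ω + V t ω) ∧ |V t ω| ≤ δ)} with hB
  have hcompl : ∀ x, (P t).real {ω | x < X t ω} = 1 - (P t).real {ω | X t ω ≤ x} := by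
    intro x
    have hn : NullMeasurableSet {ω | X t ω ≤ x} (P t) :=
      (hX t).nullMeasurable measurableSet_Iic
    have := probReal_compl_eq_one_sub₀ hn
    rw [← this]
    congr 1; ext ω; simp
  have up : (P t).real (A t) ≤ δ + (1 - (P t).real {ω | X t ω ≤ c t - 2 * δ}) := by
    rw [← hcompl]
    refine (measureReal_mono (s₂ := B ∪ {ω | c t - 2 * δ < X t ω}) fun ω hω => ?_).trans
      ((measureReal_union_le _ _).trans (by gcongr))
    by_cases hωB : ω ∈ B
    · exact Or.inl hωB
    · right
      simp only [hB, Set.mem_ofPred_eq, not_not] at hωB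
      have h1 := hωB.1.1 hω
      have h2 := (abs_le.1 hωB.2).2
      simp only [Set.mem_ofPred_eq]
      linarith
  have lo : 1 - (P t).real {ω | X t ω ≤ c t + δ} ≤ (P t).real (A t) + δ := by
    rw [← hcompl]
    refine (measureReal_mono (s₂ := A t ∪ B) fun ω hω => ?_).trans
      ((measureReal_union_le _ _).trans (by gcongr))
    by_cases hωB : ω ∈ B
    · exact Or.inr hωB
    · left
      simp only [hB, Set.mem_ofPred_eq, not_not] at hωB
      have h2 := (abs_le.1 hωB.2).1
      simp only [Set.mem_ofPred_eq] at hω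
      exact hωB.1.2 (by linarith)
  have l1 := Phi_sub_le (a := c t - 2 * δ) (b := c t) (by linarith)
  have l2 := Phi_sub_le (a := c t) (b := c t + δ) (by linarith)
  have u1 := abs_le.1 (hu (c t - 2 * δ))
  have u2 := abs_le.1 (hu (c t + δ))
  rw [Real.dist_eq, sub_zero, Phi_neg, abs_lt]
  constructor <;> linarith

end Weak

/-! ### Moments of linear images of pseudo-independent vectors -/

/-- A centered law on `ℝ^p` with covariance matrix `B Bᵀ` whose linear functionals have fourth
moments controlled by their variances. -/
structure LinearLaw {p m : ℕ} (ν : Measure (Fin p → ℝ)) (B : Matrix (Fin p) (Fin m) ℝ) (C : ℝ) :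
    Prop where
  memLp : ∀ r, MemLp (fun v : Fin p → ℝ => v r) 4 ν
  mean : ∀ r, ∫ v, v r ∂ν = 0
  cov : ∀ r s, ∫ v, v r * v s ∂ν = (B * Bᵀ) r s
  fourth : ∀ u, ∫ v, (u ⬝ᵥ v) ^ 4 ∂ν ≤ C ^ 2 * (u ⬝ᵥ (B * Bᵀ) *ᵥ u) ^ 2
  const_nonneg : 0 ≤ C

lemma memLp_four_of_integrable_pow {Ω : Type*} [MeasurableSpace Ω] {P : Measure Ω} {f : Ω → ℝ}
    (hm : AEStronglyMeasurable f P) (hi : Integrable (fun ω => f ω ^ 4) P) : MemLp f 4 P := by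
  rw [← integrable_norm_rpow_iff hm (by norm_num) (by norm_num)]
  refine hi.congr (Eventually.of_forall fun ω => ?_)
  have : (4 : ENNReal).toReal = ((4 : ℕ) : ℝ) := by norm_num
  simp only
  rw [this, Real.rpow_natCast, Real.norm_eq_abs, Even.pow_abs (by decide)]

lemma measurable_dot {p : ℕ} (u : Fin p → ℝ) : Measurable fun v : Fin p → ℝ => u ⬝ᵥ v := by
  simp only [dotProduct]
  exact Finset.measurable_fun_sum _ fun r _ => by fun_prop

section Coordinates

variable {Ω : Type*} [MeasurableSpace Ω] {P : Measure Ω} [IsProbabilityMeasure P] {m : ℕ}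

/-- Mixed fourth-order moments with an isolated coordinate vanish. -/
lemma integral_mul_four_eq_zero_of_factor {X : Ω → Fin m → ℝ}
    (hX : ∀ s, MemLp (fun ω => X ω s) 4 P) (h0 : ∀ s, ∫ ω, X ω s ∂P = 0)
    (hfac : ∀ (r : ℕ) (s : Fin r → Fin m) (e : Fin r → ℕ), 0 < r → Function.Injective s →
      (∀ l, 0 < e l) → ∑ l, e l ≤ 8 →
      (∀ l, Integrable (fun ω => X ω (s l) ^ e l) P) →
      Integrable (fun ω => ∏ l, X ω (s l) ^ e l) P →
      ∫ ω, ∏ l, X ω (s l) ^ e l ∂P = ∏ l, ∫ ω, X ω (s l) ^ e l ∂P)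
    {a b c d : Fin m} (hda : d ≠ a) (hdb : d ≠ b) (hdc : d ≠ c) :
    ∫ ω, X ω a * X ω b * (X ω c * X ω d) ∂P = 0 := by
  have hint := integrable_mul_four (hX a) (hX b) (hX c) (hX d)
  have hi1 : ∀ s, Integrable (fun ω => X ω s ^ 1) P := fun s => by
    simpa using (hX s).integrable (by norm_num)
  have hi2 : ∀ s, Integrable (fun ω => X ω s ^ 2) P := fun s =>
    ((hX s).mono_exponent (q := 4) (p := 2) (by norm_num)).integrable_sq
  have hi3 : ∀ s, Integrable (fun ω => X ω s ^ 3) P := fun s =>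
    (integrable_mul_four (hX s) (hX s) (hX s) (memLp_const 1)).congr
      (Eventually.of_forall fun ω => by simp only; ring)
  have pair : ∀ a d : Fin m, d ≠ a →
      Integrable (fun ω => X ω a ^ 3 * X ω d) P → ∫ ω, X ω a ^ 3 * X ω d ∂P = 0 := by
    intro a d hda hi
    have := hfac 2 ![a, d] ![3, 1] (by norm_num)
      (by intro i j; fin_cases i <;> fin_cases j <;> simp [hda, hda.symm])
      (by intro l; fin_cases l <;> simp) (by simp [Fin.sum_univ_succ])
      (by intro l; fin_cases l <;> simp; exacts [hi3 a, by simpa using hi1 d])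
      (by simpa [Fin.prod_univ_succ] using hi)
    simpa [Fin.prod_univ_succ, h0] using this
  have triple : ∀ a c d : Fin m, a ≠ c → d ≠ a → d ≠ c →
      Integrable (fun ω => X ω a ^ 2 * (X ω c * X ω d)) P →
      ∫ ω, X ω a ^ 2 * (X ω c * X ω d) ∂P = 0 := by
    intro a c d hac hda hdc hi
    have := hfac 3 ![a, c, d] ![2, 1, 1] (by norm_num)
      (by intro i j; fin_cases i <;> fin_cases j <;> simp [hda, hda.symm, hac, hac.symm, hdc, hdc.symm])
      (by intro l; fin_cases l <;> simp) (by simp [Fin.sum_univ_succ])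
      (by intro l; fin_cases l <;> simp
          exacts [hi2 a, by simpa using hi1 c, by simpa using hi1 d])
      (by simpa [Fin.prod_univ_succ] using hi)
    simpa [Fin.prod_univ_succ, h0] using this
  by_cases hab : a = b
  · subst hab
    by_cases hac : a = c
    · subst hac
      have e : ∀ ω, X ω a * X ω a * (X ω a * X ω d) = X ω a ^ 3 * X ω d := fun ω => by ring
      simp_rw [e] at hint ⊢
      exact pair a d hda hint
    · have e : ∀ ω, X ω a * X ω a * (X ω c * X ω d) = X ω a ^ 2 * (X ω c * X ω d) := fun ω => by ring
      simp_rw [e] at hint ⊢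
      exact triple a c d hac hda hdc hint
  by_cases hac : a = c
  · subst hac
    have e : ∀ ω, X ω a * X ω b * (X ω a * X ω d) = X ω a ^ 2 * (X ω b * X ω d) := fun ω => by ring
    simp_rw [e] at hint ⊢
    exact triple a b d hab hda hdb hint
  by_cases hbc : b = c
  · subst hbc
    have e : ∀ ω, X ω a * X ω b * (X ω b * X ω d) = X ω b ^ 2 * (X ω a * X ω d) := fun ω => by ring
    simp_rw [e] at hint ⊢
    exact triple b a d (Ne.symm hab) hdb hda hint
  have := hfac 4 ![a, b, c, d] ![1, 1, 1, 1] (by norm_num)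
    (by intro i j; fin_cases i <;> fin_cases j <;>
          simp [hda, hda.symm, hdb, hdb.symm, hdc, hdc.symm, hab, Ne.symm hab, hac, Ne.symm hac, hbc,
            Ne.symm hbc])
    (by intro l; fin_cases l <;> simp) (by simp [Fin.sum_univ_succ])
    (by intro l; fin_cases l <;> simp
        exacts [by simpa using hi1 a, by simpa using hi1 b, by simpa using hi1 c, by simpa using hi1 d])
    (by simpa [Fin.prod_univ_succ, mul_assoc] using hint)
  simpa [Fin.prod_univ_succ, h0, mul_assoc] using this

/-- The law of `B X` for a random vector `X` with standardized, pseudo-independent coordinates. -/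
lemma linearLaw_map {p : ℕ} (B : Matrix (Fin p) (Fin m) ℝ) {X : Ω → Fin m → ℝ}
    (hXm : Measurable X) {M : ℝ}
    (hX : ∀ s, MemLp (fun ω => X ω s) 4 P) (h0 : ∀ s, ∫ ω, X ω s ∂P = 0)
    (hcov : ∀ s t, ∫ ω, X ω s * X ω t ∂P = (1 : Matrix (Fin m) (Fin m) ℝ) s t)
    (h4 : ∀ s, ∫ ω, X ω s ^ 4 ∂P ≤ M)
    (hz : ∀ a b c d : Fin m, d ≠ a → d ≠ b → d ≠ c →
      ∫ ω, X ω a * X ω b * (X ω c * X ω d) ∂P = 0) :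
    LinearLaw (P.map fun ω => B *ᵥ X ω) B (3 * √|M|) := by
  have hBm : Measurable fun ω => B *ᵥ X ω := by
    refine measurable_pi_lambda _ fun r => ?_
    simp only [mulVec, dotProduct]
    fun_prop
  have hmem : ∀ r, MemLp (fun ω => (B *ᵥ X ω) r) 4 P := by
    intro r
    simp only [mulVec, dotProduct]
    exact memLp_finsetSum _ fun s _ => (hX s).const_mul (B r s)
  have hi : ∀ s, Integrable (fun ω => X ω s) P := fun s => (hX s).integrable (by norm_num)
  have hX2 : ∀ s, MemLp (fun ω => X ω s) 2 P := fun s => (hX s).mono_exponent (by norm_num)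
  refine ⟨fun r => ?_, fun r => ?_, fun r s => ?_, fun u => ?_, by positivity⟩
  · rw [memLp_map_measure_iff (measurable_pi_apply r).aestronglyMeasurable hBm.aemeasurable]
    exact hmem r
  · rw [integral_map hBm.aemeasurable (measurable_pi_apply r).aestronglyMeasurable]
    simp only [mulVec, dotProduct]
    rw [integral_finsetSum _ fun s _ => (hi s).const_mul _]
    simp [integral_const_mul, h0]
  · rw [integral_map hBm.aemeasurable (by fun_prop)]
    simp only [mulVec, dotProduct, Finset.sum_mul_sum]
    have e : ∀ k l, Integrable (fun ω => B r k * X ω k * (B s l * X ω l)) P := fun k l =>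
      integrable_mul_of_memLp_two ((hX2 k).const_mul _) ((hX2 l).const_mul _)
    rw [integral_finsetSum _ fun k _ => integrable_finsetSum _ fun l _ => e k l]
    simp_rw [Matrix.mul_apply, Matrix.transpose_apply]
    refine Finset.sum_congr rfl fun k _ => ?_
    rw [integral_finsetSum _ fun l _ => e k l, Finset.sum_eq_single k]
    · have : ∀ ω, B r k * X ω k * (B s k * X ω k) = (B r k * B s k) * (X ω k * X ω k) :=
        fun ω => by ring
      simp_rw [this]
      rw [integral_const_mul, hcov]; simp
    · intro l _ hl
      have : ∀ ω, B r k * X ω k * (B s l * X ω l) = (B r k * B s l) * (X ω k * X ω l) :=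
        fun ω => by ring
      simp_rw [this]
      rw [integral_const_mul, hcov, Matrix.one_apply_ne hl.symm, mul_zero]
    · simp
  · rw [integral_map hBm.aemeasurable ((measurable_dot u).pow_const 4).aestronglyMeasurable]
    set w : Fin m → ℝ := u ᵥ* B with hw
    have hdot : ∀ ω, u ⬝ᵥ (B *ᵥ X ω) = ∑ s, w s * X ω s := fun ω => by
      rw [Matrix.dotProduct_mulVec]; rfl
    have hquad : u ⬝ᵥ (B * Bᵀ) *ᵥ u = ∑ s, w s ^ 2 := by
      rw [← Matrix.mulVec_mulVec, Matrix.dotProduct_mulVec, Matrix.mulVec_transpose]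
      simp [dotProduct, hw, pow_two]
    simp_rw [hdot, hquad]
    have hmain := sqrt_integral_pow_four_sum_le Finset.univ (fun s ω => w s * X ω s)
      (fun s _ => (hX s).const_mul (w s)) (fun a _ b _ c _ d _ hda hdb hdc => by
        have : ∀ ω, w a * X ω a * (w b * X ω b) * (w c * X ω c * (w d * X ω d)) =
          (w a * w b * w c * w d) * (X ω a * X ω b * (X ω c * X ω d)) := fun ω => by ring
        simp_rw [this]
        rw [integral_const_mul, hz a b c d hda hdb hdc, mul_zero])
    have hterm : ∀ s, √(∫ ω, (w s * X ω s) ^ 4 ∂P) ≤ √|M| * w s ^ 2 := by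
      intro s
      rw [Real.sqrt_le_left (by positivity)]
      simp_rw [mul_pow]
      rw [integral_const_mul, Real.sq_sqrt (abs_nonneg M)]
      have := mul_le_mul_of_nonneg_left ((h4 s).trans (le_abs_self M)) (by positivity : 0 ≤ w s ^ 4)
      linarith [show (w s ^ 2) ^ 2 = w s ^ 4 by ring, show w s ^ 4 * |M| = |M| * (w s ^ 2) ^ 2 by ring]
    have hfin : √(∫ ω, (∑ s, w s * X ω s) ^ 4 ∂P) ≤ 3 * √|M| * ∑ s, w s ^ 2 := by
      refine hmain.trans ?_
      rw [mul_assoc, Finset.mul_sum (a := √|M|)]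
      exact mul_le_mul_of_nonneg_left (Finset.sum_le_sum fun s _ => hterm s) (by norm_num)
    rw [Real.sqrt_le_left (mul_nonneg (by positivity)
      (Finset.sum_nonneg fun s _ => sq_nonneg _)), mul_pow] at hfin
    exact hfin

end Coordinates

namespace LinearLaw

variable {p m : ℕ} {ν : Measure (Fin p → ℝ)} [IsProbabilityMeasure ν]
  {B : Matrix (Fin p) (Fin m) ℝ} {C : ℝ} (h : LinearLaw ν B C)
include h

lemma memLp_dot (u : Fin p → ℝ) : MemLp (fun v => u ⬝ᵥ v) 4 ν := by
  simp only [dotProduct]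
  exact memLp_finsetSum _ fun r _ => (h.memLp r).const_mul _

lemma integral_dot (u : Fin p → ℝ) : ∫ v, u ⬝ᵥ v ∂ν = 0 := by
  simp only [dotProduct]
  rw [integral_finsetSum _ fun r _ => ((h.memLp r).integrable (by norm_num)).const_mul _]
  simp [integral_const_mul, h.mean]

lemma integral_dot_mul_dot (a c : Fin p → ℝ) :
    ∫ v, (a ⬝ᵥ v) * (c ⬝ᵥ v) ∂ν = a ⬝ᵥ (B * Bᵀ) *ᵥ c := by
  have h2 : ∀ r, MemLp (fun v : Fin p → ℝ => v r) 2 ν := fun r =>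
    (h.memLp r).mono_exponent (by norm_num)
  have hi : ∀ r s, Integrable (fun v : Fin p → ℝ => a r * v r * (c s * v s)) ν := fun r s =>
    integrable_mul_of_memLp_two ((h2 r).const_mul _) ((h2 s).const_mul _)
  simp only [dotProduct, Finset.sum_mul_sum, mulVec]
  rw [integral_finsetSum _ fun r _ => integrable_finsetSum _ fun s _ => hi r s]
  refine Finset.sum_congr rfl fun r _ => ?_
  rw [integral_finsetSum _ fun s _ => hi r s, Finset.mul_sum]
  refine Finset.sum_congr rfl fun s _ => ?_
  have : ∀ v : Fin p → ℝ, a r * v r * (c s * v s) = (a r * c s) * (v r * v s) := fun v => by ring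
  simp_rw [this]
  rw [integral_const_mul, h.cov]; ring

/-- Second moments of nonnegative quadratic forms. -/
lemma integral_quadratic_sq_le {l : ℕ} (A : Matrix (Fin p) (Fin l) ℝ) :
    ∫ v, (v ⬝ᵥ (A * Aᵀ) *ᵥ v) ^ 2 ∂ν ≤ C ^ 2 * ((A * Aᵀ) * (B * Bᵀ)).trace ^ 2 := by
  set u : Fin l → Fin p → ℝ := fun k r => A r k with hu
  have hq : ∀ v, v ⬝ᵥ (A * Aᵀ) *ᵥ v = ∑ k, (u k ⬝ᵥ v) ^ 2 := by
    intro v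
    rw [← Matrix.mulVec_mulVec, Matrix.dotProduct_mulVec, Matrix.mulVec_transpose]
    simp only [dotProduct, vecMul, pow_two, hu]
    simp_rw [mul_comm]
  have htr : ((A * Aᵀ) * (B * Bᵀ)).trace = ∑ k, u k ⬝ᵥ (B * Bᵀ) *ᵥ u k := by
    rw [Matrix.mul_assoc, Matrix.trace_mul_comm, Matrix.trace]
    refine Finset.sum_congr rfl fun k _ => ?_
    rw [Matrix.diag_apply, Matrix.mul_apply', Matrix.dotProduct_mulVec, Matrix.mul_apply_eq_vecMul]
    rfl
  have hpsd : ∀ k, 0 ≤ u k ⬝ᵥ (B * Bᵀ) *ᵥ u k := by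
    intro k
    rw [← h.integral_dot_mul_dot]
    exact integral_nonneg fun v => mul_self_nonneg _
  simp_rw [hq]
  have hmem : ∀ k, MemLp (fun v => (u k ⬝ᵥ v) ^ 2) 2 ν := fun k => by
    simpa [pow_two] using memLp_two_mul_of_memLp_four (h.memLp_dot (u k)) (h.memLp_dot (u k))
  have hs : √(∫ v, (∑ k, (u k ⬝ᵥ v) ^ 2) ^ 2 ∂ν) ≤ C * ((A * Aᵀ) * (B * Bᵀ)).trace := by
    refine (sqrt_integral_sq_sum_le Finset.univ _ fun k _ => hmem k).trans ?_
    rw [htr, Finset.mul_sum]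
    refine Finset.sum_le_sum fun k _ => ?_
    rw [Real.sqrt_le_left (mul_nonneg h.const_nonneg (hpsd k)), mul_pow]
    simp_rw [← pow_mul]
    exact h.fourth (u k)
  rw [Real.sqrt_le_left, mul_pow] at hs
  · exact hs
  · rw [htr]; exact mul_nonneg h.const_nonneg (Finset.sum_nonneg fun k _ => hpsd k)

end LinearLaw

/-! ### Weighted inner products of independent vectors as degenerate kernels -/

section DotKernels

variable {I : Type*} [Fintype I] [DecidableEq I] {p m : ℕ}

/-- The kernel `c_{xy} ⟨a, b⟩`. -/
def dotKer (c : I → I → ℝ) (x y : I) (a b : Fin p → ℝ) : ℝ := c x y * (a ⬝ᵥ b)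

/-- The average over `v` of the product of `dotKer c x y v a` and `dotKer c x w v b`, when `v` has a
centered law with covariance matrix `B x (B x)ᵀ`. -/
def dotAvg (c : I → I → ℝ) (B : I → Matrix (Fin p) (Fin m) ℝ) (x y w : I) (a b : Fin p → ℝ) : ℝ :=
  c x y * c x w * (a ⬝ᵥ (B x * (B x)ᵀ) *ᵥ b)

variable {ν : I → Measure (Fin p → ℝ)} [∀ x, IsProbabilityMeasure (ν x)]
  {B : I → Matrix (Fin p) (Fin m) ℝ} {C : ℝ}

lemma integral_comp_eval (x : I) {f : (Fin p → ℝ) → ℝ} (hf : AEStronglyMeasurable f (ν x)) :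
    ∫ z : I → Fin p → ℝ, f (z x) ∂Measure.pi ν = ∫ v, f v ∂ν x := by
  have hmp := measurePreserving_eval ν x
  conv_rhs => rw [← hmp.map_eq]
  rw [integral_map hmp.measurable.aemeasurable (by rw [hmp.map_eq]; exact hf)]

lemma LinearLaw.integral_quadratic {ν : Measure (Fin p → ℝ)} [IsProbabilityMeasure ν]
    {B : Matrix (Fin p) (Fin m) ℝ}
    (h : LinearLaw ν B C) (M : Matrix (Fin p) (Fin p) ℝ) :
    ∫ v, v ⬝ᵥ M *ᵥ v ∂ν = (M * (B * Bᵀ)).trace := by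
  have h2 : ∀ r, MemLp (fun v : Fin p → ℝ => v r) 2 ν := fun r =>
    (h.memLp r).mono_exponent (by norm_num)
  have hi : ∀ r s, Integrable (fun v : Fin p → ℝ => M r s * (v r * v s)) ν := fun r s =>
    (integrable_mul_of_memLp_two (h2 r) (h2 s)).const_mul _
  have e : ∀ v : Fin p → ℝ, v ⬝ᵥ M *ᵥ v = ∑ r, ∑ s, M r s * (v r * v s) := by
    intro v
    simp only [dotProduct, mulVec, Finset.mul_sum]
    exact Finset.sum_congr rfl fun r _ => Finset.sum_congr rfl fun s _ => by ring
  simp_rw [e]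
  rw [integral_finsetSum _ fun r _ => integrable_finsetSum _ fun s _ => hi r s, Matrix.trace]
  refine Finset.sum_congr rfl fun r _ => ?_
  rw [integral_finsetSum _ fun s _ => hi r s, Matrix.diag_apply, Matrix.mul_apply]
  refine Finset.sum_congr rfl fun s _ => ?_
  rw [integral_const_mul, h.cov, Matrix.mul_apply, Matrix.mul_apply]
  simp_rw [Matrix.transpose_apply, mul_comm]

section Pi

variable (hν : ∀ x, LinearLaw (ν x) (B x) C)
include hν

lemma memLp_coord (x : I) (r : Fin p) :
    MemLp (fun z : I → Fin p → ℝ => z x r) 4 (Measure.pi ν) :=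
  ((hν x).memLp r).comp_measurePreserving (measurePreserving_eval ν x)

lemma memLp_coord_mul {x y : I} (hxy : x ≠ y) (r s : Fin p) :
    MemLp (fun z : I → Fin p → ℝ => z x r * z y s) 4 (Measure.pi ν) := by
  have hx := memLp_coord hν x r
  have hy := memLp_coord hν y s
  refine memLp_four_of_integrable_pow (hx.aestronglyMeasurable.mul hy.aestronglyMeasurable) ?_
  have hind : iIndepFun (fun (i : I) (z : I → Fin p → ℝ) => z i) (Measure.pi ν) :=
    iIndepFun_pi (X := fun _ => id) (fun _ => aemeasurable_id)
  have h2 : IndepFun (fun z : I → Fin p → ℝ => z x r ^ 4) (fun z => z y s ^ 4) (Measure.pi ν) :=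
    (hind.indepFun hxy).comp (φ := fun v : Fin p → ℝ => v r ^ 4) (ψ := fun v : Fin p → ℝ => v s ^ 4)
      (by fun_prop) (by fun_prop)
  have := h2.integrable_mul (integrable_pow_four hx) (integrable_pow_four hy)
  refine this.congr (Eventually.of_forall fun z => ?_)
  simp only [Pi.mul_apply]; ring

lemma memLp_bilinear {x y : I} (hxy : x ≠ y) (M : Matrix (Fin p) (Fin p) ℝ) :
    MemLp (fun z : I → Fin p → ℝ => z x ⬝ᵥ M *ᵥ z y) 4 (Measure.pi ν) := by
  have e : ∀ z : I → Fin p → ℝ, z x ⬝ᵥ M *ᵥ z y = ∑ r, ∑ s, M r s * (z x r * z y s) := by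
    intro z
    simp only [dotProduct, mulVec, Finset.mul_sum]
    exact Finset.sum_congr rfl fun r _ => Finset.sum_congr rfl fun s _ => by ring
  simp_rw [e]
  exact memLp_finsetSum _ fun r _ => memLp_finsetSum _ fun s _ =>
    (memLp_coord_mul hν hxy r s).const_mul _

lemma memLp_quadratic (x : I) (M : Matrix (Fin p) (Fin p) ℝ) :
    MemLp (fun z : I → Fin p → ℝ => z x ⬝ᵥ M *ᵥ z x) 2 (Measure.pi ν) := by
  have e : ∀ z : I → Fin p → ℝ, z x ⬝ᵥ M *ᵥ z x = ∑ r, ∑ s, M r s * (z x r * z x s) := by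
    intro z
    simp only [dotProduct, mulVec, Finset.mul_sum]
    exact Finset.sum_congr rfl fun r _ => Finset.sum_congr rfl fun s _ => by ring
  simp_rw [e]
  exact memLp_finsetSum _ fun r _ => memLp_finsetSum _ fun s _ =>
    (memLp_two_mul_of_memLp_four (memLp_coord hν x r) (memLp_coord hν x s)).const_mul _

lemma measurable_quadratic (M : Matrix (Fin p) (Fin p) ℝ) :
    Measurable fun v : Fin p → ℝ => v ⬝ᵥ M *ᵥ v := by
  simp only [dotProduct, mulVec]
  refine Finset.measurable_fun_sum _ fun r _ => Measurable.mul (by fun_prop) ?_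
  exact Finset.measurable_fun_sum _ fun s _ => by fun_prop

lemma integral_bilinear_sq {x y : I} (hxy : x ≠ y) (M : Matrix (Fin p) (Fin p) ℝ) :
    ∫ z : I → Fin p → ℝ, (z x ⬝ᵥ M *ᵥ z y) ^ 2 ∂Measure.pi ν =
      (Mᵀ * (B x * (B x)ᵀ) * M * (B y * (B y)ᵀ)).trace := by
  have hm : MemLp (fun z : I → Fin p → ℝ => z x ⬝ᵥ M *ᵥ z y) 2 (Measure.pi ν) :=
    (memLp_bilinear hν hxy M).mono_exponent (by norm_num)
  rw [integral_eq_integral_update ν x hm.integrable_sq]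
  have e : ∀ z : I → Fin p → ℝ, ∫ w, (Function.update z x w x ⬝ᵥ M *ᵥ Function.update z x w y) ^ 2
      ∂ν x = z y ⬝ᵥ (Mᵀ * (B x * (B x)ᵀ) * M) *ᵥ z y := by
    intro z
    simp only [Function.update_self, Function.update_of_ne hxy.symm]
    have := (hν x).integral_dot_mul_dot (M *ᵥ z y) (M *ᵥ z y)
    simp_rw [pow_two, dotProduct_comm _ (M *ᵥ z y)]
    rw [this]
    simp only [← Matrix.mulVec_mulVec]
    rw [Matrix.dotProduct_mulVec (z y) Mᵀ, Matrix.vecMul_transpose]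
  simp_rw [e]
  rw [integral_comp_eval y (f := fun v => v ⬝ᵥ (Mᵀ * (B x * (B x)ᵀ) * M) *ᵥ v)
    (measurable_quadratic hν _).aestronglyMeasurable, (hν y).integral_quadratic]

lemma integral_dot_pow_four_le {x y : I} (hxy : x ≠ y) :
    ∫ z : I → Fin p → ℝ, (z x ⬝ᵥ z y) ^ 4 ∂Measure.pi ν ≤
      (C ^ 2) ^ 2 * ((B x * (B x)ᵀ) * (B y * (B y)ᵀ)).trace ^ 2 := by
  have hm : MemLp (fun z : I → Fin p → ℝ => z x ⬝ᵥ z y) 4 (Measure.pi ν) := by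
    simpa using memLp_bilinear hν hxy 1
  have hq := memLp_quadratic hν y (B x * (B x)ᵀ)
  rw [integral_eq_integral_update ν x (integrable_pow_four hm)]
  simp only [Function.update_self, Function.update_of_ne hxy.symm]
  calc ∫ z : I → Fin p → ℝ, ∫ w, (w ⬝ᵥ z y) ^ 4 ∂ν x ∂Measure.pi ν
      ≤ ∫ z : I → Fin p → ℝ, C ^ 2 * (z y ⬝ᵥ (B x * (B x)ᵀ) *ᵥ z y) ^ 2 ∂Measure.pi ν := by
        refine integral_mono_of_nonneg (Eventually.of_forall fun z => integral_nonneg fun w => ?_)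
          (hq.integrable_sq.const_mul _) (Eventually.of_forall fun z => ?_)
        · exact (by positivity : 0 ≤ (w ⬝ᵥ z y) ^ 4)
        · simp only
          simp_rw [dotProduct_comm _ (z y)]
          exact (hν x).fourth (z y)
    _ = C ^ 2 * ∫ v, (v ⬝ᵥ (B x * (B x)ᵀ) *ᵥ v) ^ 2 ∂ν y := by
        rw [integral_const_mul, integral_comp_eval y
          (f := fun v => (v ⬝ᵥ (B x * (B x)ᵀ) *ᵥ v) ^ 2)
          ((measurable_quadratic hν _).pow_const 2).aestronglyMeasurable]
    _ ≤ C ^ 2 * (C ^ 2 * ((B x * (B x)ᵀ) * (B y * (B y)ᵀ)).trace ^ 2) :=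
        mul_le_mul_of_nonneg_left ((hν y).integral_quadratic_sq_le (B x)) (sq_nonneg C)
    _ = _ := by ring

/-- Weighted inner products of independent vectors form a degenerate kernel system; the last
hypothesis is the high-dimensionality condition on the covariance matrices. -/
lemma degenerateKernels_dot {c : I → I → ℝ} (hsymm : ∀ x y, c x y = c y x) (hdiag : ∀ x, c x x = 0)
    {δ : ℝ} (hδ0 : 0 ≤ δ)
    (hδ : ∀ x y w, ((B x * (B x)ᵀ) * (B y * (B y)ᵀ) * (B x * (B x)ᵀ) * (B w * (B w)ᵀ)).trace ≤
      δ ^ 2 * (((B x * (B x)ᵀ) * (B y * (B y)ᵀ)).trace * ((B x * (B x)ᵀ) * (B w * (B w)ᵀ)).trace)) :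
    DegenerateKernels ν (dotKer c) (dotAvg c B)
      (fun x y => c x y ^ 2 * ((B x * (B x)ᵀ) * (B y * (B y)ᵀ)).trace) (C ^ 2) δ where
  symm x y a b := by simp only [dotKer, hsymm x y, dotProduct_comm a b]
  diag x a b := by simp [dotKer, hdiag]
  centered x y _ b := by
    simp only [dotKer]
    rw [integral_const_mul]
    simp_rw [dotProduct_comm _ b]
    rw [(hν x).integral_dot, mul_zero]
  meas x y := by
    simp only [dotKer, dotProduct]
    exact (Finset.measurable_fun_sum _ fun r _ => by fun_prop).const_mul _
  memLp x y := by
    by_cases hxy : x = y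
    · subst hxy
      have : ker (dotKer c) x x = fun _ : I → Fin p → ℝ => (0 : ℝ) := by
        ext z; simp [ker, dotKer, hdiag]
      rw [this]; exact MemLp.zero'
    · have := (memLp_bilinear hν hxy 1).const_mul (c x y)
      simp only [Matrix.one_mulVec] at this
      exact this
  sq x y := by
    simp only [ker, dotKer, mul_pow]
    rw [integral_const_mul]
    by_cases hxy : x = y
    · subst hxy; simp [hdiag]
    · have := integral_bilinear_sq hν hxy 1
      simp only [Matrix.one_mulVec, Matrix.transpose_one, Matrix.one_mul, Matrix.mul_one] at this
      rw [this]
  fourth x y := by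
    simp only [ker, dotKer, mul_pow]
    rw [integral_const_mul]
    by_cases hxy : x = y
    · subst hxy; simp [hdiag]
    · have := mul_le_mul_of_nonneg_left (integral_dot_pow_four_le hν hxy)
        (by positivity : 0 ≤ c x y ^ 4)
      refine this.trans (le_of_eq (by ring))
  const_nonneg := sq_nonneg C
  avg x y w _ _ a b := by
    simp only [dotKer, dotAvg]
    have : ∀ u : Fin p → ℝ, c x y * (u ⬝ᵥ a) * (c x w * (u ⬝ᵥ b)) =
        (c x y * c x w) * ((a ⬝ᵥ u) * (b ⬝ᵥ u)) := fun u => by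
      rw [dotProduct_comm u a, dotProduct_comm u b]; ring
    simp_rw [this]
    rw [integral_const_mul, (hν x).integral_dot_mul_dot]
  avg_symm x y w a b := by
    simp only [dotAvg]
    rw [Matrix.dotProduct_mulVec, dotProduct_comm, ← Matrix.mulVec_transpose,
      Matrix.transpose_mul, Matrix.transpose_transpose]
    ring
  avg_centered x y w _ b := by
    simp only [dotAvg]
    rw [integral_const_mul]
    simp_rw [dotProduct_comm _ ((B x * (B x)ᵀ) *ᵥ b)]
    rw [(hν y).integral_dot, mul_zero]
  avg_memLp x y w := by
    have h2 : MemLp (fun z : I → Fin p → ℝ => z y ⬝ᵥ (B x * (B x)ᵀ) *ᵥ z w) 2 (Measure.pi ν) := by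
      by_cases hyw : y = w
      · subst hyw; exact memLp_quadratic hν y _
      · exact (memLp_bilinear hν hyw _).mono_exponent (by norm_num)
    exact h2.const_mul (c x y * c x w)
  delta_nonneg := hδ0
  avg_sq x y w hyw := by
    simp only [ker, dotAvg, mul_pow]
    rw [integral_const_mul, integral_bilinear_sq hν hyw, Matrix.transpose_mul,
      Matrix.transpose_transpose]
    have := mul_le_mul_of_nonneg_left (hδ x y w) (by positivity : 0 ≤ c x y ^ 2 * c x w ^ 2)
    refine this.trans (le_of_eq (by ring))

end Pi

end DotKernels

/-! ### Algebra of the statistics -/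

section WeightedDot

variable {p : ℕ} {W V : Matrix (Fin p) (Fin p) ℝ}

lemma dotProduct_mulVec_eq_sqrt (hVV : V * V = W) (hVt : Vᵀ = V) (x y : Fin p → ℝ) :
    x ⬝ᵥ (W *ᵥ y) = (V *ᵥ x) ⬝ᵥ (V *ᵥ y) := by
  rw [← hVV, ← Matrix.mulVec_mulVec, Matrix.dotProduct_mulVec, ← Matrix.mulVec_transpose, hVt]

lemma trace_mul_vecMulVec_mul (hWt : Wᵀ = W) (u v : Fin p → ℝ) :
    (W * vecMulVec u u * W * vecMulVec v v).trace = (u ⬝ᵥ (W *ᵥ v)) ^ 2 := by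
  rw [Matrix.mul_assoc (W * vecMulVec u u), Matrix.mul_vecMulVec, Matrix.mul_vecMulVec,
    Matrix.vecMulVec_mul_vecMulVec, Matrix.trace_vecMulVec, dotProduct_smul, pow_two,
    Matrix.dotProduct_mulVec u W v, ← Matrix.mulVec_transpose, hWt]
  simp

end WeightedDot

variable {K q p : ℕ} {n : Fin K → ℕ}

/-- Inner products of images under `G ⊗ W^{1/2}`. -/
lemma dTheta_dotProduct (G : Matrix (Fin q) (Fin K) ℝ) {W : Matrix (Fin p) (Fin p) ℝ}
    (hVV : matSqrt W * matSqrt W = W) (hVt : (matSqrt W)ᵀ = matSqrt W) (u v : Fin K → Fin p → ℝ) :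
    (dTheta G W *ᵥ stack u) ⬝ᵥ (dTheta G W *ᵥ stack v) =
      ∑ a, ∑ b, (Gᵀ * G) a b * (u a ⬝ᵥ (W *ᵥ v b)) := by
  have h1 : (dTheta G W)ᵀ * dTheta G W = (Gᵀ * G) ⊗ₖ W := by
    rw [dTheta, ← Matrix.kroneckerMap_transpose, ← Matrix.mul_kronecker_mul, hVt, hVV]
  rw [← Matrix.vecMul_transpose, ← Matrix.dotProduct_mulVec, Matrix.mulVec_mulVec, h1]
  simp only [dotProduct, mulVec, Fintype.sum_prod_type, Matrix.kroneckerMap_apply, stack,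
    Finset.mul_sum]
  refine Finset.sum_congr rfl fun a _ => ?_
  rw [Finset.sum_comm]
  refine Finset.sum_congr rfl fun b _ => Finset.sum_congr rfl fun r _ =>
    Finset.sum_congr rfl fun s _ => by ring

lemma sampleMean_sub (y : (a : Fin K) → Fin (n a) → Fin p → ℝ) (mu : Fin K → Fin p → ℝ) (a : Fin K)
    (ha : n a ≠ 0) :
    sampleMean (fun a i => y a i - mu a) a = sampleMean y a - mu a := by
  have h : (n a : ℝ) ≠ 0 := by exact_mod_cast ha
  simp only [sampleMean, Finset.sum_sub_distrib, Finset.sum_const, Finset.card_univ, Fintype.card_fin,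
    smul_sub]
  rw [← Nat.cast_smul_eq_nsmul ℝ, smul_smul, inv_mul_cancel₀ h, one_smul]

lemma sampleCov_sub (y : (a : Fin K) → Fin (n a) → Fin p → ℝ) (mu : Fin K → Fin p → ℝ) (a : Fin K)
    (ha : n a ≠ 0) :
    sampleCov (fun a i => y a i - mu a) a = sampleCov y a := by
  simp only [sampleCov, sampleMean_sub y mu a ha, sub_sub_sub_cancel_right]

lemma trace_mul_sampleCov (W : Matrix (Fin p) (Fin p) ℝ) (y : (a : Fin K) → Fin (n a) → Fin p → ℝ)
    (a : Fin K) :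
    (W * sampleCov y a).trace = ((n a : ℝ) - 1)⁻¹ *
      ∑ i, (y a i - sampleMean y a) ⬝ᵥ (W *ᵥ (y a i - sampleMean y a)) := by
  rw [sampleCov, Matrix.mul_smul, Matrix.trace_smul, Matrix.mul_sum, Matrix.trace_sum, smul_eq_mul]
  congr 1
  refine Finset.sum_congr rfl fun i _ => ?_
  rw [Matrix.mul_vecMulVec, Matrix.trace_vecMulVec, dotProduct_comm]

lemma trace_sampleCov_sampleCov {W : Matrix (Fin p) (Fin p) ℝ} (hWt : Wᵀ = W)
    (y : (a : Fin K) → Fin (n a) → Fin p → ℝ) (a b : Fin K) :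
    (W * sampleCov y a * W * sampleCov y b).trace = ((n a : ℝ) - 1)⁻¹ * ((n b : ℝ) - 1)⁻¹ *
      ∑ i, ∑ j, ((y a i - sampleMean y a) ⬝ᵥ (W *ᵥ (y b j - sampleMean y b))) ^ 2 := by
  simp only [sampleCov, Matrix.mul_smul, Matrix.smul_mul, Matrix.trace_smul, Matrix.mul_sum,
    Matrix.sum_mul, Matrix.trace_sum, smul_eq_mul, trace_mul_vecMulVec_mul hWt]
  simp only [← Finset.mul_sum]
  rw [Finset.sum_comm]
  ring

/-- Inner products of centered vectors in terms of the uncentered inner products. -/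
lemma centered_dotProduct {W : Matrix (Fin p) (Fin p) ℝ} (y : (a : Fin K) → Fin (n a) → Fin p → ℝ)
    (a b : Fin K) (i : Fin (n a)) (j : Fin (n b)) :
    (y a i - sampleMean y a) ⬝ᵥ (W *ᵥ (y b j - sampleMean y b)) =
      y a i ⬝ᵥ (W *ᵥ y b j) - (∑ l, y a i ⬝ᵥ (W *ᵥ y b l)) / n b -
        (∑ k, y a k ⬝ᵥ (W *ᵥ y b j)) / n a +
        (∑ k, ∑ l, y a k ⬝ᵥ (W *ᵥ y b l)) / (n a * n b) := by
  simp only [sampleMean, Matrix.mulVec_sub, Matrix.mulVec_smul, Matrix.mulVec_sum,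
    sub_dotProduct, dotProduct_sub, smul_dotProduct, dotProduct_smul, sum_dotProduct, dotProduct_sum,
    smul_eq_mul, ← Finset.mul_sum, Finset.sum_sub_distrib]
  rw [Finset.sum_comm (f := fun l k => y a k ⬝ᵥ (W *ᵥ y b l))]
  simp only [div_eq_mul_inv, mul_inv]
  ring

lemma sampleMean_dotProduct {W : Matrix (Fin p) (Fin p) ℝ}
    (y : (a : Fin K) → Fin (n a) → Fin p → ℝ) (a b : Fin K) :
    sampleMean y a ⬝ᵥ (W *ᵥ sampleMean y b) =
      (∑ k, ∑ l, y a k ⬝ᵥ (W *ᵥ y b l)) / (n a * n b) := by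
  simp only [sampleMean, Matrix.mulVec_smul, Matrix.mulVec_sum,
    smul_dotProduct, dotProduct_smul, sum_dotProduct, dotProduct_sum, smul_eq_mul,
    ← Finset.mul_sum]
  rw [Finset.sum_comm (f := fun l k => y a k ⬝ᵥ (W *ᵥ y b l))]
  simp only [div_eq_mul_inv, mul_inv]
  ring

/-- The test statistic as a bias-corrected squared norm. -/
lemma testStat_eq (G : Matrix (Fin q) (Fin K) ℝ) {W : Matrix (Fin p) (Fin p) ℝ}
    (hVV : matSqrt W * matSqrt W = W) (hVt : (matSqrt W)ᵀ = matSqrt W) (hn : ∀ a, 2 ≤ n a)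
    (y : (a : Fin K) → Fin (n a) → Fin p → ℝ) :
    testStat G W y = sqNorm (dTheta G W *ᵥ stack (sampleMean y)) -
      ∑ a, (Gᵀ * G) a a / (n a : ℝ) * (W * sampleCov y a).trace := by
  have hself : ∀ a, (Gᵀ * G) a a * uSelf W y a =
      (Gᵀ * G) a a * (sampleMean y a ⬝ᵥ (W *ᵥ sampleMean y a)) -
        (Gᵀ * G) a a / (n a : ℝ) * (W * sampleCov y a).trace := by
    intro a
    have h2 : (2 : ℝ) ≤ n a := by exact_mod_cast hn a
    have hn0 : (n a : ℝ) ≠ 0 := by linarith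
    have hn1 : (n a : ℝ) - 1 ≠ 0 := by linarith
    rw [sampleMean_dotProduct, trace_mul_sampleCov, uSelf]
    simp_rw [centered_dotProduct, Finset.sum_add_distrib, Finset.sum_sub_distrib]
    have e1 : ∑ i, ∑ j, (if i ≠ j then y a i ⬝ᵥ (W *ᵥ y a j) else 0) =
        (∑ i, ∑ j, y a i ⬝ᵥ (W *ᵥ y a j)) - ∑ i, y a i ⬝ᵥ (W *ᵥ y a i) := by
      rw [← Finset.sum_sub_distrib]
      refine Finset.sum_congr rfl fun i _ => ?_
      have : ∀ j, (if i ≠ j then y a i ⬝ᵥ (W *ᵥ y a j) else 0) =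
          y a i ⬝ᵥ (W *ᵥ y a j) - if i = j then y a i ⬝ᵥ (W *ᵥ y a j) else 0 := by
        intro j; by_cases h : i = j <;> simp [h]
      simp_rw [this, Finset.sum_sub_distrib]
      simp
    rw [e1, ← Finset.sum_div, ← Finset.sum_div,
      Finset.sum_comm (f := fun i k => y a k ⬝ᵥ (W *ᵥ y a i)), Finset.sum_const, Finset.card_univ,
      Fintype.card_fin, nsmul_eq_mul]
    field_simp
    ring
  have hcross : ∀ a b, (Gᵀ * G) a b * uCross W y a b =
      (Gᵀ * G) a b * (sampleMean y a ⬝ᵥ (W *ᵥ sampleMean y b)) := by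
    intro a b
    rw [sampleMean_dotProduct, uCross]
  rw [testStat, sqNorm, dTheta_dotProduct G hVV hVt]
  simp_rw [hself, hcross, Finset.sum_sub_distrib]
  have hsplit : ∀ a, ∑ b, (Gᵀ * G) a b * (sampleMean y a ⬝ᵥ (W *ᵥ sampleMean y b)) =
      (Gᵀ * G) a a * (sampleMean y a ⬝ᵥ (W *ᵥ sampleMean y a)) +
      ∑ b, if a ≠ b then (Gᵀ * G) a b * (sampleMean y a ⬝ᵥ (W *ᵥ sampleMean y b)) else 0 := by
    intro a
    have : ∀ b, (Gᵀ * G) a b * (sampleMean y a ⬝ᵥ (W *ᵥ sampleMean y b)) =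
        (if a = b then (Gᵀ * G) a b * (sampleMean y a ⬝ᵥ (W *ᵥ sampleMean y b)) else 0) +
        if a ≠ b then (Gᵀ * G) a b * (sampleMean y a ⬝ᵥ (W *ᵥ sampleMean y b)) else 0 := by
      intro b; by_cases h : a = b <;> simp [h]
    rw [Finset.sum_congr rfl fun b _ => this b, Finset.sum_add_distrib]
    simp
  simp_rw [hsplit, Finset.sum_add_distrib]
  ring

lemma stack_sub (u v : Fin K → Fin p → ℝ) : stack u - stack v = stack (u - v) := rfl

/-- The null statistic is the test statistic of the centered observations. -/
lemma nullStat_eq_testStat (G : Matrix (Fin q) (Fin K) ℝ) {W : Matrix (Fin p) (Fin p) ℝ}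
    (hVV : matSqrt W * matSqrt W = W) (hVt : (matSqrt W)ᵀ = matSqrt W) (hn : ∀ a, 2 ≤ n a)
    (mu : Fin K → Fin p → ℝ) (y : (a : Fin K) → Fin (n a) → Fin p → ℝ) :
    nullStat G W mu y = testStat G W (fun a i => y a i - mu a) := by
  have hn0 : ∀ a, n a ≠ 0 := fun a => by have := hn a; omega
  rw [testStat_eq G hVV hVt hn, nullStat, stack_sub]
  have h1 : sampleMean (fun a i => y a i - mu a) = sampleMean y - mu := by
    funext a; rw [sampleMean_sub y mu a (hn0 a)]; rfl
  rw [h1]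
  congr 1
  refine Finset.sum_congr rfl fun a _ => ?_
  rw [sampleCov_sub y mu a (hn0 a)]

/-- Decomposition of the test statistic into noise, linear term and signal. -/
lemma testStat_decomp (G : Matrix (Fin q) (Fin K) ℝ) {W : Matrix (Fin p) (Fin p) ℝ}
    (hVV : matSqrt W * matSqrt W = W) (hVt : (matSqrt W)ᵀ = matSqrt W) (hn : ∀ a, 2 ≤ n a)
    (mu : Fin K → Fin p → ℝ) (y : (a : Fin K) → Fin (n a) → Fin p → ℝ) :
    testStat G W y = nullStat G W mu y + 2 * linStat G W mu y + signal G W mu := by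
  have hexp : ∀ u v : Fin q × Fin p → ℝ, sqNorm (u + v) = sqNorm u + 2 * (v ⬝ᵥ u) + sqNorm v := by
    intro u v
    simp only [sqNorm, add_dotProduct, dotProduct_add, dotProduct_comm u v]
    ring
  rw [testStat_eq G hVV hVt hn, nullStat, linStat, signal]
  have : dTheta G W *ᵥ stack (sampleMean y) =
      dTheta G W *ᵥ (stack (sampleMean y) - stack mu) + dTheta G W *ᵥ stack mu := by
    rw [← Matrix.mulVec_add, sub_add_cancel]
  rw [this, hexp]
  ring

/-- The number of ordered pairs of distinct observations from the samples `a` and `b`. -/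
def pairCount (n : Fin K → ℕ) (a b : Fin K) : ℝ :=
  if a = b then (n a : ℝ) * ((n a : ℝ) - 1) else (n a : ℝ) * (n b : ℝ)

/-- The indicator of distinct observations, as a real number. -/
def offDiag {I : Type*} [DecidableEq I] (x y : I) : ℝ := if x = y then 0 else 1

/-- The coefficients of the statistic `T_{n0}` as a quadratic form in the observations. -/
def pairCoef (G : Matrix (Fin q) (Fin K) ℝ) (n : Fin K → ℕ) (x y : (a : Fin K) × Fin (n a)) : ℝ :=
  (Gᵀ * G) x.1 y.1 / pairCount n x.1 y.1 * offDiag x y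

/-- The centered and standardized observations `W^{1/2} (Y_{ai} - μ_a)`, as one family indexed by the
pairs `(a, i)`. -/
def stdObs (W : Matrix (Fin p) (Fin p) ℝ) (mu : Fin K → Fin p → ℝ)
    (y : (a : Fin K) → Fin (n a) → Fin p → ℝ) (x : (a : Fin K) × Fin (n a)) : Fin p → ℝ :=
  matSqrt W *ᵥ (y x.1 x.2 - mu x.1)

/-- The Gram matrix of a family of vectors with its diagonal removed. -/
def offGram {I : Type*} [DecidableEq I] (z : I → Fin p → ℝ) (x y : I) : ℝ :=
  offDiag x y * (z x ⬝ᵥ z y)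

/-- `T_{n0}` is a degenerate quadratic form in the standardized observations. -/
lemma nullStat_eq_quadForm (G : Matrix (Fin q) (Fin K) ℝ) {W : Matrix (Fin p) (Fin p) ℝ}
    (hVV : matSqrt W * matSqrt W = W) (hVt : (matSqrt W)ᵀ = matSqrt W) (hn : ∀ a, 2 ≤ n a)
    (mu : Fin K → Fin p → ℝ) (y : (a : Fin K) → Fin (n a) → Fin p → ℝ) :
    nullStat G W mu y = quadForm (dotKer (pairCoef G n)) (stdObs W mu y) := by
  rw [nullStat_eq_testStat G hVV hVt hn, testStat]
  simp only [quadForm, rowForm, ker, dotKer, Fintype.sum_sigma]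
  have hself : ∀ a, (Gᵀ * G) a a * uSelf W (fun a i => y a i - mu a) a =
      ∑ i, ∑ j, pairCoef G n ⟨a, i⟩ ⟨a, j⟩ * (stdObs W mu y ⟨a, i⟩ ⬝ᵥ stdObs W mu y ⟨a, j⟩) := by
    intro a
    simp only [uSelf, Finset.sum_div, Finset.mul_sum]
    refine Finset.sum_congr rfl fun i _ => Finset.sum_congr rfl fun j _ => ?_
    rw [dotProduct_mulVec_eq_sqrt hVV hVt]
    by_cases hij : i = j
    · simp [hij, pairCoef, offDiag]
    · simp only [ne_eq, hij, not_false_eq_true, if_true, pairCoef, offDiag, pairCount, stdObs,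
        Sigma.mk.injEq, heq_eq_eq, true_and, if_false]
      ring
  have hcross : ∀ a b, a ≠ b → (Gᵀ * G) a b * uCross W (fun a i => y a i - mu a) a b =
      ∑ i, ∑ j, pairCoef G n ⟨a, i⟩ ⟨b, j⟩ * (stdObs W mu y ⟨a, i⟩ ⬝ᵥ stdObs W mu y ⟨b, j⟩) := by
    intro a b hab
    simp only [uCross, Finset.sum_div, Finset.mul_sum]
    refine Finset.sum_congr rfl fun i _ => Finset.sum_congr rfl fun j _ => ?_
    rw [dotProduct_mulVec_eq_sqrt hVV hVt]
    simp only [pairCoef, offDiag, pairCount, stdObs, Sigma.mk.injEq, hab, false_and, if_false]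
    ring
  rw [← Finset.sum_add_distrib]
  refine Finset.sum_congr rfl fun a _ => ?_
  rw [Finset.sum_comm (s := Finset.univ (α := Fin (n a))), hself,
    ← Finset.add_sum_erase Finset.univ (fun b => ∑ i, ∑ j, pairCoef G n ⟨a, i⟩ ⟨b, j⟩ *
      (stdObs W mu y ⟨a, i⟩ ⬝ᵥ stdObs W mu y ⟨b, j⟩)) (Finset.mem_univ a)]
  congr 1
  rw [← Finset.add_sum_erase Finset.univ _ (Finset.mem_univ a)]
  simp only [ne_eq, not_true_eq_false, if_false, zero_add]
  refine Finset.sum_congr rfl fun b hb => ?_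
  have hab : a ≠ b := (Finset.ne_of_mem_erase hb).symm
  rw [if_pos hab, hcross a b hab]

/-! ### The variance estimator as a function of the Gram matrix -/

/-- The unbiased estimator of `tr (W Σ W Σ)` from one sample of size `N`, in terms of the sum `A` of
the squared off-diagonal inner products, the sum `R` of their squared row sums and their sum `S`. -/
def selfEst (N A R S : ℝ) : ℝ :=
  A / (N * (N - 1)) - 2 * (R - A) / (N * (N - 1) * (N - 2)) +
    (S ^ 2 - 4 * (R - A) - 2 * A) / (N * (N - 1) * (N - 2) * (N - 3))

/-- The estimator of `tr (W Σ_a W Σ_b)` from two samples of sizes `N` and `M`, in terms of the sum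
`A` of the squared inner products, the sums `R` and `R'` of the squared row and column sums, and the
sum `S`. -/
def crossEst (N M A R R' S : ℝ) : ℝ :=
  (A - R / M - R' / N + S ^ 2 / (N * M)) / ((N - 1) * (M - 1))

section Sums

variable {n m : ℕ}

lemma sum_sq_add_add (g : Fin n → Fin m → ℝ) (u : Fin n → ℝ) (v : Fin m → ℝ) :
    ∑ i, ∑ j, (g i j + u i + v j) ^ 2 =
      (∑ i, ∑ j, g i j ^ 2) + 2 * (∑ i, (∑ j, g i j) * u i) + 2 * (∑ j, (∑ i, g i j) * v j) +
      m * (∑ i, u i ^ 2) + 2 * (∑ i, u i) * (∑ j, v j) + n * ∑ j, v j ^ 2 := by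
  have e : ∀ i j, (g i j + u i + v j) ^ 2 = g i j ^ 2 + 2 * (g i j * u i) + 2 * (g i j * v j) +
      u i ^ 2 + 2 * (u i * v j) + v j ^ 2 := fun i j => by ring
  simp_rw [e, Finset.sum_add_distrib, ← Finset.mul_sum]
  rw [Finset.sum_comm (f := fun i j => g i j * v j)]
  simp only [← Finset.sum_mul, ← Finset.mul_sum, Finset.sum_const, Finset.card_univ,
    Fintype.card_fin, nsmul_eq_mul]
  ring

lemma sum_sub_div (r : Fin n → ℝ) (s M : ℝ) :
    ∑ i, (s - r i / M) = n * s - (∑ i, r i) / M := by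
  simp [Finset.sum_sub_distrib, Finset.sum_div]

lemma sum_mul_sub_div (r f : Fin n → ℝ) (s M : ℝ) :
    ∑ i, f i * (s - r i / M) = (∑ i, f i) * s - (∑ i, f i * r i) / M := by
  simp only [mul_sub, Finset.sum_sub_distrib, Finset.sum_mul, Finset.sum_div, mul_div_assoc]

lemma sum_sq_sub_div (r : Fin n → ℝ) (s M : ℝ) :
    ∑ i, (s - r i / M) ^ 2 = n * s ^ 2 - 2 * s * (∑ i, r i) / M + (∑ i, r i ^ 2) / M ^ 2 := by
  have e : ∀ i, (s - r i / M) ^ 2 = s ^ 2 - (2 * s / M) * r i + r i ^ 2 / M ^ 2 := fun i => by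
    rw [sub_sq, div_pow]; ring
  simp_rw [e, Finset.sum_add_distrib, Finset.sum_sub_distrib, ← Finset.mul_sum, ← Finset.sum_div]
  simp only [Finset.sum_const, Finset.card_univ, Fintype.card_fin, nsmul_eq_mul]
  ring

/-- Double centering of a rectangular array. -/
lemma sum_sq_centered (g : Fin n → Fin m → ℝ) (hn : (n : ℝ) ≠ 0) (hm : (m : ℝ) ≠ 0) :
    ∑ i, ∑ j, (g i j - (∑ l, g i l) / m - (∑ k, g k j) / n + (∑ k, ∑ l, g k l) / (n * m)) ^ 2 =
      (∑ i, ∑ j, g i j ^ 2) - (∑ i, (∑ j, g i j) ^ 2) / m - (∑ j, (∑ i, g i j) ^ 2) / n +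
        (∑ i, ∑ j, g i j) ^ 2 / (n * m) := by
  set S := ∑ k, ∑ l, g k l with hS
  have hS' : ∑ l, ∑ k, g k l = S := Finset.sum_comm
  have e : ∀ i j, g i j - (∑ l, g i l) / m - (∑ k, g k j) / n + S / (n * m) =
      g i j + (S / (2 * n * m) - (∑ l, g i l) / m) + (S / (2 * n * m) - (∑ k, g k j) / n) := by
    intro i j; field_simp; ring
  simp_rw [e, sum_sq_add_add, sum_mul_sub_div, sum_sub_div, sum_sq_sub_div, ← pow_two, ← hS, hS']
  field_simp
  ring

/-- The bias-corrected estimator depends on the Gram matrix only through its off-diagonal part. -/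
lemma centered_eq_selfEst (g : Fin n → Fin n → ℝ) (hg : ∀ i j, g i j = g j i) (hn : 4 ≤ n)
    (h : Fin n → Fin n → ℝ)
    (hh : ∀ i j, h i j =
      g i j - (∑ l, g i l) / n - (∑ k, g k j) / n + (∑ k, ∑ l, g k l) / (n * n)) :
    ((n : ℝ) - 1) / (n * ((n : ℝ) - 2) * ((n : ℝ) - 3)) *
      (((n : ℝ) - 1) * ((n : ℝ) - 2) * (((n : ℝ) - 1)⁻¹ * ((n : ℝ) - 1)⁻¹ * ∑ i, ∑ j, h i j ^ 2) +
        (((n : ℝ) - 1)⁻¹ * ∑ i, h i i) ^ 2 - n * (((n : ℝ) - 1)⁻¹ * ∑ i, h i i ^ 2)) =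
    selfEst n (∑ i, ∑ j, (if i = j then 0 else g i j) ^ 2)
      (∑ i, (∑ j, if i = j then 0 else g i j) ^ 2) (∑ i, ∑ j, if i = j then 0 else g i j) := by
  have h4 : (4 : ℝ) ≤ n := by exact_mod_cast hn
  have n0 : (n : ℝ) ≠ 0 := by linarith
  have n1 : (n : ℝ) - 1 ≠ 0 := by linarith
  have n2 : (n : ℝ) - 2 ≠ 0 := by linarith
  have n3 : (n : ℝ) - 3 ≠ 0 := by linarith
  have hcol : ∀ j, ∑ k, g k j = ∑ l, g j l := fun j => Finset.sum_congr rfl fun k _ => hg k j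
  -- sums over the off-diagonal part
  have hrow : ∀ i, (∑ j, if i = j then 0 else g i j) = (∑ j, g i j) - g i i := by
    intro i
    have : ∀ j, (if i = j then 0 else g i j) = g i j - if i = j then g i j else 0 := by
      intro j; by_cases hij : i = j <;> simp [hij]
    simp_rw [this, Finset.sum_sub_distrib]; simp
  have hrow2 : ∀ i, (∑ j, (if i = j then 0 else g i j) ^ 2) = (∑ j, g i j ^ 2) - g i i ^ 2 := by
    intro i
    have : ∀ j, (if i = j then 0 else g i j) ^ 2 = g i j ^ 2 - if i = j then g i j ^ 2 else 0 := by
      intro j; by_cases hij : i = j <;> simp [hij]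
    simp_rw [this, Finset.sum_sub_distrib]; simp
  have eR : ∑ i, ((∑ j, g i j) - g i i) ^ 2 =
      (∑ i, (∑ j, g i j) ^ 2) - 2 * (∑ i, g i i * ∑ j, g i j) + ∑ i, g i i ^ 2 := by
    rw [Finset.mul_sum, ← Finset.sum_sub_distrib, ← Finset.sum_add_distrib]
    exact Finset.sum_congr rfl fun i _ => by ring
  simp_rw [hrow, hrow2, Finset.sum_sub_distrib, eR]
  -- sums over the centered Gram matrix
  have hSS : ∑ i, ∑ j, h i j ^ 2 = (∑ i, ∑ j, g i j ^ 2) - 2 * (∑ i, (∑ j, g i j) ^ 2) / n +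
        (∑ i, ∑ j, g i j) ^ 2 / (n * n) := by
    simp_rw [hh, sum_sq_centered g n0 n0, hcol]; ring
  set S := ∑ k, ∑ l, g k l with hS
  have hdiag : ∀ i, h i i = g i i + 2 * (S / (2 * n * n) - (∑ l, g i l) / n) := by
    intro i; rw [hh, hcol]; field_simp; ring
  have hD : ∑ i, h i i = (∑ i, g i i) - S / n := by
    simp_rw [hdiag, Finset.sum_add_distrib, ← Finset.mul_sum, sum_sub_div, ← hS]
    field_simp; ring
  have hD2 : ∑ i, h i i ^ 2 = (∑ i, g i i ^ 2) +
      4 * ((∑ i, g i i) * (S / (2 * n * n)) - (∑ i, g i i * ∑ l, g i l) / n) +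
      4 * (n * (S / (2 * n * n)) ^ 2 - 2 * (S / (2 * n * n)) * S / n +
        (∑ i, (∑ l, g i l) ^ 2) / n ^ 2) := by
    have e : ∀ i, h i i ^ 2 = g i i ^ 2 + 4 * (g i i * (S / (2 * n * n) - (∑ l, g i l) / n)) +
        4 * (S / (2 * n * n) - (∑ l, g i l) / n) ^ 2 := fun i => by rw [hdiag]; ring
    simp_rw [e, Finset.sum_add_distrib, ← Finset.mul_sum, sum_mul_sub_div, sum_sq_sub_div, ← hS]
  rw [hSS, hD, hD2, selfEst]
  field_simp
  ring

end Sums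

variable {K q p : ℕ} {n : Fin K → ℕ}

/-- Sum of the squared inner products between the samples `a` and `b`. -/
def gramSq (a b : Fin K) (z : (a : Fin K) × Fin (n a) → Fin p → ℝ) : ℝ :=
  ∑ i : Fin (n a), ∑ j : Fin (n b), offGram z ⟨a, i⟩ ⟨b, j⟩ ^ 2

/-- Sum of the squared row sums of the inner products between the samples `a` and `b`. -/
def gramRow (a b : Fin K) (z : (a : Fin K) × Fin (n a) → Fin p → ℝ) : ℝ :=
  ∑ i : Fin (n a), (∑ j : Fin (n b), offGram z ⟨a, i⟩ ⟨b, j⟩) ^ 2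

/-- Sum of the inner products between the samples `a` and `b`. -/
def gramSum (a b : Fin K) (z : (a : Fin K) × Fin (n a) → Fin p → ℝ) : ℝ :=
  ∑ i : Fin (n a), ∑ j : Fin (n b), offGram z ⟨a, i⟩ ⟨b, j⟩

/-- The estimator of `tr (W Σ_a W Σ_b)` as a function of the standardized observations. -/
def pairEst (a b : Fin K) (z : (a : Fin K) × Fin (n a) → Fin p → ℝ) : ℝ :=
  if a = b then selfEst (n a) (gramSq a a z) (gramRow a a z) (gramSum a a z)
  else crossEst (n a) (n b) (gramSq a b z) (gramRow a b z) (gramRow b a z) (gramSum a b z)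

/-- The mean corrections turn the double centering of the Gram matrix into a function of its
off-diagonal entries, and the true mean may be subtracted beforehand. -/
lemma trSqHat_eq {W : Matrix (Fin p) (Fin p) ℝ}
    (hVV : matSqrt W * matSqrt W = W) (hVt : (matSqrt W)ᵀ = matSqrt W)
    (mu : Fin K → Fin p → ℝ) (y : (a : Fin K) → Fin (n a) → Fin p → ℝ) (a : Fin K) (hn : 4 ≤ n a) :
    trSqHat W y a = pairEst a a (stdObs W mu y) := by
  have hWt : Wᵀ = W := by rw [← hVV, Matrix.transpose_mul, hVt]
  set x : (a : Fin K) → Fin (n a) → Fin p → ℝ := fun a i => y a i - mu a with hx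
  have hmean : ∀ i, y a i - sampleMean y a = x a i - sampleMean x a := by
    intro i
    rw [hx, sampleMean_sub y mu a (by omega)]; simp
  set h : Fin (n a) → Fin (n a) → ℝ := fun i j =>
    (x a i - sampleMean x a) ⬝ᵥ (W *ᵥ (x a j - sampleMean x a)) with hh
  set g : Fin (n a) → Fin (n a) → ℝ := fun i j => x a i ⬝ᵥ (W *ᵥ x a j) with hg
  have hgz : ∀ i j, g i j = stdObs W mu y ⟨a, i⟩ ⬝ᵥ stdObs W mu y ⟨a, j⟩ := fun i j =>
    dotProduct_mulVec_eq_sqrt hVV hVt _ _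
  have hq : quartic W y a = ((n a : ℝ) - 1)⁻¹ * ∑ i, h i i ^ 2 := by
    rw [quartic]
    congr 1
    refine Finset.sum_congr rfl fun i _ => ?_
    rw [sqNorm, ← dotProduct_mulVec_eq_sqrt hVV hVt, hmean]
  have h1 : (W * sampleCov y a).trace = ((n a : ℝ) - 1)⁻¹ * ∑ i, h i i := by
    rw [trace_mul_sampleCov]; simp_rw [hmean]; rfl
  have h2 : ((W * sampleCov y a) ^ 2).trace =
      ((n a : ℝ) - 1)⁻¹ * ((n a : ℝ) - 1)⁻¹ * ∑ i, ∑ j, h i j ^ 2 := by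
    rw [pow_two, ← Matrix.mul_assoc, trace_sampleCov_sampleCov hWt]
    simp_rw [hmean]; rfl
  rw [trSqHat, h1, h2, hq, centered_eq_selfEst g (fun i j => by rw [hgz, hgz, dotProduct_comm]) hn h
    (fun i j => by rw [hh]; exact centered_dotProduct x a a i j), pairEst, if_pos rfl]
  have hoff : ∀ i j, (if i = j then 0 else g i j) = offGram (stdObs W mu y) ⟨a, i⟩ ⟨a, j⟩ := by
    intro i j
    by_cases hij : i = j <;> simp [hij, offGram, offDiag, hgz]
  simp only [hoff, gramSq, gramRow, gramSum]

lemma trace_cross_eq {W : Matrix (Fin p) (Fin p) ℝ}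
    (hVV : matSqrt W * matSqrt W = W) (hVt : (matSqrt W)ᵀ = matSqrt W)
    (mu : Fin K → Fin p → ℝ) (y : (a : Fin K) → Fin (n a) → Fin p → ℝ) {a b : Fin K} (hab : a ≠ b)
    (ha : n a ≠ 0) (hb : n b ≠ 0) :
    (W * sampleCov y a * W * sampleCov y b).trace = pairEst a b (stdObs W mu y) := by
  have hWt : Wᵀ = W := by rw [← hVV, Matrix.transpose_mul, hVt]
  set x : (a : Fin K) → Fin (n a) → Fin p → ℝ := fun a i => y a i - mu a with hx
  have hmean : ∀ a, n a ≠ 0 → ∀ i, y a i - sampleMean y a = x a i - sampleMean x a := by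
    intro a ha i
    rw [hx, sampleMean_sub y mu a ha]; simp
  rw [trace_sampleCov_sampleCov hWt]
  simp_rw [hmean a ha, hmean b hb, centered_dotProduct]
  rw [sum_sq_centered (fun i j => x a i ⬝ᵥ (W *ᵥ x b j)) (by exact_mod_cast ha)
    (by exact_mod_cast hb), pairEst, if_neg hab, crossEst]
  have hgz : ∀ i j, x a i ⬝ᵥ (W *ᵥ x b j) = offGram (stdObs W mu y) ⟨a, i⟩ ⟨b, j⟩ := by
    intro i j
    rw [dotProduct_mulVec_eq_sqrt hVV hVt]
    simp [offGram, offDiag, hab, stdObs, hx]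
  have hgz' : ∀ i j, x a i ⬝ᵥ (W *ᵥ x b j) = offGram (stdObs W mu y) ⟨b, j⟩ ⟨a, i⟩ := by
    intro i j
    rw [dotProduct_mulVec_eq_sqrt hVV hVt, dotProduct_comm]
    simp [offGram, offDiag, Ne.symm hab, stdObs, hx]
  have hcol : ∑ j, (∑ i, x a i ⬝ᵥ (W *ᵥ x b j)) ^ 2 = gramRow b a (stdObs W mu y) := by
    simp only [hgz', gramRow]
  rw [hcol]
  simp only [hgz, gramSq, gramRow, gramSum]
  rw [← mul_inv, ← div_eq_inv_mul]

/-- The variance estimator is a function of the inner products of distinct standardized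
observations. -/
lemma varHat_eq (G : Matrix (Fin q) (Fin K) ℝ) {W : Matrix (Fin p) (Fin p) ℝ}
    (hVV : matSqrt W * matSqrt W = W) (hVt : (matSqrt W)ᵀ = matSqrt W) (hn : ∀ a, 4 ≤ n a)
    (mu : Fin K → Fin p → ℝ) (y : (a : Fin K) → Fin (n a) → Fin p → ℝ) :
    varHat G W y =
      2 * ∑ a, ∑ b, (Gᵀ * G) a b ^ 2 / pairCount n a b * pairEst a b (stdObs W mu y) := by
  have hn0 : ∀ a, n a ≠ 0 := fun a => by have := hn a; omega
  rw [varHat, ← Finset.sum_add_distrib]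
  congr 1
  refine Finset.sum_congr rfl fun a _ => ?_
  rw [← Finset.add_sum_erase Finset.univ (fun b => (Gᵀ * G) a b ^ 2 / pairCount n a b *
    pairEst a b (stdObs W mu y)) (Finset.mem_univ a)]
  congr 1
  · rw [trSqHat_eq hVV hVt mu y a (hn a), pairCount, if_pos rfl]; ring
  · rw [← Finset.add_sum_erase Finset.univ _ (Finset.mem_univ a)]
    simp only [ne_eq, not_true_eq_false, if_false, zero_add]
    refine Finset.sum_congr rfl fun b hb => ?_
    have hab : a ≠ b := (Finset.ne_of_mem_erase hb).symm
    rw [if_pos hab, trace_cross_eq hVV hVt mu y hab (hn0 a) (hn0 b), pairCount, if_neg hab]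
    ring

/-! ### Consistency of the variance estimator -/

section Kernels

variable {I E : Type*} [Fintype I] [DecidableEq I] [MeasurableSpace E]
variable {ν : I → Measure E} [∀ x, IsProbabilityMeasure (ν x)]
  {κ : I → I → E → E → ℝ} {β : I → I → I → E → E → ℝ} {V : I → I → ℝ} {C δ : ℝ}

namespace DegenerateKernels

variable (h : DegenerateKernels ν κ β V C δ)
include h

lemma integral_ker_mul_ker_of_notMem {x y u v : I} (hu : x ≠ u) (hv : x ≠ v) :
    ∫ z, ker κ x y z * ker κ u v z ∂Measure.pi ν = 0 :=
  integral_mul_eq_zero ν x (fun z w => ker_update κ hu hv z w) (h.ker_centered_left x y)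
    (integrable_mul_of_memLp_two (h.memLp_two x y) (h.memLp_two u v))

/-- Kernels with different unordered pairs of indices are orthogonal. -/
lemma integral_ker_mul_ker_eq_zero {x y u v : I} (hne : s(x, y) ≠ s(u, v)) :
    ∫ z, ker κ x y z * ker κ u v z ∂Measure.pi ν = 0 := by
  by_cases hxy : x = y
  · subst hxy; simp [h.ker_diag]
  by_cases hx : x ≠ u ∧ x ≠ v
  · exact h.integral_ker_mul_ker_of_notMem hx.1 hx.2
  by_cases hy : y ≠ u ∧ y ≠ v
  · simp_rw [h.ker_symm x y]
    exact h.integral_ker_mul_ker_of_notMem hy.1 hy.2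
  exfalso
  simp only [ne_eq, Sym2.eq_iff] at hne
  grind

/-- The second moment of a sum of distinct kernels: each unordered pair of indices occurs at most
twice. -/
lemma integral_sq_sum_ker_le {J : Type*} [DecidableEq J] (s : Finset J) (f : J → I × I)
    (hf : Function.Injective f) :
    ∫ z, (∑ j ∈ s, ker κ (f j).1 (f j).2 z) ^ 2 ∂Measure.pi ν ≤
      2 * ∑ j ∈ s, V (f j).1 (f j).2 := by
  have := integral_sq_sum_le_of_key s (fun j => ker κ (f j).1 (f j).2) (fun j => s((f j).1, (f j).2))
    (P := Measure.pi ν) 2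
    (fun j _ => by
      rw [← Finset.card_image_of_injective _ hf]
      refine (Finset.card_le_card (t := {f j, (f j).swap}) ?_).trans Finset.card_le_two
      intro r hr
      simp only [Finset.mem_image, Finset.mem_filter, Sym2.eq_iff] at hr
      obtain ⟨i, ⟨_, hi⟩, rfl⟩ := hr
      simp only [Finset.mem_insert, Finset.mem_singleton, Prod.ext_iff, Prod.fst_swap, Prod.snd_swap]
      exact hi)
    (fun j _ => h.memLp_two _ _)
    (fun i _ j _ hij => h.integral_ker_mul_ker_eq_zero hij)
  simp_rw [h.sq] at this
  exact_mod_cast this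

end DegenerateKernels

end Kernels

section Coefficients

/-- The estimation error in one sample is controlled by the three sums that enter the estimator. -/
lemma abs_selfEst_sub_le {L N A R S : ℝ} (hL : 4 ≤ L) (hN : L ≤ N) (hA : 0 ≤ A) (hR : 0 ≤ R) :
    |selfEst N A R S - A / (N * (N - 1))| ≤
      6 / (L - 3) * ((A + R + R + S ^ 2) / (N * N)) := by
  have d0 : 0 < N := by linarith
  have d1 : 0 < N - 1 := by linarith
  have d2 : 0 < N - 2 := by linarith
  have d3 : 0 < N - 3 := by linarith
  set u := 1 / (N * (N - 1) * (N - 2)) with hu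
  set v := 1 / (N * (N - 1) * (N - 2) * (N - 3)) with hv
  set k := 1 / (N * N * (N - 3)) with hk
  have hu0 : 0 ≤ u := by positivity
  have hv0 : 0 ≤ v := by positivity
  have hk0 : 0 ≤ k := by positivity
  have huk : u ≤ 4 / 3 * k := by
    rw [hu, hk, mul_one_div, div_le_div_iff₀ (by positivity) (by positivity)]
    nlinarith [mul_nonneg d0.le (show (0 : ℝ) ≤ N ^ 2 - 3 * N + 8 by nlinarith)]
  have hvk : v ≤ 2 / 3 * k := by
    rw [hv, hk, mul_one_div, div_le_div_iff₀ (by positivity) (by positivity)]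
    nlinarith [mul_nonneg (mul_nonneg d0.le d3.le) (mul_nonneg (show (0 : ℝ) ≤ 2 * N - 1 by linarith)
      (show (0 : ℝ) ≤ N - 4 by linarith))]
  have e : selfEst N A R S - A / (N * (N - 1)) =
      -(2 * (R - A) * u) + (S ^ 2 - 4 * R + 2 * A) * v := by
    rw [selfEst, hu, hv]; ring
  have h1 : |selfEst N A R S - A / (N * (N - 1))| ≤
      2 * (R + A) * u + (S ^ 2 + 4 * R + 2 * A) * v := by
    rw [e, abs_le]
    have := mul_nonneg hA hu0
    have := mul_nonneg hR hu0
    have := mul_nonneg hA hv0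
    have := mul_nonneg hR hv0
    have := mul_nonneg (sq_nonneg S) hv0
    constructor <;> nlinarith
  have h2 : 2 * (R + A) * u + (S ^ 2 + 4 * R + 2 * A) * v ≤ 6 * k * (A + R + R + S ^ 2) := by
    have := mul_le_mul_of_nonneg_left huk (by positivity : 0 ≤ 2 * (R + A))
    have := mul_le_mul_of_nonneg_left hvk (by positivity : 0 ≤ S ^ 2 + 4 * R + 2 * A)
    have := mul_nonneg hA hk0
    have := mul_nonneg hR hk0
    have := mul_nonneg (sq_nonneg S) hk0
    nlinarith
  refine (h1.trans h2).trans ?_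
  have h3 : 6 * k * (A + R + R + S ^ 2) = 6 / (N - 3) * ((A + R + R + S ^ 2) / (N * N)) := by
    rw [hk]; field_simp
  rw [h3]
  have : 6 / (N - 3) ≤ 6 / (L - 3) :=
    div_le_div_of_nonneg_left (by norm_num) (by linarith) (by linarith)
  exact mul_le_mul_of_nonneg_right this (by positivity)

/-- The estimation error for two samples is controlled by the sums that enter the estimator. -/
lemma abs_crossEst_sub_le {L N M A R R' S : ℝ} (hL : 4 ≤ L) (hN : L ≤ N) (hM : L ≤ M) (hA : 0 ≤ A)
    (hR : 0 ≤ R) (hR' : 0 ≤ R') :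
    |crossEst N M A R R' S - A / (N * M)| ≤
      6 / (L - 3) * ((A + R + R' + S ^ 2) / (N * M)) := by
  have d0 : 0 < N := by linarith
  have d1 : 0 < N - 1 := by linarith
  have e0 : 0 < M := by linarith
  have e1 : 0 < M - 1 := by linarith
  have l3 : 0 < L - 3 := by linarith
  set v := 1 / ((N - 1) * (M - 1) * (N * M)) with hv
  have hv0 : 0 ≤ v := by positivity
  have e : crossEst N M A R R' S - A / (N * M) =
      (A * (N + M - 1) - R * N - R' * M + S ^ 2) * v := by
    rw [crossEst, hv]; field_simp; ring
  have h1 : |crossEst N M A R R' S - A / (N * M)| ≤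
      (A + R + R' + S ^ 2) * (N + M) * v := by
    rw [e, abs_mul, abs_of_nonneg hv0]
    refine mul_le_mul_of_nonneg_right ?_ hv0
    have := mul_nonneg hA d0.le
    have := mul_nonneg hR d0.le
    have := mul_nonneg hR' d0.le
    have := mul_nonneg hA e0.le
    have := mul_nonneg hR e0.le
    have := mul_nonneg hR' e0.le
    have := mul_nonneg (sq_nonneg S) d1.le
    have := mul_nonneg (sq_nonneg S) e0.le
    rw [abs_le]
    constructor <;> nlinarith
  have h2 : (N + M) / ((N - 1) * (M - 1)) ≤ 6 / (L - 3) := by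
    rw [div_le_div_iff₀ (by positivity) l3]
    have a1 : N * (L - 3) ≤ N * (M - 1) := mul_le_mul_of_nonneg_left (by linarith) d0.le
    have a2 : M * (L - 3) ≤ M * (N - 1) := mul_le_mul_of_nonneg_left (by linarith) e0.le
    nlinarith
  refine h1.trans (le_of_eq_of_le ?_ (mul_le_mul_of_nonneg_right h2
    (by positivity : 0 ≤ (A + R + R' + S ^ 2) / (N * M))))
  rw [hv]; field_simp

end Coefficients

variable {K q p m : ℕ} {n : Fin K → ℕ}

lemma abs_pairEst_sub_le {L : ℝ} (hL : 4 ≤ L) (hn : ∀ a, L ≤ n a) (a b : Fin K)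
    (z : (a : Fin K) × Fin (n a) → Fin p → ℝ) :
    |pairEst a b z - gramSq a b z / pairCount n a b| ≤
      6 / (L - 3) * ((gramSq a b z + gramRow a b z + gramRow b a z + gramSum a b z ^ 2) /
        ((n a : ℝ) * n b)) := by
  have h1 : ∀ a b, 0 ≤ gramSq a b z := fun a b =>
    Finset.sum_nonneg fun _ _ => Finset.sum_nonneg fun _ _ => sq_nonneg _
  have h2 : ∀ a b, 0 ≤ gramRow a b z := fun a b => Finset.sum_nonneg fun _ _ => sq_nonneg _
  by_cases hab : a = b
  · subst hab
    rw [pairEst, if_pos rfl, pairCount, if_pos rfl]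
    exact abs_selfEst_sub_le hL (hn a) (h1 _ _) (h2 _ _)
  · rw [pairEst, if_neg hab, pairCount, if_neg hab]
    exact abs_crossEst_sub_le hL (hn a) (hn b) (h1 _ _) (h2 _ _) (h2 _ _)

/-- `tr (Λ_a Λ_b)` for `Λ_a = B_a B_aᵀ`. -/
def pairTrace (B : Fin K → Matrix (Fin p) (Fin m) ℝ) (a b : Fin K) : ℝ :=
  ((B a * (B a)ᵀ) * (B b * (B b)ᵀ)).trace

lemma pairTrace_nonneg (B : Fin K → Matrix (Fin p) (Fin m) ℝ) (a b : Fin K) :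
    0 ≤ pairTrace B a b := by
  have : pairTrace B a b = (((B a)ᵀ * B b) * ((B a)ᵀ * B b)ᵀ).trace := by
    rw [pairTrace, Matrix.mul_assoc, Matrix.trace_mul_comm, Matrix.transpose_mul,
      Matrix.transpose_transpose]
    simp only [Matrix.mul_assoc]
  rw [this, Matrix.trace]
  refine Finset.sum_nonneg fun i _ => ?_
  rw [Matrix.diag_apply, Matrix.mul_apply]
  exact Finset.sum_nonneg fun j _ => mul_self_nonneg _

lemma pairTrace_comm (B : Fin K → Matrix (Fin p) (Fin m) ℝ) (a b : Fin K) :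
    pairTrace B a b = pairTrace B b a := Matrix.trace_mul_comm _ _

/-- The variance of `T_{n0}` when the standardized observations of the sample `a` have covariance
matrix `B_a B_aᵀ`. -/
def nullVar (G : Matrix (Fin q) (Fin K) ℝ) (n : Fin K → ℕ) (B : Fin K → Matrix (Fin p) (Fin m) ℝ) :
    ℝ :=
  2 * ∑ a, ∑ b, (Gᵀ * G) a b ^ 2 / pairCount n a b * pairTrace B a b

lemma pairCount_pos (hn : ∀ a, 2 ≤ n a) (a b : Fin K) : 0 < pairCount n a b := by
  have h1 : ∀ a, (2 : ℝ) ≤ n a := fun a => by exact_mod_cast hn a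
  have ha := h1 a
  have hb := h1 b
  rw [pairCount]
  split_ifs
  · exact mul_pos (by linarith) (by linarith)
  · exact mul_pos (by linarith) (by linarith)

lemma offDiag_sq {I : Type*} [DecidableEq I] (x y : I) : offDiag x y ^ 2 = offDiag x y := by
  rw [offDiag]; split_ifs <;> simp

lemma offDiag_le_one {I : Type*} [DecidableEq I] (x y : I) : offDiag x y ≤ 1 := by
  rw [offDiag]; split_ifs <;> simp

/-- The number of observations in the sample `b` distinct from a given one in the sample `a`, times
`n_a`. -/
lemma sum_offDiag (a b : Fin K) (i : Fin (n a)) :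
    (n a : ℝ) * ∑ j : Fin (n b), offDiag (⟨a, i⟩ : (a : Fin K) × Fin (n a)) ⟨b, j⟩ =
      pairCount n a b := by
  by_cases hab : a = b
  · subst hab
    simp [offDiag, pairCount, Finset.sum_ite, Finset.filter_ne]
    left
    rw [Nat.cast_sub (by have := i.isLt; omega)]; simp
  · simp [offDiag, hab, pairCount]

section Moments

variable {ν : (a : Fin K) × Fin (n a) → Measure (Fin p → ℝ)} [∀ x, IsProbabilityMeasure (ν x)]
  {B : Fin K → Matrix (Fin p) (Fin m) ℝ} {C δ : ℝ}

lemma pairCoef_symm (G : Matrix (Fin q) (Fin K) ℝ) (x y : (a : Fin K) × Fin (n a)) :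
    pairCoef G n x y = pairCoef G n y x := by
  have h1 : (Gᵀ * G) x.1 y.1 = (Gᵀ * G) y.1 x.1 := by
    have : (Gᵀ * G)ᵀ = Gᵀ * G := by rw [Matrix.transpose_mul, Matrix.transpose_transpose]
    rw [← Matrix.transpose_apply (Gᵀ * G), this]
  have h2 : pairCount n x.1 y.1 = pairCount n y.1 x.1 := by
    rw [pairCount, pairCount]
    by_cases h : x.1 = y.1
    · rw [if_pos h, if_pos h.symm, h]
    · rw [if_neg h, if_neg (Ne.symm h), mul_comm]
  have h3 : offDiag x y = offDiag y x := by simp only [offDiag, eq_comm]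
  rw [pairCoef, pairCoef, h1, h2, h3]

lemma pairCoef_self (G : Matrix (Fin q) (Fin K) ℝ) (x : (a : Fin K) × Fin (n a)) :
    pairCoef G n x x = 0 := by
  simp [pairCoef, offDiag]

variable (hν : ∀ x, LinearLaw (ν x) (B x.1) C) (hδ0 : 0 ≤ δ)
  (hδ : ∀ a b c, ((B a * (B a)ᵀ) * (B b * (B b)ᵀ) * (B a * (B a)ᵀ) * (B c * (B c)ᵀ)).trace ≤
    δ ^ 2 * (pairTrace B a b * pairTrace B a c))
include hν hδ0 hδ

lemma degenerateKernels_offDiag : DegenerateKernels ν (dotKer offDiag)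
    (dotAvg offDiag fun x : (a : Fin K) × Fin (n a) => B x.1)
    (fun x y => offDiag x y ^ 2 * pairTrace B x.1 y.1) (C ^ 2) δ :=
  degenerateKernels_dot hν (fun x y => by simp only [offDiag, eq_comm]) (fun x => by simp [offDiag])
    hδ0 fun x y w => hδ x.1 y.1 w.1

lemma degenerateKernels_pairCoef (G : Matrix (Fin q) (Fin K) ℝ) (r : ℝ) :
    DegenerateKernels ν (dotKer fun x y => r * pairCoef G n x y)
    (dotAvg (fun x y => r * pairCoef G n x y) fun x : (a : Fin K) × Fin (n a) => B x.1)
    (fun x y => (r * pairCoef G n x y) ^ 2 * pairTrace B x.1 y.1) (C ^ 2) δ :=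
  degenerateKernels_dot hν (fun x y => by rw [pairCoef_symm]) (fun x => by rw [pairCoef_self, mul_zero])
    hδ0 fun x y w => hδ x.1 y.1 w.1

lemma integrable_gramSq (a b : Fin K) : Integrable (gramSq (n := n) a b) (Measure.pi ν) :=
  integrable_finsetSum _ fun _ _ => integrable_finsetSum _ fun _ _ =>
    ((degenerateKernels_offDiag hν hδ0 hδ).memLp_two _ _).integrable_sq

lemma integral_gramSq_le (a b : Fin K) :
    ∫ z, gramSq (n := n) a b z ∂Measure.pi ν ≤ (n a : ℝ) * n b * pairTrace B a b := by
  have h := degenerateKernels_offDiag hν hδ0 hδ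
  have hi : ∀ (i : Fin (n a)) (j : Fin (n b)), Integrable
      (fun z => offGram z ⟨a, i⟩ ⟨b, j⟩ ^ 2) (Measure.pi ν) := fun i j =>
    (h.memLp_two ⟨a, i⟩ ⟨b, j⟩).integrable_sq
  simp only [gramSq]
  rw [integral_finsetSum _ fun i _ => integrable_finsetSum _ fun j _ => hi i j]
  have : ∀ i : Fin (n a), ∫ z, ∑ j : Fin (n b), offGram z ⟨a, i⟩ ⟨b, j⟩ ^ 2 ∂Measure.pi ν ≤
      n b * pairTrace B a b := by
    intro i
    rw [integral_finsetSum _ fun j _ => hi i j]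
    refine (Finset.sum_le_card_nsmul _ _ (pairTrace B a b) fun j _ => ?_).trans (by simp)
    refine (h.sq ⟨a, i⟩ ⟨b, j⟩).trans_le ?_
    rw [offDiag_sq]
    exact mul_le_of_le_one_left (pairTrace_nonneg B a b) (offDiag_le_one _ _)
  refine (Finset.sum_le_card_nsmul _ _ _ fun i _ => this i).trans (by simp [mul_assoc])

lemma rowSum_memLp (a b : Fin K) (i : Fin (n a)) :
    MemLp (fun z => ∑ j : Fin (n b), offGram z ⟨a, i⟩ ⟨b, j⟩) 2 (Measure.pi ν) :=
  memLp_finsetSum _ fun j _ => (degenerateKernels_offDiag hν hδ0 hδ).memLp_two ⟨a, i⟩ ⟨b, j⟩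

lemma integrable_gramRow (a b : Fin K) : Integrable (gramRow (n := n) a b) (Measure.pi ν) :=
  integrable_finsetSum _ fun i _ => (rowSum_memLp hν hδ0 hδ a b i).integrable_sq

lemma integral_gramRow_le (a b : Fin K) :
    ∫ z, gramRow (n := n) a b z ∂Measure.pi ν ≤ 2 * ((n a : ℝ) * n b * pairTrace B a b) := by
  have h := degenerateKernels_offDiag hν hδ0 hδ
  simp only [gramRow]
  rw [integral_finsetSum _ fun i _ => (rowSum_memLp hν hδ0 hδ a b i).integrable_sq]
  have : ∀ i : Fin (n a), ∫ z, (∑ j : Fin (n b), offGram z ⟨a, i⟩ ⟨b, j⟩) ^ 2 ∂Measure.pi ν ≤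
      2 * (n b * pairTrace B a b) := by
    intro i
    refine (h.integral_sq_sum_ker_le Finset.univ (fun j : Fin (n b) => (⟨a, i⟩, ⟨b, j⟩))
      (fun j k hjk => by simpa using hjk)).trans ?_
    refine mul_le_mul_of_nonneg_left ?_ (by norm_num)
    refine (Finset.sum_le_card_nsmul _ _ (pairTrace B a b) fun j _ => ?_).trans (by simp)
    rw [offDiag_sq]
    exact mul_le_of_le_one_left (pairTrace_nonneg B a b) (offDiag_le_one _ _)
  refine (Finset.sum_le_card_nsmul _ _ _ fun i _ => this i).trans (le_of_eq ?_)
  simp; ring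

lemma gramSum_memLp (a b : Fin K) : MemLp (gramSum (n := n) a b) 2 (Measure.pi ν) :=
  memLp_finsetSum _ fun i _ => rowSum_memLp hν hδ0 hδ a b i

lemma integral_gramSum_sq_le (a b : Fin K) :
    ∫ z, gramSum (n := n) a b z ^ 2 ∂Measure.pi ν ≤ 2 * ((n a : ℝ) * n b * pairTrace B a b) := by
  have h := degenerateKernels_offDiag hν hδ0 hδ
  simp only [gramSum, ← Finset.sum_product']
  refine (h.integral_sq_sum_ker_le (Finset.univ ×ˢ Finset.univ)
    (fun j : Fin (n a) × Fin (n b) => (⟨a, j.1⟩, ⟨b, j.2⟩))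
    (fun j k hjk => by simpa [Prod.ext_iff] using hjk)).trans ?_
  refine mul_le_mul_of_nonneg_left ?_ (by norm_num)
  refine (Finset.sum_le_card_nsmul _ _ (pairTrace B a b) fun j _ => ?_).trans (by simp)
  rw [offDiag_sq]
  exact mul_le_of_le_one_left (pairTrace_nonneg B a b) (offDiag_le_one _ _)

/-- Each pairwise trace estimator differs from the average of the squared inner products by a
relative error of the order of the reciprocal sample size. -/
lemma integral_pairEst_error_le {L : ℝ} (hL : 4 ≤ L) (hn : ∀ a, L ≤ n a) (a b : Fin K) :
    Integrable (fun z => 6 / (L - 3) *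
      ((gramSq (n := n) a b z + gramRow a b z + gramRow b a z + gramSum a b z ^ 2) /
        ((n a : ℝ) * n b))) (Measure.pi ν) ∧
    ∫ z, 6 / (L - 3) * ((gramSq (n := n) a b z + gramRow a b z + gramRow b a z +
      gramSum a b z ^ 2) / ((n a : ℝ) * n b)) ∂Measure.pi ν ≤ 42 / (L - 3) * pairTrace B a b := by
  have i1 := integrable_gramSq hν hδ0 hδ a b
  have i2 := integrable_gramRow hν hδ0 hδ a b
  have i3 := integrable_gramRow hν hδ0 hδ b a
  have i4 := (gramSum_memLp hν hδ0 hδ a b).integrable_sq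
  have i12 := i1.fun_add i2
  have i123 := i12.fun_add i3
  refine ⟨((i123.fun_add i4).div_const _).const_mul _, ?_⟩
  rw [integral_const_mul, integral_div, integral_add i123 i4, integral_add i12 i3,
    integral_add i1 i2]
  have hna : (0 : ℝ) < n a := by linarith [hn a]
  have hnb : (0 : ℝ) < n b := by linarith [hn b]
  have e1 := integral_gramSq_le hν hδ0 hδ a b
  have e2 := integral_gramRow_le hν hδ0 hδ a b
  have e3 := integral_gramRow_le hν hδ0 hδ b a
  rw [pairTrace_comm B b a, mul_comm (n b : ℝ)] at e3
  have e4 := integral_gramSum_sq_le hν hδ0 hδ a b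
  have hl : 0 ≤ 6 / (L - 3) := div_nonneg (by norm_num) (by linarith)
  refine (mul_le_mul_of_nonneg_left (div_le_div_of_nonneg_right
    (add_le_add (add_le_add (add_le_add e1 e2) e3) e4) (mul_pos hna hnb).le) hl).trans
    (le_of_eq ?_)
  field_simp; ring

end Moments

variable {K q p m : ℕ} {n : Fin K → ℕ}

/-- The variance estimator as a function of the standardized observations. -/
def varEst (G : Matrix (Fin q) (Fin K) ℝ) (z : (a : Fin K) × Fin (n a) → Fin p → ℝ) : ℝ :=
  2 * ∑ a, ∑ b, (Gᵀ * G) a b ^ 2 / pairCount n a b * pairEst a b z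

lemma sum_offDiag_eq_div {a : Fin K} (ha : n a ≠ 0) (b : Fin K) (i : Fin (n a)) :
    ∑ j : Fin (n b), offDiag (⟨a, i⟩ : (a : Fin K) × Fin (n a)) ⟨b, j⟩ =
      pairCount n a b / n a := by
  rw [← sum_offDiag a b i, mul_div_cancel_left₀ _ (by exact_mod_cast ha)]

lemma sum_pairCoef_sq_mul (G : Matrix (Fin q) (Fin K) ℝ) (B : Fin K → Matrix (Fin p) (Fin m) ℝ)
    (hn : ∀ a, 2 ≤ n a) (r : ℝ) (x : (a : Fin K) × Fin (n a)) :
    ∑ y : (a : Fin K) × Fin (n a), (r * pairCoef G n x y) ^ 2 * pairTrace B x.1 y.1 =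
      r ^ 2 * (∑ b, (Gᵀ * G) x.1 b ^ 2 / pairCount n x.1 b * pairTrace B x.1 b) / n x.1 := by
  obtain ⟨a, i⟩ := x
  rw [Fintype.sum_sigma, Finset.mul_sum, Finset.sum_div]
  refine Finset.sum_congr rfl fun b _ => ?_
  have e : ∀ j : Fin (n b), (r * pairCoef G n ⟨a, i⟩ ⟨b, j⟩) ^ 2 * pairTrace B a b =
      r ^ 2 * ((Gᵀ * G) a b / pairCount n a b) ^ 2 * pairTrace B a b *
        offDiag (⟨a, i⟩ : (a : Fin K) × Fin (n a)) ⟨b, j⟩ := by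
    intro j
    rw [pairCoef, ← offDiag_sq (⟨a, i⟩ : (a : Fin K) × Fin (n a)) ⟨b, j⟩, mul_pow, mul_pow,
      offDiag_sq, offDiag_sq]
    ring
  simp only [e]
  have hpc := (pairCount_pos hn a b).ne'
  have hna : (n a : ℝ) ≠ 0 := by have := hn a; positivity
  rw [← Finset.mul_sum, sum_offDiag_eq_div (by have := hn a; omega)]
  field_simp

/-- The kernel variances sum to half of the variance of the quadratic form. -/
lemma sum_sum_pairCoef_sq_mul (G : Matrix (Fin q) (Fin K) ℝ)
    (B : Fin K → Matrix (Fin p) (Fin m) ℝ) (hn : ∀ a, 2 ≤ n a) (r : ℝ) :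
    ∑ x : (a : Fin K) × Fin (n a), ∑ y : (a : Fin K) × Fin (n a),
      (r * pairCoef G n x y) ^ 2 * pairTrace B x.1 y.1 = r ^ 2 * (nullVar G n B / 2) := by
  simp_rw [sum_pairCoef_sq_mul G B hn]
  rw [Fintype.sum_sigma, nullVar, mul_div_cancel_left₀ _ (by norm_num : (2 : ℝ) ≠ 0),
    Finset.mul_sum]
  refine Finset.sum_congr rfl fun a _ => ?_
  have hna : (n a : ℝ) ≠ 0 := by have := hn a; positivity
  simp only [Finset.sum_const, Finset.card_univ, Fintype.card_fin, nsmul_eq_mul]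
  field_simp

lemma pairSum_nonneg (G : Matrix (Fin q) (Fin K) ℝ) (B : Fin K → Matrix (Fin p) (Fin m) ℝ)
    (hn : ∀ a, 2 ≤ n a) (a b : Fin K) :
    0 ≤ (Gᵀ * G) a b ^ 2 / pairCount n a b * pairTrace B a b :=
  mul_nonneg (div_nonneg (sq_nonneg _) (pairCount_pos hn a b).le) (pairTrace_nonneg B a b)

/-- No single observation carries more than a share `1 / L` of the kernel variances. -/
lemma sum_pairCoef_sq_mul_le (G : Matrix (Fin q) (Fin K) ℝ)
    (B : Fin K → Matrix (Fin p) (Fin m) ℝ) (hn : ∀ a, 2 ≤ n a) {L : ℝ} (hL : 0 < L)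
    (hLn : ∀ a, L ≤ n a) (r : ℝ) (x : (a : Fin K) × Fin (n a)) :
    ∑ y : (a : Fin K) × Fin (n a), (r * pairCoef G n x y) ^ 2 * pairTrace B x.1 y.1 ≤
      r ^ 2 * (nullVar G n B / 2) / L := by
  rw [sum_pairCoef_sq_mul G B hn, nullVar, mul_div_cancel_left₀ _ (by norm_num : (2 : ℝ) ≠ 0)]
  have h1 : ∑ b, (Gᵀ * G) x.1 b ^ 2 / pairCount n x.1 b * pairTrace B x.1 b ≤
      ∑ a, ∑ b, (Gᵀ * G) a b ^ 2 / pairCount n a b * pairTrace B a b :=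
    Finset.single_le_sum (f := fun a => ∑ b, (Gᵀ * G) a b ^ 2 / pairCount n a b * pairTrace B a b)
      (fun a _ => Finset.sum_nonneg fun b _ => pairSum_nonneg G B hn a b) (Finset.mem_univ x.1)
  have h0 : 0 ≤ ∑ b, (Gᵀ * G) x.1 b ^ 2 / pairCount n x.1 b * pairTrace B x.1 b :=
    Finset.sum_nonneg fun b _ => pairSum_nonneg G B hn x.1 b
  exact div_le_div₀ (mul_nonneg (sq_nonneg r) (h0.trans h1))
    (mul_le_mul_of_nonneg_left h1 (sq_nonneg r)) hL (hLn x.1)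

lemma sum_sum_ker_sq (G : Matrix (Fin q) (Fin K) ℝ) (r : ℝ)
    (z : (a : Fin K) × Fin (n a) → Fin p → ℝ) :
    ∑ x, ∑ y, ker (dotKer fun x y => r * pairCoef G n x y) x y z ^ 2 =
      r ^ 2 * ∑ a, ∑ b, (Gᵀ * G) a b ^ 2 / pairCount n a b * (gramSq a b z / pairCount n a b) := by
  rw [Fintype.sum_sigma, Finset.mul_sum]
  refine Finset.sum_congr rfl fun a _ => ?_
  simp only [Fintype.sum_sigma]
  rw [Finset.sum_comm, Finset.mul_sum]
  refine Finset.sum_congr rfl fun b _ => ?_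
  simp only [gramSq, Finset.mul_sum, Finset.sum_div]
  refine Finset.sum_congr rfl fun i _ => Finset.sum_congr rfl fun j _ => ?_
  simp only [ker, dotKer, pairCoef, offGram]
  ring

section Moments

variable {ν : (a : Fin K) × Fin (n a) → Measure (Fin p → ℝ)} [∀ x, IsProbabilityMeasure (ν x)]
  {B : Fin K → Matrix (Fin p) (Fin m) ℝ} {C δ : ℝ}

variable (hν : ∀ x, LinearLaw (ν x) (B x.1) C) (hδ0 : 0 ≤ δ)
  (hδ : ∀ a b c, ((B a * (B a)ᵀ) * (B b * (B b)ᵀ) * (B a * (B a)ᵀ) * (B c * (B c)ᵀ)).trace ≤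
    δ ^ 2 * (pairTrace B a b * pairTrace B a c))
include hν hδ0 hδ

/-- Relative consistency of the variance estimator, with an explicit rate. -/
lemma measure_varEst_error_le (G : Matrix (Fin q) (Fin K) ℝ) {L : ℝ} (hL : 4 ≤ L)
    (hLn : ∀ a, L ≤ n a) (hpos : 0 < nullVar G n B) {ε : ℝ} (hε : 0 < ε) :
    (Measure.pi ν).real {z | ε * nullVar G n B < |varEst G z - nullVar G n B|} ≤
      (42 / (L - 3) + 2 * C ^ 2 / √L) / ε := by
  have hn : ∀ a, 2 ≤ n a := fun a => by
    have : (4 : ℝ) ≤ n a := hL.trans (hLn a)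
    have : 4 ≤ n a := by exact_mod_cast this
    omega
  have hL0 : 0 < L := by linarith
  have h := degenerateKernels_pairCoef hν hδ0 hδ G 1
  set κ : (a : Fin K) × Fin (n a) → (a : Fin K) × Fin (n a) → (Fin p → ℝ) → (Fin p → ℝ) → ℝ :=
    dotKer fun x y => 1 * pairCoef G n x y with hκ
  set V : (a : Fin K) × Fin (n a) → (a : Fin K) × Fin (n a) → ℝ :=
    fun x y => (1 * pairCoef G n x y) ^ 2 * pairTrace B x.1 y.1 with hV
  set s2 := nullVar G n B with hs2
  have hSV : ∑ x, ∑ y, V x y = s2 / 2 := by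
    rw [hV, sum_sum_pairCoef_sq_mul G B hn]; ring
  -- the fluctuation of the sum of the squared kernels, whose mean is `σ² / 2`
  set F : ((a : Fin K) × Fin (n a) → Fin p → ℝ) → ℝ :=
    fun z => ∑ x, ∑ y, (ker κ x y z ^ 2 - V x y) with hF
  have hFm : MemLp F 2 (Measure.pi ν) :=
    memLp_finsetSum _ fun x _ => memLp_finsetSum _ fun y _ => h.sq_sub_memLp x y
  have hF2 : ∫ z, F z ^ 2 ∂Measure.pi ν ≤ (C ^ 2 * (s2 / √L)) ^ 2 := by
    refine h.integral_sq_sum_sq_sub_le.trans ?_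
    have hrow : ∀ x, ∑ y, V x y ≤ s2 / 2 / L := by
      intro x
      have := sum_pairCoef_sq_mul_le G B hn hL0 hLn 1 x
      simpa [hV] using this
    have h0 : ∀ x, 0 ≤ ∑ y, V x y := fun x => Finset.sum_nonneg fun y _ => h.V_nonneg x y
    have : ∑ x, (∑ y, V x y) ^ 2 ≤ s2 / 2 / L * (s2 / 2) := by
      rw [← hSV, Finset.mul_sum]
      refine Finset.sum_le_sum fun x _ => ?_
      rw [pow_two, hSV]
      exact mul_le_mul_of_nonneg_right (hrow x) (h0 x)
    refine (mul_le_mul_of_nonneg_left this (by positivity)).trans (le_of_eq ?_)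
    rw [mul_pow, div_pow, Real.sq_sqrt hL0.le]
    field_simp
    ring
  have hF1 : ∫ z, |F z| ∂Measure.pi ν ≤ C ^ 2 * (s2 / √L) := by
    have h1 := abs_integral_mul_le_sqrt hFm.norm (memLp_const (1 : ℝ) : MemLp _ 2 (Measure.pi ν))
    simp only [Real.norm_eq_abs, mul_one, sq_abs, one_pow, integral_const, probReal_univ, smul_eq_mul] at h1
    refine (le_abs_self _).trans (h1.trans ?_)
    simp only [Real.sqrt_one, mul_one]
    exact Real.sqrt_le_iff.2 ⟨by positivity, hF2⟩
  -- the difference between the estimator and the sum of the squared kernels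
  set w : Fin K → Fin K → ℝ := fun a b => (Gᵀ * G) a b ^ 2 / pairCount n a b with hw
  have hw0 : ∀ a b, 0 ≤ w a b := fun a b => div_nonneg (sq_nonneg _) (pairCount_pos hn a b).le
  set U : Fin K → Fin K → ((a : Fin K) × Fin (n a) → Fin p → ℝ) → ℝ := fun a b z =>
    6 / (L - 3) * ((gramSq a b z + gramRow a b z + gramRow b a z + gramSum a b z ^ 2) /
        ((n a : ℝ) * n b)) with hU
  have hUi := fun a b => integral_pairEst_error_le hν hδ0 hδ hL hLn a b
  have hUint : Integrable (fun z => ∑ a, ∑ b, w a b * U a b z) (Measure.pi ν) :=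
    integrable_finsetSum _ fun a _ => integrable_finsetSum _ fun b _ => (hUi a b).1.const_mul _
  have hUle : ∫ z, ∑ a, ∑ b, w a b * U a b z ∂Measure.pi ν ≤ 42 / (L - 3) * (s2 / 2) := by
    rw [integral_finsetSum _ fun a _ => integrable_finsetSum _ fun b _ => (hUi a b).1.const_mul _,
      hs2, nullVar, mul_div_cancel_left₀ _ (by norm_num : (2 : ℝ) ≠ 0), Finset.mul_sum]
    refine Finset.sum_le_sum fun a _ => ?_
    rw [integral_finsetSum _ fun b _ => (hUi a b).1.const_mul _, Finset.mul_sum]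
    refine Finset.sum_le_sum fun b _ => ?_
    rw [integral_const_mul]
    refine (mul_le_mul_of_nonneg_left (hUi a b).2 (hw0 a b)).trans (le_of_eq (by ring))
  have hpt : ∀ z, |varEst G z - s2| ≤ 2 * (∑ a, ∑ b, w a b * U a b z) + 2 * |F z| := by
    intro z
    have e1 : F z = (∑ a, ∑ b, w a b * (gramSq a b z / pairCount n a b)) - s2 / 2 := by
      rw [← hSV, hF]
      simp only [Finset.sum_sub_distrib]
      rw [hκ, sum_sum_ker_sq]; ring
    have e2 : varEst G z - s2 =
        2 * (∑ a, ∑ b, w a b * (pairEst a b z - gramSq a b z / pairCount n a b)) + 2 * F z := by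
      rw [e1, varEst]
      simp only [mul_sub, Finset.sum_sub_distrib]
      ring
    rw [e2]
    refine (abs_add_le _ _).trans ?_
    rw [abs_mul, abs_mul, abs_two]
    gcongr
    refine (Finset.abs_sum_le_sum_abs _ _).trans (Finset.sum_le_sum fun a _ => ?_)
    refine (Finset.abs_sum_le_sum_abs _ _).trans (Finset.sum_le_sum fun b _ => ?_)
    rw [abs_mul, abs_of_nonneg (hw0 a b)]
    exact mul_le_mul_of_nonneg_left (abs_pairEst_sub_le hL hLn a b z) (hw0 a b)
  -- Markov's inequality
  have hFi : Integrable (fun z => |F z|) (Measure.pi ν) := (hFm.integrable (by norm_num)).abs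
  have hint := (hUint.const_mul 2).fun_add (hFi.const_mul 2)
  have hmarkov := mul_meas_ge_le_integral_of_nonneg
    (Eventually.of_forall fun z => (abs_nonneg _).trans (hpt z)) hint (ε * s2)
  rw [integral_add (hUint.const_mul 2) (hFi.const_mul 2), integral_const_mul,
    integral_const_mul] at hmarkov
  have hsub : (Measure.pi ν).real {z | ε * s2 < |varEst G z - s2|} ≤ (Measure.pi ν).real
      {z | ε * s2 ≤ 2 * (∑ a, ∑ b, w a b * U a b z) + 2 * |F z|} :=
    measureReal_mono (fun z hz => le_of_lt (lt_of_lt_of_le hz (hpt z)))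
  rw [le_div_iff₀ hε]
  have h3 : ε * s2 * (Measure.pi ν).real {z | ε * s2 < |varEst G z - s2|} ≤
      2 * (42 / (L - 3) * (s2 / 2)) + 2 * (C ^ 2 * (s2 / √L)) :=
    (mul_le_mul_of_nonneg_left hsub (by positivity)).trans (hmarkov.trans (by gcongr))
  have h4 : s2 * ((Measure.pi ν).real {z | ε * s2 < |varEst G z - s2|} * ε) ≤
      s2 * (42 / (L - 3) + 2 * C ^ 2 / √L) := by
    refine le_trans (le_of_eq (by ring)) (h3.trans (le_of_eq (by ring)))
  exact le_of_mul_le_mul_left h4 hpos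

end Moments

/-! ### The statistics under the factor model -/

section SquareRoot

open scoped MatrixOrder

variable {p : ℕ}

lemma weightMatrix_posSemidef {w : Fin p → ℝ → ℝ} (hw : ∀ i, IsWeightDensity (w i)) :
    (weightMatrix w).PosSemidef := by
  refine Matrix.PosSemidef.add (Matrix.PosSemidef.diagonal fun i => ?_) ?_
  · exact integral_nonneg fun x => mul_nonneg (sq_nonneg _) ((hw i).nonneg x)
  · simpa using Matrix.posSemidef_vecMulVec_self_star (fun i => densityMean (w i))

lemma matSqrt_mul_self {W : Matrix (Fin p) (Fin p) ℝ} (hW : W.PosSemidef) :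
    matSqrt W * matSqrt W = W :=
  CFC.sqrt_mul_sqrt_self W (Matrix.nonneg_iff_posSemidef.2 hW)

lemma transpose_matSqrt (W : Matrix (Fin p) (Fin p) ℝ) : (matSqrt W)ᵀ = matSqrt W :=
  (Matrix.nonneg_iff_posSemidef.1 (CFC.sqrt_nonneg W)).isHermitian

end SquareRoot

section Traces

variable {K p m : ℕ} {W : Matrix (Fin p) (Fin p) ℝ} {Sigma : Fin K → Matrix (Fin p) (Fin p) ℝ}
  {Gamma : Fin K → Matrix (Fin p) (Fin m) ℝ}
  (hVV : matSqrt W * matSqrt W = W) (hVt : (matSqrt W)ᵀ = matSqrt W)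
  (hload : ∀ a, Gamma a * (Gamma a)ᵀ = Sigma a)
include hVV hVt hload

lemma sqrt_mul_loading (a : Fin K) :
    (matSqrt W * Gamma a) * (matSqrt W * Gamma a)ᵀ = matSqrt W * Sigma a * matSqrt W := by
  rw [Matrix.transpose_mul, hVt, ← hload a]
  simp only [Matrix.mul_assoc]

lemma pairTrace_loading (a b : Fin K) :
    pairTrace (fun a => matSqrt W * Gamma a) a b = (W * Sigma a * W * Sigma b).trace := by
  rw [pairTrace, sqrt_mul_loading hVV hVt hload, sqrt_mul_loading hVV hVt hload]
  conv_rhs => rw [← hVV]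
  rw [← Matrix.mul_assoc, Matrix.trace_mul_comm]
  simp only [Matrix.mul_assoc]

lemma trace_loading_four (a b c : Fin K) :
    (((matSqrt W * Gamma a) * (matSqrt W * Gamma a)ᵀ) * ((matSqrt W * Gamma b) * (matSqrt W * Gamma b)ᵀ)
      * ((matSqrt W * Gamma a) * (matSqrt W * Gamma a)ᵀ) *
      ((matSqrt W * Gamma c) * (matSqrt W * Gamma c)ᵀ)).trace =
    (W * Sigma b * W * Sigma a * W * Sigma c * W * Sigma a).trace := by
  rw [sqrt_mul_loading hVV hVt hload, sqrt_mul_loading hVV hVt hload,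
    sqrt_mul_loading hVV hVt hload]
  have : (W * Sigma b * W * Sigma a * W * Sigma c * W * Sigma a).trace =
      (W * Sigma a * (W * Sigma b * W * Sigma a * W * Sigma c)).trace := by
    rw [Matrix.trace_mul_comm (W * Sigma a)]
    simp only [Matrix.mul_assoc]
  rw [this]
  conv_rhs => rw [← hVV]
  rw [← Matrix.mul_assoc, Matrix.trace_mul_comm]
  simp only [Matrix.mul_assoc]

end Traces

lemma quadForm_smul {I : Type*} [Fintype I] {p : ℕ} (c : I → I → ℝ) (r : ℝ) (z : I → Fin p → ℝ) :
    quadForm (dotKer fun x y => r * c x y) z = r * quadForm (dotKer c) z := by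
  simp only [quadForm, rowForm, ker, dotKer, Finset.mul_sum, mul_assoc]

section Model

variable {K q p m : ℕ} {n : Fin K → ℕ} {Ω : Type*} [MeasurableSpace Ω] {P : Measure Ω}
  [IsProbabilityMeasure P] {mu : Fin K → Fin p → ℝ} {Sigma : Fin K → Matrix (Fin p) (Fin p) ℝ}
  {Gamma : Fin K → Matrix (Fin p) (Fin m) ℝ} {Z : (a : Fin K) → Fin (n a) → Ω → Fin m → ℝ}
  {Y : (a : Fin K) → Fin (n a) → Ω → Fin p → ℝ} {Δ : ℝ}
  (hA1 : FactorModel n p m P mu Sigma Gamma Z Y)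

section Law

variable (W : Matrix (Fin p) (Fin p) ℝ)
include hA1

lemma stdObs_model (x : (a : Fin K) × Fin (n a)) (ω : Ω) :
    stdObs W mu (fun a i => Y a i ω) x = (matSqrt W * Gamma x.1) *ᵥ Z x.1 x.2 ω := by
  rw [stdObs, hA1.model, add_sub_cancel_right, Matrix.mulVec_mulVec]

lemma measurable_stdObs (x : (a : Fin K) × Fin (n a)) :
    Measurable fun ω => stdObs W mu (fun a i => Y a i ω) x := by
  simp_rw [stdObs_model hA1]
  exact (Continuous.matrix_mulVec continuous_const continuous_id).measurable.comp
    (hA1.measurable x.1 x.2)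

/-- The standardized observations are independent. -/
lemma map_stdObs : P.map (fun ω => stdObs W mu fun a i => Y a i ω) =
    Measure.pi fun x => P.map fun ω => stdObs W mu (fun a i => Y a i ω) x := by
  refine (iIndepFun_iff_map_fun_eq_pi_map fun x => (measurable_stdObs hA1 W x).aemeasurable).1 ?_
  have := hA1.indep.comp (fun x v => (matSqrt W * Gamma x.1) *ᵥ v)
    (fun x => (Continuous.matrix_mulVec continuous_const continuous_id).measurable)
  convert this using 2 with x
  ext1 ω
  exact stdObs_model hA1 W x ω

lemma isProbabilityMeasure_stdObs (x : (a : Fin K) × Fin (n a)) :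
    IsProbabilityMeasure (P.map fun ω => stdObs W mu (fun a i => Y a i ω) x) :=
  Measure.isProbabilityMeasure_map (measurable_stdObs hA1 W x).aemeasurable

lemma memLp_factor (hA2 : PseudoIndependent P Δ Z) (a : Fin K) (i : Fin (n a)) (s : Fin m) :
    MemLp (fun ω => Z a i ω s) 4 P :=
  memLp_four_of_integrable_pow
    ((measurable_pi_apply s).comp (hA1.measurable a i)).aestronglyMeasurable
    (hA2.integrable_fourth a i s)

/-- The law of a standardized observation is linear in a standardized pseudo-independent vector. -/
lemma linearLaw_stdObs (hA2 : PseudoIndependent P Δ Z) (x : (a : Fin K) × Fin (n a)) :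
    LinearLaw (P.map fun ω => stdObs W mu (fun a i => Y a i ω) x) (matSqrt W * Gamma x.1)
      (3 * √|3 + Δ|) := by
  have hX := memLp_factor hA1 hA2 x.1 x.2
  simp_rw [stdObs_model hA1]
  refine linearLaw_map _ (hA1.measurable x.1 x.2) hX (hA1.mean_zero x.1 x.2) (fun s t => ?_)
    (fun s => (hA2.fourth x.1 x.2 s).le) (fun a b c d hda hdb hdc => ?_)
  · have h2 : ∀ s, MemLp (fun ω => Z x.1 x.2 ω s) 2 P := fun s =>
      (hX s).mono_exponent (by norm_num)
    have := hA1.cov_one x.1 x.2 s t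
    rw [covariance_eq_sub (h2 s) (h2 t), hA1.mean_zero, zero_mul, sub_zero] at this
    exact this
  · exact integral_mul_four_eq_zero_of_factor hX (hA1.mean_zero x.1 x.2)
      (fun r s e => hA2.factor x.1 x.2 r s e) hda hdb hdc

lemma integral_comp_stdObs {F : Type*} [NormedAddCommGroup F] [NormedSpace ℝ F]
    {f : ((a : Fin K) × Fin (n a) → Fin p → ℝ) → F}
    (hf : AEStronglyMeasurable f
      (Measure.pi fun x => P.map fun ω => stdObs W mu (fun a i => Y a i ω) x)) :
    ∫ ω, f (stdObs W mu fun a i => Y a i ω) ∂P =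
      ∫ z, f z ∂(Measure.pi fun x => P.map fun ω => stdObs W mu (fun a i => Y a i ω) x) := by
  rw [← map_stdObs hA1 W] at hf ⊢
  exact (integral_map (measurable_pi_lambda _ fun x => measurable_stdObs hA1 W x).aemeasurable
    hf).symm

end Law

section Linear

variable (G : Matrix (Fin q) (Fin K) ℝ) (W : Matrix (Fin p) (Fin p) ℝ)
include hA1

/-- `S_n` is linear in the factors. -/
lemma linStat_eq_sum (hn : ∀ a, n a ≠ 0) (ω : Ω) :
    linStat G W mu (fun a i => Y a i ω) = ∑ k : Fin K × Fin p,
      ((dTheta G W *ᵥ stack mu) ᵥ* dTheta G W) k *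
        ((n k.1 : ℝ)⁻¹ * ∑ i, ∑ s, Gamma k.1 k.2 s * Z k.1 i ω s) := by
  rw [linStat, Matrix.dotProduct_mulVec, dotProduct]
  refine Finset.sum_congr rfl fun k _ => ?_
  congr 1
  have hk : (n k.1 : ℝ) ≠ 0 := by exact_mod_cast hn k.1
  have e : ∀ i, Y k.1 i ω k.2 = (∑ s, Gamma k.1 k.2 s * Z k.1 i ω s) + mu k.1 k.2 := by
    intro i
    rw [hA1.model, Pi.add_apply]; rfl
  simp only [Pi.sub_apply, stack, sampleMean, Pi.smul_apply, Finset.sum_apply, smul_eq_mul, e,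
    Finset.sum_add_distrib, Finset.sum_const, Finset.card_univ, Fintype.card_fin, nsmul_eq_mul]
  field_simp
  ring

lemma linStat_memLp (hA2 : PseudoIndependent P Δ Z) (hn : ∀ a, n a ≠ 0) :
    MemLp (fun ω => linStat G W mu (fun a i => Y a i ω)) 2 P := by
  simp_rw [linStat_eq_sum hA1 G W hn]
  exact memLp_finsetSum _ fun k _ => ((memLp_finsetSum _ fun i _ => memLp_finsetSum _ fun s _ =>
    ((memLp_factor hA1 hA2 k.1 i s).mono_exponent (by norm_num)).const_mul _).const_mul _).const_mul _

lemma integral_linStat (hA2 : PseudoIndependent P Δ Z) (hn : ∀ a, n a ≠ 0) :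
    ∫ ω, linStat G W mu (fun a i => Y a i ω) ∂P = 0 := by
  have hi : ∀ a i s, Integrable (fun ω => Z a i ω s) P := fun a i s =>
    (memLp_factor hA1 hA2 a i s).integrable (by norm_num)
  have hi2 : ∀ k : Fin K × Fin p, ∀ i, Integrable (fun ω => ∑ s, Gamma k.1 k.2 s * Z k.1 i ω s) P :=
    fun k i => integrable_finsetSum _ fun s _ => (hi _ _ _).const_mul _
  simp_rw [linStat_eq_sum hA1 G W hn]
  rw [integral_finsetSum _ fun k _ =>
    ((integrable_finsetSum _ fun i _ => hi2 k i).const_mul _).const_mul _]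
  refine Finset.sum_eq_zero fun k _ => ?_
  rw [integral_const_mul, integral_const_mul, integral_finsetSum _ fun i _ => hi2 k i,
    Finset.sum_eq_zero, mul_zero, mul_zero]
  intro i _
  rw [integral_finsetSum _ fun s _ => (hi _ _ _).const_mul _]
  refine Finset.sum_eq_zero fun s _ => ?_
  rw [integral_const_mul, hA1.mean_zero, mul_zero]

lemma measure_linStat_le (hA2 : PseudoIndependent P Δ Z) (hn : ∀ a, n a ≠ 0) {c : ℝ} (hc : 0 < c) :
    P.real {ω | c ≤ |linStat G W mu (fun a i => Y a i ω)|} ≤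
      Var[fun ω => linStat G W mu (fun a i => Y a i ω); P] / c ^ 2 := by
  have := meas_ge_le_variance_div_sq (linStat_memLp hA1 G W hA2 hn) hc
  simp only [integral_linStat hA1 G W hA2 hn, sub_zero] at this
  exact ENNReal.toReal_le_of_le_ofReal (div_nonneg (variance_nonneg _ _) (sq_nonneg _)) this

end Linear

section Quadratic

variable {W : Matrix (Fin p) (Fin p) ℝ}
  (hVV : matSqrt W * matSqrt W = W) (hVt : (matSqrt W)ᵀ = matSqrt W)
  (hA2 : PseudoIndependent P Δ Z) (hn : ∀ a, 2 ≤ n a) {δ : ℝ} (hδ0 : 0 ≤ δ)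
  (hδ : ∀ a b c, (W * Sigma b * W * Sigma a * W * Sigma c * W * Sigma a).trace ≤
    δ ^ 2 * ((W * Sigma b * W * Sigma a).trace * (W * Sigma c * W * Sigma a).trace))
include hA1 hVV hVt

include hδ in
/-- The trace condition, in terms of the covariance matrices of the standardized observations. -/
lemma trace_loading_four_le (a b c : Fin K) :
    (((matSqrt W * Gamma a) * (matSqrt W * Gamma a)ᵀ) * ((matSqrt W * Gamma b) * (matSqrt W * Gamma b)ᵀ)
      * ((matSqrt W * Gamma a) * (matSqrt W * Gamma a)ᵀ) *
      ((matSqrt W * Gamma c) * (matSqrt W * Gamma c)ᵀ)).trace ≤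
    δ ^ 2 * (pairTrace (fun a => matSqrt W * Gamma a) a b *
      pairTrace (fun a => matSqrt W * Gamma a) a c) := by
  rw [trace_loading_four hVV hVt hA1.loading, pairTrace_comm _ a b, pairTrace_comm _ a c,
    pairTrace_loading hVV hVt hA1.loading, pairTrace_loading hVV hVt hA1.loading]
  exact hδ a b c

include hA2 hδ0 hδ

lemma degenerateKernels_stdObs (G : Matrix (Fin q) (Fin K) ℝ) (r : ℝ) :
    DegenerateKernels (fun x => P.map fun ω => stdObs W mu (fun a i => Y a i ω) x)
    (dotKer fun x y => r * pairCoef G n x y)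
    (dotAvg (fun x y => r * pairCoef G n x y)
      fun x : (a : Fin K) × Fin (n a) => matSqrt W * Gamma x.1)
    (fun x y => (r * pairCoef G n x y) ^ 2 * pairTrace (fun a => matSqrt W * Gamma a) x.1 y.1)
    ((3 * √|3 + Δ|) ^ 2) δ :=
  have := isProbabilityMeasure_stdObs hA1 W
  degenerateKernels_pairCoef (B := fun a => matSqrt W * Gamma a)
    (linearLaw_stdObs hA1 W hA2) hδ0 (trace_loading_four_le hA1 hVV hVt hδ) G r

include hn

lemma nullStat_memLp (G : Matrix (Fin q) (Fin K) ℝ) :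
    MemLp (fun ω => nullStat G W mu (fun a i => Y a i ω)) 2 P := by
  have := isProbabilityMeasure_stdObs hA1 W
  have h := degenerateKernels_stdObs hA1 hVV hVt hA2 hδ0 hδ G 1
  have := h.quadForm_memLp.mono_exponent (p := 2) (by norm_num)
  rw [← map_stdObs hA1 W] at this
  have h2 := this.comp_of_map
    (measurable_pi_lambda _ fun x => measurable_stdObs hA1 W x).aemeasurable
  simp_rw [nullStat_eq_quadForm G hVV hVt hn]
  simp only [one_mul] at h2
  exact h2

lemma variance_nullStat (G : Matrix (Fin q) (Fin K) ℝ) :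
    Var[fun ω => nullStat G W mu (fun a i => Y a i ω); P] =
      nullVar G n (fun a => matSqrt W * Gamma a) := by
  have := isProbabilityMeasure_stdObs hA1 W
  have h := degenerateKernels_stdObs hA1 hVV hVt hA2 hδ0 hδ G 1
  have hm := h.quadForm_memLp.aestronglyMeasurable
  have e0 := integral_comp_stdObs hA1 W hm
  have e2 := integral_comp_stdObs hA1 W (hm.pow 2)
  simp only [Pi.pow_apply] at e2
  rw [h.integral_quadForm] at e0
  rw [h.integral_quadForm_sq, sum_sum_pairCoef_sq_mul G _ hn] at e2
  simp only [one_mul] at e0 e2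
  have hnull := nullStat_memLp hA1 hVV hVt hA2 hn hδ0 hδ G
  simp_rw [← nullStat_eq_quadForm G hVV hVt hn] at e0 e2
  rw [variance_of_integral_eq_zero hnull.aestronglyMeasurable.aemeasurable e0, e2]
  ring

/-- Quantitative central limit theorem for `T_{n0} / σ(T_{n0})`, in terms of the characteristic
function. -/
lemma norm_charFun_nullStat_sub_le (G : Matrix (Fin q) (Fin K) ℝ) {L : ℝ} (hL : 0 < L)
    (hLn : ∀ a, L ≤ n a) (hpos : 0 < nullVar G n (fun a => matSqrt W * Gamma a)) (u : ℝ) :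
    ‖∫ ω, cexpI u (nullStat G W mu (fun a i => Y a i ω) /
        √(nullVar G n fun a => matSqrt W * Gamma a)) ∂P - ↑(Real.exp (-(u ^ 2 / 2)))‖ ≤
      u ^ 2 * √(348 * (((3 * √|3 + Δ|) ^ 2) ^ 2 + δ ^ 2) * (1 / (2 * L)) + 12 * δ ^ 2) +
        |u| ^ 3 * (3 * (1 + 9 * ((3 * √|3 + Δ|) ^ 2) ^ 2) * √(1 / (2 * L))) := by
  have := isProbabilityMeasure_stdObs hA1 W
  set σ2 := nullVar G n fun a => matSqrt W * Gamma a with hσ2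
  have hr : (√σ2)⁻¹ ^ 2 * (σ2 / 2) = 1 / 2 := by
    rw [inv_pow, Real.sq_sqrt hpos.le]; field_simp
  have h := degenerateKernels_stdObs hA1 hVV hVt hA2 hδ0 hδ G (√σ2)⁻¹
  have hmain := h.norm_charFun_sub_le (η := 1 / (2 * L)) (by positivity)
    (by rw [sum_sum_pairCoef_sq_mul G _ hn, ← hσ2, hr])
    (fun x => (sum_pairCoef_sq_mul_le G _ hn hL hLn _ x).trans (le_of_eq (by
      rw [← hσ2, hr]; field_simp))) u
  have e := integral_comp_stdObs hA1 W (f := fun z => cexpI u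
    (quadForm (dotKer fun x y => (√σ2)⁻¹ * pairCoef G n x y) z))
    ((measurable_cexpI u).comp_aemeasurable
      h.quadForm_memLp.aestronglyMeasurable.aemeasurable).aestronglyMeasurable
  rw [← e] at hmain
  refine le_of_eq_of_le ?_ hmain
  congr 3
  ext ω
  rw [quadForm_smul, ← nullStat_eq_quadForm G hVV hVt hn, div_eq_inv_mul]

/-- Relative consistency of the variance estimator, evaluated at the observations. -/
lemma measure_varHat_error_le (G : Matrix (Fin q) (Fin K) ℝ) {L : ℝ} (hL : 4 ≤ L)
    (hLn : ∀ a, L ≤ n a) (hpos : 0 < nullVar G n (fun a => matSqrt W * Gamma a)) {ε : ℝ}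
    (hε : 0 < ε) :
    P.real {ω | ε * nullVar G n (fun a => matSqrt W * Gamma a) <
      |varHat G W (fun a i => Y a i ω) - nullVar G n (fun a => matSqrt W * Gamma a)|} ≤
      (42 / (L - 3) + 2 * (3 * √|3 + Δ|) ^ 2 / √L) / ε := by
  have := isProbabilityMeasure_stdObs hA1 W
  have hn4 : ∀ a, 4 ≤ n a := fun a => by
    have : (4 : ℝ) ≤ n a := hL.trans (hLn a)
    exact_mod_cast this
  have h := measure_varEst_error_le (B := fun a => matSqrt W * Gamma a)
    (linearLaw_stdObs hA1 W hA2) hδ0 (trace_loading_four_le hA1 hVV hVt hδ) G hL hLn hpos hε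
  refine le_trans ?_ h
  rw [← map_stdObs hA1 W]
  have hm : AEMeasurable (fun ω => stdObs W mu fun a i => Y a i ω) P :=
    (measurable_pi_lambda _ fun x => measurable_stdObs hA1 W x).aemeasurable
  have := Measure.isProbabilityMeasure_map hm
  have hle := Measure.le_map_apply hm {z | ε * nullVar G n (fun a => matSqrt W * Gamma a) <
    |varEst G z - nullVar G n (fun a => matSqrt W * Gamma a)|}
  -- the event need not be measurable: an outer estimate of its pushforward is enough
  refine le_trans (le_of_eq ?_) (ENNReal.toReal_mono (measure_ne_top _ _) hle)
  rw [Measure.real]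
  congr 2
  ext ω
  simp only [Set.mem_ofPred_eq, Set.mem_preimage, varEst, ← varHat_eq G hVV hVt hn4]

end Quadratic

end Model

/-! ### Passage to the limit -/

lemma abs_sqrt_div_sqrt_sub_one_le {v s : ℝ} (hv : 0 ≤ v) (hs : 0 < s) :
    |√v / √s - 1| ≤ |v - s| / s := by
  rw [← Real.sqrt_div hv]
  have h0 := Real.sqrt_nonneg (v / s)
  have h2 := Real.sq_sqrt (div_nonneg hv hs.le)
  have e : |v - s| / s = |√(v / s) - 1| * (√(v / s) + 1) := by
    rw [← abs_of_pos (show 0 < √(v / s) + 1 by linarith), ← abs_mul,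
      show (√(v / s) - 1) * (√(v / s) + 1) = √(v / s) ^ 2 - 1 by ring, h2]
    nth_rw 2 [← abs_of_pos hs]
    rw [← abs_div, sub_div, div_self hs.ne']
  rw [e]
  exact le_mul_of_one_le_right (abs_nonneg _) (by linarith)

/-- The rejection event in terms of the null part, where the linear part of the statistic and the
error of the variance estimator are moved into one small remainder. -/
lemma rejection_iff {T N S g v s z ε δ : ℝ} (hT : T = N + 2 * S + g) (hs : 0 < s) (hε : ε < 1)
    (hv : |v - s| ≤ ε * s) (hzε : |z| * ε ≤ δ / 2) (hS : |S| ≤ δ / 4 * √s) :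
    (z ≤ T / √v ↔ z - g / √s ≤ N / √s + (2 * S / √s - z * (√v / √s - 1))) ∧
      |2 * S / √s - z * (√v / √s - 1)| ≤ δ := by
  have hv0 : 0 < v := by
    have := (abs_le.1 hv).1
    nlinarith
  have hs' := Real.sqrt_pos.2 hs
  have hv' := Real.sqrt_pos.2 hv0
  constructor
  · rw [le_div_iff₀ hv', ← div_le_div_iff_of_pos_right hs', hT]
    have e1 : z * √v / √s = z * (√v / √s) := mul_div_assoc _ _ _
    have e2 : (N + 2 * S + g) / √s = N / √s + 2 * S / √s + g / √s := by rw [add_div, add_div]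
    rw [e1, e2]
    constructor <;> intro h <;> linarith
  · refine (abs_sub _ _).trans ?_
    have h1 : |2 * S / √s| ≤ δ / 2 := by
      rw [abs_div, abs_mul, abs_two, abs_of_pos hs', div_le_iff₀ hs']
      linarith
    have h2 : |z * (√v / √s - 1)| ≤ δ / 2 := by
      rw [abs_mul]
      refine (mul_le_mul_of_nonneg_left ((abs_sqrt_div_sqrt_sub_one_le hv0.le hs).trans
        ((div_le_iff₀ hs).2 hv)) (abs_nonneg z)).trans hzε
    linarith

section Limit

variable {K q : ℕ} {n : ℕ → Fin K → ℕ} {p m : ℕ → ℕ}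
  {Ω : ℕ → Type*} [∀ t, MeasurableSpace (Ω t)]
  {P : (t : ℕ) → Measure (Ω t)} [∀ t, IsProbabilityMeasure (P t)]
  {mu : (t : ℕ) → Fin K → Fin (p t) → ℝ}
  {Sigma : (t : ℕ) → Fin K → Matrix (Fin (p t)) (Fin (p t)) ℝ}
  {Gamma : (t : ℕ) → Fin K → Matrix (Fin (p t)) (Fin (m t)) ℝ}
  {Z : (t : ℕ) → (a : Fin K) → Fin (n t a) → Ω t → Fin (m t) → ℝ}
  {Y : (t : ℕ) → (a : Fin K) → Fin (n t a) → Ω t → Fin (p t) → ℝ}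
  {Δ : ℝ} {τ : Fin K → ℝ}

/-- Under balanced growth all sample sizes eventually exceed a diverging sequence. -/
lemma exists_sizes_ge (hn : Tendsto (fun t => totalSize (n t)) atTop atTop)
    (hτ : ∀ a, τ a ∈ Set.Ioo (0 : ℝ) 1)
    (hA3 : ∀ a, Tendsto (fun t => (n t a : ℝ) / (totalSize (n t) : ℝ)) atTop (𝓝 (τ a))) :
    ∃ L : ℕ → ℝ, Tendsto L atTop atTop ∧ ∀ᶠ t in atTop, ∀ a, L t ≤ n t a := by
  have hc : ∃ c > 0, ∀ a, c < τ a := by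
    cases isEmpty_or_nonempty (Fin K) with
    | inl h => exact ⟨1, one_pos, fun a => h.elim a⟩
    | inr h =>
      obtain ⟨a, ha⟩ := Finite.exists_min τ
      exact ⟨τ a / 2, half_pos (hτ a).1, fun b => (half_lt_self (hτ a).1).trans_le (ha b)⟩
  obtain ⟨c, hc0, hc⟩ := hc
  refine ⟨fun t => c * totalSize (n t),
    (tendsto_natCast_atTop_atTop.comp hn).const_mul_atTop hc0, ?_⟩
  refine eventually_all.2 fun a => ?_
  filter_upwards [(hA3 a).eventually (lt_mem_nhds (hc a)), hn.eventually_gt_atTop 0] with t ht h0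
  have : (0 : ℝ) < totalSize (n t) := by exact_mod_cast h0
  exact ((lt_div_iff₀ this).1 ht).le

variable (hA1 : ∀ t, FactorModel (n t) (p t) (m t) (P t) (mu t) (Sigma t) (Gamma t) (Z t) (Y t))
  {W : (t : ℕ) → Matrix (Fin (p t)) (Fin (p t)) ℝ} (hW : ∀ t, (W t).PosSemidef)
include hA1

lemma measurable_nullStat (G : Matrix (Fin q) (Fin K) ℝ) (t : ℕ) :
    Measurable fun ω => nullStat G (W t) (mu t) (fun a i => Y t a i ω) := by
  have hY : ∀ a i r, Measurable fun ω => Y t a i ω r := by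
    intro a i r
    simp_rw [(hA1 t).model, Pi.add_apply, mulVec, dotProduct]
    have := (hA1 t).measurable a i
    fun_prop
  have hY' : ∀ a i, Measurable fun ω => Y t a i ω := fun a i => measurable_pi_lambda _ (hY a i)
  simp only [nullStat, sqNorm, mulVec, dotProduct, stack, sampleMean, sampleCov, Matrix.trace,
    Matrix.diag_apply, Matrix.mul_apply, Matrix.smul_apply, Matrix.sum_apply,
    Matrix.vecMulVec_apply, Pi.sub_apply, Pi.smul_apply, Finset.sum_apply, smul_eq_mul]
  fun_prop

include hW

/-- The little-o trace condition, uniformly over the finitely many triples of samples; the traces on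
the right are nonnegative, so no absolute values are needed. -/
lemma eventually_trace_le
    (hA4 : ∀ a b c : Fin K,
      (fun t => (W t * Sigma t a * W t * Sigma t b * W t * Sigma t c * W t * Sigma t b).trace)
      =o[atTop]
      (fun t => (W t * Sigma t a * W t * Sigma t b).trace *
        (W t * Sigma t c * W t * Sigma t b).trace)) {δ : ℝ} (hδ : 0 < δ) :
    ∀ᶠ t in atTop, ∀ a b c,
      (W t * Sigma t b * W t * Sigma t a * W t * Sigma t c * W t * Sigma t a).trace ≤
      δ ^ 2 * ((W t * Sigma t b * W t * Sigma t a).trace *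
        (W t * Sigma t c * W t * Sigma t a).trace) := by
  refine eventually_all.2 fun a => eventually_all.2 fun b => eventually_all.2 fun c => ?_
  filter_upwards [(hA4 b a c).bound (pow_pos hδ 2)] with t ht
  have h0 : ∀ b, 0 ≤ (W t * Sigma t b * W t * Sigma t a).trace := fun b => by
    rw [← pairTrace_loading (matSqrt_mul_self (hW t)) (transpose_matSqrt (W t)) (hA1 t).loading]
    exact pairTrace_nonneg _ _ _
  rw [Real.norm_eq_abs, Real.norm_eq_abs, abs_of_nonneg (mul_nonneg (h0 b) (h0 c))] at ht
  exact (le_abs_self _).trans ht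

variable (hA2 : ∀ t, PseudoIndependent (P t) Δ (Z t))
  {L : ℕ → ℝ} (hL : Tendsto L atTop atTop) (hLn : ∀ᶠ t in atTop, ∀ a, L t ≤ n t a)
  (hA4 : ∀ a b c : Fin K,
    (fun t => (W t * Sigma t a * W t * Sigma t b * W t * Sigma t c * W t * Sigma t b).trace)
    =o[atTop]
    (fun t => (W t * Sigma t a * W t * Sigma t b).trace *
      (W t * Sigma t c * W t * Sigma t b).trace))
  (G : ℕ → Matrix (Fin q) (Fin K) ℝ)
  (hpos : ∀ᶠ t in atTop,
    0 < Var[fun ω => nullStat (G t) (W t) (mu t) (fun a i => Y t a i ω); P t])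
include hA2 hL hLn hA4 hpos

/-- Asymptotic normality of `T_{n0} / σ(T_{n0})`. -/
lemma tendsto_real_nullStat_le (x : ℝ) :
    Tendsto (fun t => (P t).real {ω | nullStat (G t) (W t) (mu t) (fun a i => Y t a i ω) /
      √(Var[fun ω => nullStat (G t) (W t) (mu t) (fun a i => Y t a i ω); P t]) ≤ x}) atTop
      (𝓝 (Phi x)) := by
  refine tendsto_real_le_Phi P _
    (fun t => ((measurable_nullStat hA1 (G t) t).div_const _).aemeasurable) (fun u => ?_) x
  rw [tendsto_iff_norm_sub_tendsto_zero, Metric.tendsto_nhds]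
  intro ε hε
  set C : ℝ := (3 * √|3 + Δ|) ^ 2 with hC
  -- with `δ` fixed and the sample sizes growing, only the contribution of `δ` is left
  have hδ : ∃ δ > 0, u ^ 2 * √(12 * δ ^ 2) < ε := by
    have : Tendsto (fun δ : ℝ => u ^ 2 * √(12 * δ ^ 2)) (𝓝[>] 0) (𝓝 0) := by
      refine tendsto_nhdsWithin_of_tendsto_nhds ?_
      have hc : Continuous fun δ : ℝ => u ^ 2 * √(12 * δ ^ 2) := by fun_prop
      simpa using hc.tendsto 0
    obtain ⟨δ, h1, h2⟩ := ((this.eventually (gt_mem_nhds hε)).and self_mem_nhdsWithin).exists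
    exact ⟨δ, h2, h1⟩
  obtain ⟨δ, hδ0, hδε⟩ := hδ
  have hη : Tendsto (fun t => 1 / (2 * L t)) atTop (𝓝 0) :=
    tendsto_const_nhds.div_atTop (hL.const_mul_atTop (by norm_num))
  have hlim : Tendsto (fun t => u ^ 2 * √(348 * (C ^ 2 + δ ^ 2) * (1 / (2 * L t)) + 12 * δ ^ 2) +
      |u| ^ 3 * (3 * (1 + 9 * C ^ 2) * √(1 / (2 * L t)))) atTop (𝓝 (u ^ 2 * √(12 * δ ^ 2))) := by
    have hc : Continuous fun η : ℝ => u ^ 2 * √(348 * (C ^ 2 + δ ^ 2) * η + 12 * δ ^ 2) +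
      |u| ^ 3 * (3 * (1 + 9 * C ^ 2) * √η) := by fun_prop
    have := (hc.tendsto 0).comp hη
    simp only [mul_zero, zero_add, Real.sqrt_zero, add_zero] at this
    exact this
  filter_upwards [hlim.eventually (gt_mem_nhds hδε), hLn, hL.eventually_ge_atTop 2,
    eventually_trace_le hA1 hW hA4 hδ0, hpos] with t h1 h2 h3 h4 h5
  have hn2 : ∀ a, 2 ≤ n t a := fun a => by exact_mod_cast h3.trans (h2 a)
  have hVV := matSqrt_mul_self (hW t)
  have hVt := transpose_matSqrt (W t)
  have hvar := variance_nullStat (hA1 t) hVV hVt (hA2 t) hn2 hδ0.le h4 (G t)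
  rw [hvar] at h5
  have := norm_charFun_nullStat_sub_le (hA1 t) hVV hVt (hA2 t) hn2 hδ0.le h4 (G t)
    (by linarith) h2 h5 u
  rw [Real.dist_eq, sub_zero, abs_of_nonneg (norm_nonneg _), hvar]
  exact this.trans_lt h1

/-- The rejection probability is asymptotically the normal one under local alternatives. -/
theorem tendsto_real_studentized_sub_Phi
    (hlocal :
      (fun t => Var[fun ω => linStat (G t) (W t) (mu t) (fun a i => Y t a i ω); P t])
      =o[atTop]
      (fun t => Var[fun ω => nullStat (G t) (W t) (mu t) (fun a i => Y t a i ω); P t])) (z : ℝ) :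
    Tendsto (fun t => (P t).real {ω | z ≤ studentized (G t) (W t) (fun a i => Y t a i ω)} -
      Phi (-(z - signal (G t) (W t) (mu t) /
        √(Var[fun ω => nullStat (G t) (W t) (mu t) (fun a i => Y t a i ω); P t])))) atTop
      (𝓝 0) := by
  set s : ℕ → ℝ := fun t =>
    Var[fun ω => nullStat (G t) (W t) (mu t) (fun a i => Y t a i ω); P t] with hs
  refine tendsto_real_sub_Phi P
    (fun t ω => nullStat (G t) (W t) (mu t) (fun a i => Y t a i ω) / √(s t))
    (fun t => ((measurable_nullStat hA1 (G t) t).div_const _).aemeasurable)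
    (tendsto_real_nullStat_le hA1 hW hA2 hL hLn hA4 G hpos)
    (fun t ω => 2 * linStat (G t) (W t) (mu t) (fun a i => Y t a i ω) / √(s t) -
      z * (√(varHat (G t) (W t) (fun a i => Y t a i ω)) / √(s t) - 1)) _ _ (fun δ hδ => ?_)
  -- the relative precision that is asked of the variance estimator
  obtain ⟨ε, hε0, hε1, hzε⟩ : ∃ ε > 0, ε < 1 ∧ |z| * ε ≤ δ / 2 := by
    refine ⟨min (1 / 2) (δ / (2 * (|z| + 1))), by positivity,
      (min_le_left _ _).trans_lt (by norm_num), ?_⟩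
    refine (mul_le_mul_of_nonneg_left (min_le_right _ _) (abs_nonneg z)).trans ?_
    rw [mul_div_assoc', div_le_div_iff₀ (by positivity) (by norm_num)]
    nlinarith [abs_nonneg z]
  set C : ℝ := 3 * √|3 + Δ| with hC
  have hb1 : Tendsto (fun t => (42 / (L t - 3) + 2 * C ^ 2 / √(L t)) / ε) atTop (𝓝 0) := by
    have h1 : Tendsto (fun t => 42 / (L t - 3)) atTop (𝓝 0) :=
      tendsto_const_nhds.div_atTop (tendsto_atTop_add_const_right _ (-3) hL)
    have h2 : Tendsto (fun t => 2 * C ^ 2 / √(L t)) atTop (𝓝 0) :=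
      tendsto_const_nhds.div_atTop (Real.tendsto_sqrt_atTop.comp hL)
    simpa using (h1.add h2).div_const ε
  have hb2 : Tendsto (fun t =>
      Var[fun ω => linStat (G t) (W t) (mu t) (fun a i => Y t a i ω); P t] / s t / (δ / 4) ^ 2)
      atTop (𝓝 0) := by
    simpa using hlocal.tendsto_div_nhds_zero.div_const ((δ / 4) ^ 2)
  have hb := hb1.add hb2
  rw [add_zero] at hb
  refine squeeze_zero' (Eventually.of_forall fun t => measureReal_nonneg) ?_ hb
  filter_upwards [hLn, hL.eventually_ge_atTop 4, eventually_trace_le hA1 hW hA4 one_pos, hpos]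
    with t h2 h3 h4 h5
  have hn2 : ∀ a, 2 ≤ n t a := fun a => by
    have : (2 : ℝ) ≤ n t a := le_trans (by linarith) (h2 a)
    exact_mod_cast this
  have hVV := matSqrt_mul_self (hW t)
  have hVt := transpose_matSqrt (W t)
  have hvar := variance_nullStat (hA1 t) hVV hVt (hA2 t) hn2 zero_le_one h4 (G t)
  have e1 := measure_varHat_error_le (hA1 t) hVV hVt (hA2 t) hn2 zero_le_one h4 (G t) h3 h2
    (hvar ▸ h5) hε0
  rw [← hvar] at e1
  have hst : 0 < s t := h5
  have e2 := measure_linStat_le (hA1 t) (G t) (W t) (hA2 t) (fun a => by have := hn2 a; omega)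
    (mul_pos (by linarith : 0 < δ / 4) (Real.sqrt_pos.2 hst))
  rw [mul_pow, Real.sq_sqrt hst.le, mul_comm ((δ / 4) ^ 2), ← div_div] at e2
  refine le_trans (measureReal_mono ?_ (measure_ne_top _ _))
    ((measureReal_union_le _ _).trans (add_le_add e1 e2))
  intro ω hω
  by_contra hno
  simp only [Set.mem_union, Set.mem_ofPred_eq, not_or, not_lt, not_le] at hno
  refine hω ?_
  exact rejection_iff (testStat_decomp (G t) hVV hVt hn2 (mu t) _) hst hε1 hno.1 hzε hno.2.le

end Limit

end

end GLHT

theorem theorem2p4 {K q : ℕ} (hqK : q < K)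
    -- the known coefficient matrix, of full row rank, and the exponent in its normalization
    (G₀ : Matrix (Fin q) (Fin K) ℝ) (hG₀ : G₀.rank = q)
    (e : ℝ) (he : e = -(1 / 2) ∨ e = 1 / 2)
    -- sample sizes and dimensions at stage `t`
    (n : ℕ → Fin K → ℕ) (p m : ℕ → ℕ)
    -- weight densities at stage `t`
    (w : (t : ℕ) → Fin (p t) → ℝ → ℝ) (hw : ∀ t i, GLHT.IsWeightDensity (w t i))
    -- the populations and the samples at stage `t`
    {Ω : ℕ → Type*} [∀ t, MeasurableSpace (Ω t)]
    (P : (t : ℕ) → Measure (Ω t)) [∀ t, IsProbabilityMeasure (P t)]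
    (mu : (t : ℕ) → Fin K → Fin (p t) → ℝ)
    (Sigma : (t : ℕ) → Fin K → Matrix (Fin (p t)) (Fin (p t)) ℝ)
    (Gamma : (t : ℕ) → Fin K → Matrix (Fin (p t)) (Fin (m t)) ℝ)
    (Z : (t : ℕ) → (a : Fin K) → Fin (n t a) → Ω t → Fin (m t) → ℝ)
    (Y : (t : ℕ) → (a : Fin K) → Fin (n t a) → Ω t → Fin (p t) → ℝ)
    -- `n, p → ∞`
    (hn : Tendsto (fun t => GLHT.totalSize (n t)) atTop atTop)
    (hp : Tendsto p atTop atTop)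
    -- (A1), (A2)
    (hA1 : ∀ t, GLHT.FactorModel (n t) (p t) (m t) (P t) (mu t) (Sigma t) (Gamma t) (Z t) (Y t))
    (Δ : ℝ) (hA2 : ∀ t, GLHT.PseudoIndependent (P t) Δ (Z t))
    -- (A3)
    (τ : Fin K → ℝ) (hτ : ∀ a, τ a ∈ Set.Ioo (0 : ℝ) 1)
    (hA3 : ∀ a, Tendsto (fun t => (n t a : ℝ) / (GLHT.totalSize (n t) : ℝ)) atTop (𝓝 (τ a)))
    -- (A4)
    (hA4 : ∀ a b c : Fin K,
      (fun t => (GLHT.weightMatrix (w t) * Sigma t a * GLHT.weightMatrix (w t) * Sigma t b *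
        GLHT.weightMatrix (w t) * Sigma t c * GLHT.weightMatrix (w t) * Sigma t b).trace)
      =o[atTop]
      (fun t =>
        (GLHT.weightMatrix (w t) * Sigma t a * GLHT.weightMatrix (w t) * Sigma t b).trace *
        (GLHT.weightMatrix (w t) * Sigma t c * GLHT.weightMatrix (w t) * Sigma t b).trace))
    -- the null variance is not degenerate
    (hpos : ∀ᶠ t in atTop,
      0 < Var[fun ω => GLHT.nullStat (GLHT.normCoef G₀ e (n t)) (GLHT.weightMatrix (w t)) (mu t)
        (fun a i => Y t a i ω); P t])
    -- the local alternative condition `Var(S_n) = o(σ²(T_{n0}))`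
    (hlocal :
      (fun t => Var[fun ω => GLHT.linStat (GLHT.normCoef G₀ e (n t)) (GLHT.weightMatrix (w t))
        (mu t) (fun a i => Y t a i ω); P t])
      =o[atTop]
      (fun t => Var[fun ω => GLHT.nullStat (GLHT.normCoef G₀ e (n t)) (GLHT.weightMatrix (w t))
        (mu t) (fun a i => Y t a i ω); P t]))
    -- the level and its upper quantile
    (lev z : ℝ) (hlev : lev ∈ Set.Ioo (0 : ℝ) 1) (hz : GLHT.Phi z = 1 - lev) :
    ∃ ε : ℕ → ℝ, Tendsto ε atTop (𝓝 0) ∧ ∀ t,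
      (P t).real {ω | z ≤ GLHT.studentized (GLHT.normCoef G₀ e (n t)) (GLHT.weightMatrix (w t))
        (fun a i => Y t a i ω)} =
      GLHT.Phi (-z +
        GLHT.signal (GLHT.normCoef G₀ e (n t)) (GLHT.weightMatrix (w t)) (mu t) /
        Real.sqrt (Var[fun ω => GLHT.nullStat (GLHT.normCoef G₀ e (n t))
          (GLHT.weightMatrix (w t)) (mu t) (fun a i => Y t a i ω); P t])) * (1 + ε t) := by
  obtain ⟨L, hL, hLn⟩ := GLHT.exists_sizes_ge hn hτ hA3
  have hmain := GLHT.tendsto_real_studentized_sub_Phi hA1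
    (fun t => GLHT.weightMatrix_posSemidef (hw t)) hA2 hL hLn hA4
    (fun t => GLHT.normCoef G₀ e (n t)) hpos hlocal z
  -- the limiting power is at least the level, so the absolute error is also a relative one
  have hle : ∀ g s : ℝ, 0 ≤ g → lev ≤ GLHT.Phi (-z + g / √s) := fun g s hg => by
    have h1 : GLHT.Phi (-z) = lev := by rw [GLHT.Phi_neg, hz]; ring
    rw [← h1]
    exact GLHT.Phi_mono (le_add_of_nonneg_right (div_nonneg hg (Real.sqrt_nonneg s)))
  refine ⟨fun t => (P t).real {ω | z ≤ GLHT.studentized (GLHT.normCoef G₀ e (n t))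
    (GLHT.weightMatrix (w t)) (fun a i => Y t a i ω)} / GLHT.Phi (-z +
        GLHT.signal (GLHT.normCoef G₀ e (n t)) (GLHT.weightMatrix (w t)) (mu t) /
        Real.sqrt (Var[fun ω => GLHT.nullStat (GLHT.normCoef G₀ e (n t))
          (GLHT.weightMatrix (w t)) (mu t) (fun a i => Y t a i ω); P t])) - 1, ?_, fun t => ?_⟩
  · have hbound := (hmain.norm).div_const lev
    rw [norm_zero, zero_div] at hbound
    refine squeeze_zero_norm (fun t => ?_) hbound
    have hsig : 0 ≤ GLHT.signal (GLHT.normCoef G₀ e (n t)) (GLHT.weightMatrix (w t)) (mu t) :=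
      Finset.sum_nonneg fun _ _ => mul_self_nonneg _
    set v := Var[fun ω => GLHT.nullStat (GLHT.normCoef G₀ e (n t))
      (GLHT.weightMatrix (w t)) (mu t) (fun a i => Y t a i ω); P t]
    set g := GLHT.signal (GLHT.normCoef G₀ e (n t)) (GLHT.weightMatrix (w t)) (mu t)
    have hΦ := GLHT.Phi_pos (-z + g / √v)
    rw [div_sub_one hΦ.ne', norm_div, Real.norm_of_nonneg hΦ.le,
      show -(z - g / √v) = -z + g / √v by ring]
    exact div_le_div_of_nonneg_left (norm_nonneg _) hlev.1 (hle g v hsig)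
  · have hΦ := (GLHT.Phi_pos (-z +
        GLHT.signal (GLHT.normCoef G₀ e (n t)) (GLHT.weightMatrix (w t)) (mu t) /
        Real.sqrt (Var[fun ω => GLHT.nullStat (GLHT.normCoef G₀ e (n t))
          (GLHT.weightMatrix (w t)) (mu t) (fun a i => Y t a i ω); P t]))).ne'
    rw [add_sub_cancel, mul_div_cancel₀ _ hΦ]
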